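/- Let $\Bbbk$ be an algebraically closed field of characteristic $0$, let $n>2$ be an odd integer, and let $q\in\Bbbk$ be a root of unity of order $n$ or $2n$. Let $\overline{U}_q$ be the small quantum group: the $\Bbbk$-algebra generated by $E,F,K,K^{-1}$ with relations $$KK^{-1}=K^{-1}K=1,\quad KEK^{-1}=q^2E,\quad KFK^{-1}=q^{-2}F,\quad EF-FE=\frac{K-K^{-1}}{q-q^{-1}},\quad E^n=F^n=0,\quad K^n=1,$$ with the Hopf algebra structure $\Delta(K)=K\otimes K$, $\Delta(E)=E\otimes K+1\otimes E$, $\Delta(F)=F\otimes 1+K^{-1}\otimes F$, $\varepsilon(K)=1$, $\varepsilon(E)=\varepsilon(F)=0$, $S(K)=K^{-1}$, $S(E)=-EK^{-1}$, $S(F)=-KF$. Let $r(\overline{U}_q)$ be its Green ring, that is, the abelian group generated by the isomorphism classes $[V]$ of finite dimensional left $\overline{U}_q$-modules modulo the relations $[U\oplus V]=[U]+[V]$, with multiplication $[U][V]=[U\otimes V]$, and let the projective class ring $r_p(\overline{U}_q)$ be the subring of $r(\overline{U}_q)$ generated by the classes of the projective modules and of the simple modules. Let $V_2$ be the two dimensional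 simple module with basis $m_1,m_2$ and action $Em_1=m_2$, $Em_2=0$, $Fm_1=0$, $Fm_2=q^nm_1$, $Km_1=q^{n-1}m_1$, $Km_2=q^{n+1}m_2$ (so $q^n=1$ if $q$ has order $n$, and $q^n=-1$ if $q$ has order $2n$). Let $I$ be the ideal of $\mathbb Z[y]$ generated by $$\Big(\sum_{i=0}^{\frac{n-1}{2}}(-1)^i\frac{n}{n-i}\binom{n-i}{i}y^{n-2i}-2\Big)\Big(\sum_{i=0}^{\frac{n-1}{2}}(-1)^i\binom{n-1-i}{i}y^{n-1-2i}\Big).$$ Then there is a ring isomorphism $\mathbb Z[y]/I\cong r_p(\overline{U}_q)$ that sends the class of $y$ to $[V_2]$. -/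

import Mathlib

open scoped TensorProduct Polynomial

universe u

noncomputable section

/-! Finite dimensional left modules over a `k`-algebra `H`, the Green ring of a bialgebra. -/

/-- A finite dimensional left module over the `k`-algebra `H`. -/
structure FDMod (k H : Type u) [Field k] [Ring H] [Algebra k H] : Type (u + 1) where
  carrier : Type u
  [addCommGroup : AddCommGroup carrier]
  [moduleBase : Module k carrier]
  [moduleAlg : Module H carrier]
  [isScalarTower : IsScalarTower k H carrier]
  [finite : Module.Finite k carrier]

namespace FDMod

instance (k H : Type u) [Field k] [Ring H] [Algebra k H] :
    CoeSort (FDMod k H) (Type u) := ⟨carrier⟩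

attribute [instance] addCommGroup moduleBase moduleAlg isScalarTower finite

section Basic

variable {k H : Type u} [Field k] [Ring H] [Algebra k H]

/-- The `H`-module attached to a representation `ρ : H → End_k(V)`; here `h • v = ρ h v`. -/
@[reducible] def ofAlgHom (V : Type u) [AddCommGroup V] [Module k V] [Module.Finite k V]
    (ρ : H →ₐ[k] Module.End k V) : FDMod k H :=
  letI : Module H V := Module.compHom V (ρ : H →+* Module.End k V)
  haveI : IsScalarTower k H V := ⟨fun c h v => by
    change ρ (c • h) v = c • ρ h v
    simp⟩
  { carrier := V }

/-- The direct sum of two modules. -/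
def directSum (V W : FDMod k H) : FDMod k H where
  carrier := V × W

/-- Isomorphism of `H`-modules. -/
def Iso (V W : FDMod k H) : Prop := Nonempty (V ≃ₗ[H] W)

instance isoSetoid (k H : Type u) [Field k] [Ring H] [Algebra k H] : Setoid (FDMod k H) where
  r := Iso
  iseqv :=
    { refl := fun V => ⟨LinearEquiv.refl H V⟩
      symm := fun ⟨e⟩ => ⟨e.symm⟩
      trans := fun ⟨e⟩ ⟨f⟩ => ⟨e.trans f⟩ }

theorem iso_of_equiv {V W : FDMod k H} (e : V ≃ₗ[k] W)
    (he : ∀ (h : H) (v : V), e (h • v) = h • e v) : V ≈ W :=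
  ⟨{ e with map_smul' := he }⟩

end Basic

section Tensor

variable {k H : Type u} [Field k] [Ring H] [Bialgebra k H]

/-- The action of `H ⊗ H` on `V ⊗ W`: `(a ⊗ b) (v ⊗ w) = (a • v) ⊗ (b • w)`. -/
def tensorAction (V W : Type u) [AddCommGroup V] [Module k V] [Module H V] [IsScalarTower k H V]
    [AddCommGroup W] [Module k W] [Module H W] [IsScalarTower k H W] :
    H ⊗[k] H →ₐ[k] Module.End k (V ⊗[k] W) :=
  (Module.endTensorEndAlgHom (R := k) (S := k) (A := k) (M := V) (N := W)).comp
    (Algebra.TensorProduct.map (Algebra.lsmul k k V) (Algebra.lsmul k k W))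

@[simp] theorem tensorAction_tmul (V W : Type u) [AddCommGroup V] [Module k V] [Module H V]
    [IsScalarTower k H V] [AddCommGroup W] [Module k W] [Module H W] [IsScalarTower k H W]
    (a b : H) (v : V) (w : W) :
    tensorAction V W (a ⊗ₜ[k] b) (v ⊗ₜ[k] w) = (a • v) ⊗ₜ[k] (b • w) := rfl

/-- The tensor product over `k` of two `H`-modules; `H` acts through the comultiplication. -/
def tensor (V W : FDMod k H) : FDMod k H :=
  ofAlgHom (V ⊗[k] W) ((tensorAction V W).comp (Bialgebra.comulAlgHom k H))

/-- The trivial module `k`; `H` acts through the counit. -/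
def triv (k H : Type u) [Field k] [Ring H] [Bialgebra k H] : FDMod k H :=
  ofAlgHom k ((Algebra.lsmul k k k).comp (Bialgebra.counitAlgHom k H))

/-- The underlying space of the tensor product is the tensor product of spaces. -/
def tensorEquiv (V W : FDMod k H) : tensor V W ≃ₗ[k] V ⊗[k] W := LinearEquiv.refl k _

/-- The underlying space of the trivial module is `k`. -/
def trivEquiv : triv k H ≃ₗ[k] k := LinearEquiv.refl k _

theorem tensorEquiv_smul (V W : FDMod k H) (h : H) (x : tensor V W) :
    tensorEquiv V W (h • x) =
      tensorAction V W (Coalgebra.comul (R := k) h) (tensorEquiv V W x) := rfl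

theorem trivEquiv_smul (h : H) (x : triv k H) :
    trivEquiv (h • x) = Coalgebra.counit (R := k) h * trivEquiv x := rfl

theorem tensor_congr {V V' W W' : FDMod k H} (hV : V ≈ V') (hW : W ≈ W') :
    tensor V W ≈ tensor V' W' := by
  obtain ⟨e⟩ := hV
  obtain ⟨f⟩ := hW
  let g : V ⊗[k] W ≃ₗ[k] V' ⊗[k] W' :=
    TensorProduct.congr (e.restrictScalars k) (f.restrictScalars k)
  have key : ∀ (x : H ⊗[k] H) (t : V ⊗[k] W),
      g (tensorAction V W x t) = tensorAction V' W' x (g t) := by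
    intro x t
    induction x with
    | zero => simp
    | add x y hx hy => simp [hx, hy]
    | tmul a b =>
      induction t with
      | zero => simp
      | add s t hs ht => simp [hs, ht]
      | tmul v w => simp [g]
  exact iso_of_equiv ((tensorEquiv V W).trans (g.trans (tensorEquiv V' W').symm))
    fun h v => key _ v

theorem tensor_assoc (U V W : FDMod k H) :
    tensor (tensor U V) W ≈ tensor U (tensor V W) := by
  let g : (U ⊗[k] V) ⊗[k] W ≃ₗ[k] U ⊗[k] (V ⊗[k] W) := TensorProduct.assoc k U V W
  let e1 : tensor (tensor U V) W ≃ₗ[k] (U ⊗[k] V) ⊗[k] W :=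
    (tensorEquiv (tensor U V) W).trans
      (TensorProduct.congr (tensorEquiv U V) (LinearEquiv.refl k W))
  let e2 : tensor U (tensor V W) ≃ₗ[k] U ⊗[k] (V ⊗[k] W) :=
    (tensorEquiv U (tensor V W)).trans
      (TensorProduct.congr (LinearEquiv.refl k U) (tensorEquiv V W))
  -- the action of `H ⊗ (H ⊗ H)` on `U ⊗ (V ⊗ W)`
  let A : H ⊗[k] (H ⊗[k] H) →ₐ[k] Module.End k (U ⊗[k] (V ⊗[k] W)) :=
    (Module.endTensorEndAlgHom (R := k) (S := k) (A := k) (M := U) (N := V ⊗[k] W)).comp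
      (Algebra.TensorProduct.map (Algebra.lsmul k k U) (tensorAction V W))
  have A_tmul : ∀ (a : H) (y : H ⊗[k] H) (u : U) (t : V ⊗[k] W),
      A (a ⊗ₜ y) (u ⊗ₜ t) = (a • u) ⊗ₜ (tensorAction V W y t) := fun _ _ _ _ => rfl
  -- right hand side
  have hR : ∀ (x : H ⊗[k] H) (t : tensor U (tensor V W)),
      TensorProduct.congr (LinearEquiv.refl k U) (tensorEquiv V W)
          (tensorAction U (tensor V W) x (tensorEquiv U (tensor V W) t)) =
        A ((Coalgebra.comul (R := k) (A := H)).lTensor H x) (e2 t) := by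
    intro x t
    obtain ⟨t, rfl⟩ := (tensorEquiv U (tensor V W)).symm.surjective t
    simp only [e2, LinearEquiv.trans_apply, LinearEquiv.apply_symm_apply]
    induction x with
    | zero => simp
    | add x y hx hy => simp [hx, hy]
    | tmul a b =>
      induction t with
      | zero => simp
      | add s t hs ht => simp only [map_add, hs, ht]
      | tmul u t =>
        simp only [tensorAction_tmul, TensorProduct.congr_tmul, LinearMap.lTensor_tmul, A_tmul,
          LinearEquiv.refl_apply, tensorEquiv_smul]
  have hL0 : ∀ (y : H ⊗[k] H) (b : H) (s : U ⊗[k] V) (w : W),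
      g ((tensorAction U V y s) ⊗ₜ (b • w)) =
        A (TensorProduct.assoc k H H H (y ⊗ₜ b)) (g (s ⊗ₜ w)) := by
    intro y b s w
    induction y with
    | zero => simp
    | add x y hx hy => simp only [map_add, LinearMap.add_apply, TensorProduct.add_tmul, hx, hy]
    | tmul a c =>
      induction s with
      | zero => simp
      | add s t hs ht => simp only [map_add, TensorProduct.add_tmul, hs, ht]
      | tmul u v => rfl
  have hL : ∀ (x : H ⊗[k] H) (t : tensor (tensor U V) W),
      g (TensorProduct.congr (tensorEquiv U V) (LinearEquiv.refl k W)
          (tensorAction (tensor U V) W x (tensorEquiv (tensor U V) W t))) =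
        A (TensorProduct.assoc k H H H
          ((Coalgebra.comul (R := k) (A := H)).rTensor H x)) (g (e1 t)) := by
    intro x t
    obtain ⟨t, rfl⟩ := (tensorEquiv (tensor U V) W).symm.surjective t
    simp only [e1, LinearEquiv.trans_apply, LinearEquiv.apply_symm_apply]
    induction x with
    | zero => simp
    | add x y hx hy => simp [hx, hy]
    | tmul a b =>
      induction t with
      | zero => simp
      | add s t hs ht => simp only [map_add, hs, ht]
      | tmul s w =>
        simp only [tensorAction_tmul, TensorProduct.congr_tmul, LinearMap.rTensor_tmul,
          LinearEquiv.refl_apply, tensorEquiv_smul, hL0]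
  refine iso_of_equiv (e1.trans (g.trans e2.symm)) fun h t => e2.injective ?_
  have h1 := hL (Coalgebra.comul (R := k) h) t
  have h2 := hR (Coalgebra.comul (R := k) h) ((e1.trans (g.trans e2.symm)) t)
  rw [Coalgebra.coassoc_apply] at h1
  simp only [LinearEquiv.trans_apply, LinearEquiv.apply_symm_apply] at h2 ⊢
  exact h1.trans h2.symm

theorem triv_tensor (V : FDMod k H) : tensor (triv k H) V ≈ V := by
  let e : tensor (triv k H) V ≃ₗ[k] V :=
    (tensorEquiv (triv k H) V).trans
      ((TensorProduct.congr trivEquiv (LinearEquiv.refl k V)).trans (TensorProduct.lid k V))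
  have key : ∀ (x : H ⊗[k] H) (t : triv k H ⊗[k] V),
      TensorProduct.lid k V (TensorProduct.congr trivEquiv (LinearEquiv.refl k V)
        (tensorAction (triv k H) V x t)) =
      (TensorProduct.lid k H ((Coalgebra.counit (R := k) (A := H)).rTensor H x)) •
        TensorProduct.lid k V (TensorProduct.congr trivEquiv (LinearEquiv.refl k V) t) := by
    intro x t
    induction x with
    | zero => simp
    | add x y hx hy => simp [hx, hy, add_smul]
    | tmul a b =>
      induction t with
      | zero => simp
      | add s t hs ht => simp only [map_add, hs, ht, smul_add]
      | tmul c v =>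
        simp only [tensorAction_tmul, TensorProduct.congr_tmul, LinearMap.rTensor_tmul,
          LinearEquiv.refl_apply, trivEquiv_smul, TensorProduct.lid_tmul, smul_assoc, mul_smul]
        rw [← algebraMap_smul H (trivEquiv c) v, ← algebraMap_smul H (trivEquiv c) (b • v),
          ← mul_smul, ← mul_smul, Algebra.commutes]
  refine iso_of_equiv e fun h t => ?_
  have := key (Coalgebra.comul (R := k) h) (tensorEquiv _ _ t)
  rw [Coalgebra.rTensor_counit_comul, TensorProduct.lid_tmul, one_smul] at this
  exact this

theorem tensor_triv (V : FDMod k H) : tensor V (triv k H) ≈ V := by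
  let e : tensor V (triv k H) ≃ₗ[k] V :=
    (tensorEquiv V (triv k H)).trans
      ((TensorProduct.congr (LinearEquiv.refl k V) trivEquiv).trans (TensorProduct.rid k V))
  have key : ∀ (x : H ⊗[k] H) (t : V ⊗[k] triv k H),
      TensorProduct.rid k V (TensorProduct.congr (LinearEquiv.refl k V) trivEquiv
        (tensorAction V (triv k H) x t)) =
      (TensorProduct.rid k H ((Coalgebra.counit (R := k) (A := H)).lTensor H x)) •
        TensorProduct.rid k V (TensorProduct.congr (LinearEquiv.refl k V) trivEquiv t) := by
    intro x t
    induction x with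
    | zero => simp
    | add x y hx hy => simp [hx, hy, add_smul]
    | tmul a b =>
      induction t with
      | zero => simp
      | add s t hs ht => simp only [map_add, hs, ht, smul_add]
      | tmul v c =>
        simp only [tensorAction_tmul, TensorProduct.congr_tmul, LinearMap.lTensor_tmul,
          LinearEquiv.refl_apply, trivEquiv_smul, TensorProduct.rid_tmul, smul_assoc, mul_smul]
        rw [← algebraMap_smul H (trivEquiv c) v, ← algebraMap_smul H (trivEquiv c) (a • v),
          ← mul_smul, ← mul_smul, Algebra.commutes]
  refine iso_of_equiv e fun h t => ?_
  have := key (Coalgebra.comul (R := k) h) (tensorEquiv _ _ t)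
  rw [Coalgebra.lTensor_counit_comul, TensorProduct.rid_tmul, one_smul] at this
  exact this

theorem directSum_tensor (U V W : FDMod k H) :
    tensor (directSum U V) W ≈ directSum (tensor U W) (tensor V W) := by
  let g : (U × V) ⊗[k] W ≃ₗ[k] (U ⊗[k] W) × (V ⊗[k] W) := TensorProduct.prodLeft k k U V W
  have key : ∀ (x : H ⊗[k] H) (t : (U × V) ⊗[k] W),
      g (tensorAction (U × V) W x t) =
        (tensorAction U W x (g t).1, tensorAction V W x (g t).2) := by
    intro x t
    induction x with
    | zero => simp; rfl
    | add x y hx hy => simp [hx, hy]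
    | tmul a b =>
      induction t with
      | zero => simp; rfl
      | add s t hs ht => simp [hs, ht]
      | tmul v w => rfl
  exact iso_of_equiv (V := tensor (directSum U V) W) (W := directSum (tensor U W) (tensor V W))
    g fun h v => key _ v

theorem tensor_directSum (U V W : FDMod k H) :
    tensor U (directSum V W) ≈ directSum (tensor U V) (tensor U W) := by
  let g : U ⊗[k] (V × W) ≃ₗ[k] (U ⊗[k] V) × (U ⊗[k] W) := TensorProduct.prodRight k k U V W
  have key : ∀ (x : H ⊗[k] H) (t : U ⊗[k] (V × W)),
      g (tensorAction U (V × W) x t) =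
        (tensorAction U V x (g t).1, tensorAction U W x (g t).2) := by
    intro x t
    induction x with
    | zero => simp; rfl
    | add x y hx hy => simp [hx, hy]
    | tmul a b =>
      induction t with
      | zero => simp; rfl
      | add s t hs ht => simp [hs, ht]
      | tmul v w => rfl
  exact iso_of_equiv (V := tensor U (directSum V W)) (W := directSum (tensor U V) (tensor U W))
    g fun h v => key _ v

end Tensor

end FDMod

/-- Isomorphism classes of finite dimensional `H`-modules. -/
def IsoClass (k H : Type u) [Field k] [Ring H] [Algebra k H] : Type (u + 1) :=
  Quotient (FDMod.isoSetoid k H)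

section Green

variable (k H : Type u) [Field k] [Ring H] [Bialgebra k H]

/-- Isomorphism classes form a monoid under the tensor product, with unit the class of the
trivial module. -/
instance IsoClass.instMonoid : Monoid (IsoClass k H) where
  mul := Quotient.map₂ FDMod.tensor fun _ _ h _ _ h' => FDMod.tensor_congr h h'
  one := Quotient.mk _ (FDMod.triv k H)
  mul_assoc := by
    rintro ⟨U⟩ ⟨V⟩ ⟨W⟩
    exact Quotient.sound (FDMod.tensor_assoc U V W)
  one_mul := by
    rintro ⟨V⟩
    exact Quotient.sound (FDMod.triv_tensor V)
  mul_one := by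
    rintro ⟨V⟩
    exact Quotient.sound (FDMod.tensor_triv V)

/-- The generator attached to a module of the free abelian group on the isomorphism classes. -/
def greenGen (V : FDMod k H) : FreeAbelianGroup (IsoClass k H) :=
  FreeAbelianGroup.of (Quotient.mk _ V)

/-- The subgroup generated by the relations `[U ⊕ V] - [U] - [V]`. -/
def greenRelations : AddSubgroup (FreeAbelianGroup (IsoClass k H)) :=
  AddSubgroup.closure
    {x | ∃ U V : FDMod k H, x = greenGen k H (U.directSum V) - greenGen k H U - greenGen k H V}

variable {k H}

theorem greenGen_mul (V W : FDMod k H) :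
    greenGen k H V * greenGen k H W = greenGen k H (V.tensor W) :=
  FreeAbelianGroup.of_mul_of _ _

theorem greenGen_eq {V W : FDMod k H} (h : V ≈ W) : greenGen k H V = greenGen k H W :=
  congrArg FreeAbelianGroup.of (Quotient.sound h)

theorem greenRelations_mul_left (x : FreeAbelianGroup (IsoClass k H))
    {y : FreeAbelianGroup (IsoClass k H)} (hy : y ∈ greenRelations k H) :
    x * y ∈ greenRelations k H := by
  induction hy using AddSubgroup.closure_induction with
  | zero => simp [zero_mem]
  | add a b _ _ ha hb => rw [mul_add]; exact add_mem ha hb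
  | neg a _ ha => rw [mul_neg]; exact neg_mem ha
  | mem y hy =>
    obtain ⟨U, V, rfl⟩ := hy
    induction x using FreeAbelianGroup.induction_on with
    | zero => simp [zero_mem]
    | neg a ha => rw [neg_mul]; exact neg_mem ha
    | add a b ha hb => rw [add_mul]; exact add_mem ha hb
    | of c =>
      obtain ⟨W⟩ := c
      change greenGen k H W * _ ∈ _
      rw [mul_sub, mul_sub, greenGen_mul, greenGen_mul, greenGen_mul,
        greenGen_eq (FDMod.tensor_directSum W U V)]
      exact AddSubgroup.subset_closure ⟨_, _, rfl⟩

theorem greenRelations_mul_right {x : FreeAbelianGroup (IsoClass k H)}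
    (y : FreeAbelianGroup (IsoClass k H)) (hx : x ∈ greenRelations k H) :
    x * y ∈ greenRelations k H := by
  induction hx using AddSubgroup.closure_induction with
  | zero => simp [zero_mem]
  | add a b _ _ ha hb => rw [add_mul]; exact add_mem ha hb
  | neg a _ ha => rw [neg_mul]; exact neg_mem ha
  | mem x hx =>
    obtain ⟨U, V, rfl⟩ := hx
    induction y using FreeAbelianGroup.induction_on with
    | zero => simp [zero_mem]
    | neg a ha => rw [mul_neg]; exact neg_mem ha
    | add a b ha hb => rw [mul_add]; exact add_mem ha hb
    | of c =>
      obtain ⟨W⟩ := c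
      change _ * greenGen k H W ∈ _
      rw [sub_mul, sub_mul, greenGen_mul, greenGen_mul, greenGen_mul,
        greenGen_eq (FDMod.directSum_tensor U V W)]
      exact AddSubgroup.subset_closure ⟨_, _, rfl⟩

variable (k H)

/-- The subgroup of relations is a two-sided ideal for the multiplication `[U][V] = [U ⊗ V]`. -/
def greenIdeal : TwoSidedIdeal (FreeAbelianGroup (IsoClass k H)) :=
  TwoSidedIdeal.mk' (greenRelations k H : Set (FreeAbelianGroup (IsoClass k H)))
    (zero_mem _) (fun hx hy => add_mem hx hy) (fun hx => neg_mem hx)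
    (fun hy => greenRelations_mul_left _ hy) (fun hx => greenRelations_mul_right _ hx)

/-- The Green ring `r(H)`: the abelian group generated by the isomorphism classes `[V]` of finite
dimensional `H`-modules modulo `[U ⊕ V] = [U] + [V]`, with `[U][V] = [U ⊗ V]`. -/
abbrev GreenRing : Type (u + 1) := (greenIdeal k H).ringCon.Quotient

variable {k H}

/-- The class `[V]` in the Green ring. -/
def greenClass (V : FDMod k H) : GreenRing k H :=
  (greenIdeal k H).ringCon.mk' (greenGen k H V)

variable (k H)

/-- The projective class ring `r_p(H)`: the subring of the Green ring generated by the classes of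
the projective modules and of the simple modules. -/
def projectiveClassRing : Subring (GreenRing k H) :=
  Subring.closure
    {x | ∃ V : FDMod k H, (Module.Projective H V ∨ IsSimpleModule H V) ∧ x = greenClass V}

end Green

/-! The `q`-binomial theorem at a root of unity. -/

/-- The Gaussian binomial coefficient `a + b` over `a`, at the parameter `Q`. -/
def gaussBinom {k : Type u} [CommRing k] (Q : k) : ℕ → ℕ → k
  | 0, _ => 1
  | _ + 1, 0 => 1
  | a + 1, b + 1 => gaussBinom Q a (b + 1) + Q ^ (a + 1) * gaussBinom Q (a + 1) b

section Gauss

variable {k : Type u} [CommRing k] (Q : k)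

theorem gaussBinom_zero_left (b : ℕ) : gaussBinom Q 0 b = 1 := by simp [gaussBinom]

theorem gaussBinom_zero_right (a : ℕ) : gaussBinom Q a 0 = 1 := by cases a <;> simp [gaussBinom]

theorem gaussBinom_absorb (s : ℕ) : ∀ a b : ℕ, a + b = s →
    (Q ^ (a + 1) - 1) * gaussBinom Q (a + 1) b = (Q ^ (a + b + 1) - 1) * gaussBinom Q a b ∧
    (Q ^ (b + 1) - 1) * gaussBinom Q a (b + 1) = (Q ^ (a + b + 1) - 1) * gaussBinom Q a b := by
  induction s with
  | zero =>
    intro a b h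
    obtain ⟨rfl, rfl⟩ : a = 0 ∧ b = 0 := by omega
    simp [gaussBinom]
  | succ s ih =>
    intro a b h
    constructor
    · cases b with
      | zero => simp [gaussBinom_zero_right]
      | succ b =>
        obtain ⟨h1, h2⟩ := ih a b (by omega)
        rw [gaussBinom]
        have e1 : Q ^ (a + (b + 1) + 1) = Q ^ (a + 1) * Q ^ (b + 1) := by ring
        have e2 : Q ^ (a + b + 1) = Q ^ a * Q ^ (b + 1) := by ring
        rw [e1]
        rw [e2] at h1 h2
        linear_combination Q ^ (a + 1) * h1 - Q ^ (a + 1) * h2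
    · cases a with
      | zero => simp [gaussBinom_zero_left]
      | succ a =>
        obtain ⟨h1, h2⟩ := ih a b (by omega)
        rw [gaussBinom]
        have e1 : Q ^ (a + 1 + b + 1) = Q ^ (a + 1) * Q ^ (b + 1) := by ring
        have e2 : Q ^ (a + b + 1) = Q ^ a * Q ^ (b + 1) := by ring
        rw [e1]
        rw [e2] at h1 h2
        linear_combination h2 - h1

theorem add_pow_of_skew {A : Type u} [Ring A] [Algebra k A] {x y : A} (h : y * x = Q • (x * y))
    (m : ℕ) : (x + y) ^ m =
      ∑ p ∈ Finset.HasAntidiagonal.antidiagonal m, gaussBinom Q p.1 p.2 • (x ^ p.1 * y ^ p.2) := by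
  have hyx : ∀ a : ℕ, y * x ^ a = Q ^ a • (x ^ a * y) := by
    intro a
    induction a with
    | zero => simp
    | succ a ih =>
      rw [pow_succ x, ← mul_assoc, ih, smul_mul_assoc, mul_assoc, h, mul_smul_comm, smul_smul,
        mul_assoc, pow_succ]
  induction m with
  | zero => simp [gaussBinom]
  | succ m ih =>
    have split : ∀ p ∈ Finset.HasAntidiagonal.antidiagonal (m + 1),
        gaussBinom Q p.1 p.2 • (x ^ p.1 * y ^ p.2) =
          (if p.1 = 0 then 0 else gaussBinom Q (p.1 - 1) p.2 • (x ^ p.1 * y ^ p.2)) +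
          (if p.2 = 0 then 0 else
            (Q ^ p.1 * gaussBinom Q p.1 (p.2 - 1)) • (x ^ p.1 * y ^ p.2)) := by
      rintro ⟨a, b⟩ hp
      rw [Finset.HasAntidiagonal.mem_antidiagonal] at hp
      cases a with
      | zero =>
        cases b with
        | zero => simp at hp
        | succ b => simp [gaussBinom]
      | succ a =>
        cases b with
        | zero => simp [gaussBinom_zero_right]
        | succ b => simp [gaussBinom, add_smul]
    rw [Finset.sum_congr rfl split, Finset.sum_add_distrib, Finset.Nat.sum_antidiagonal_succ,
      Finset.Nat.sum_antidiagonal_succ', pow_succ', ih, add_mul, Finset.mul_sum, Finset.mul_sum]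
    simp only [if_true, zero_add, Nat.succ_ne_zero, if_false, Nat.add_sub_cancel]
    congr 1
    · refine Finset.sum_congr rfl fun p _ => ?_
      rw [mul_smul_comm, ← mul_assoc, ← pow_succ']
    · refine Finset.sum_congr rfl fun p _ => ?_
      rw [mul_smul_comm, ← mul_assoc, hyx, smul_mul_assoc, smul_smul, mul_assoc, ← pow_succ',
        mul_comm]

theorem add_pow_of_skew_root {k : Type u} [Field k] {Q : k} {n : ℕ} (hQ : IsPrimitiveRoot Q n)
    (hn : 0 < n) {A : Type u} [Ring A] [Algebra k A] {x y : A} (h : y * x = Q • (x * y)) :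
    (x + y) ^ n = x ^ n + y ^ n := by
  rw [add_pow_of_skew Q h]
  have hz : ∀ a b : ℕ, (a + 1) + (b + 1) = n → gaussBinom Q (a + 1) (b + 1) = 0 := by
    intro a b hab
    have h1 := (gaussBinom_absorb Q _ a (b + 1) rfl).1
    rw [show a + (b + 1) + 1 = n by omega, hQ.pow_eq_one, sub_self, zero_mul] at h1
    exact (mul_eq_zero.mp h1).resolve_left
      (sub_ne_zero.mpr (hQ.pow_ne_one_of_pos_of_lt (by omega) (by omega)))
  obtain ⟨m, rfl⟩ : ∃ m, n = m + 1 := ⟨n - 1, by omega⟩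
  rw [Finset.Nat.sum_antidiagonal_succ, gaussBinom_zero_left]
  cases m with
  | zero => simp [gaussBinom, add_comm]
  | succ m =>
    rw [Finset.Nat.sum_antidiagonal_succ', gaussBinom_zero_right, Finset.sum_eq_zero]
    · simp [add_comm]
    · rintro ⟨a, b⟩ hp
      rw [Finset.HasAntidiagonal.mem_antidiagonal] at hp
      simp only at hp
      rw [hz a b (by omega), zero_smul]

theorem mul_pow_of_skew {k : Type u} [CommRing k] {A : Type u} [Ring A] [Algebra k A] {x y : A}
    {c : k} (h : y * x = c • (x * y)) (m : ℕ) : ∃ d : k, (x * y) ^ m = d • (x ^ m * y ^ m) := by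
  have hyx : ∀ a : ℕ, y * x ^ a = c ^ a • (x ^ a * y) := by
    intro a
    induction a with
    | zero => simp
    | succ a ih =>
      rw [pow_succ x, ← mul_assoc, ih, smul_mul_assoc, mul_assoc, h, mul_smul_comm, smul_smul,
        mul_assoc, pow_succ]
  induction m with
  | zero => exact ⟨1, by simp⟩
  | succ m ih =>
    obtain ⟨d, hd⟩ := ih
    refine ⟨d * c ^ m, ?_⟩
    rw [pow_succ' (x * y), hd, mul_smul_comm, mul_assoc, ← mul_assoc y, hyx, smul_mul_assoc,
      mul_smul_comm, smul_smul, mul_assoc, ← mul_assoc x, ← pow_succ', ← pow_succ']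

end Gauss

/-! The small quantum group `u_q(sl₂)`. -/

/-- The four algebra generators `E, F, K, K⁻¹`. -/
inductive QGen : Type
  | E | F | K | Kinv

namespace SmallQuantumGroup

/-- The defining relations of the small quantum group: those of `U_q(sl₂)`, together with
`E ^ n = 0`, `F ^ n = 0` and `K ^ n = 1`. -/
inductive Rel {k : Type u} [Field k] (q : k) (n : ℕ) :
    FreeAlgebra k QGen → FreeAlgebra k QGen → Prop
  | K_mul_Kinv : Rel q n (.ι k .K * .ι k .Kinv) 1
  | Kinv_mul_K : Rel q n (.ι k .Kinv * .ι k .K) 1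
  | K_E : Rel q n (.ι k .K * .ι k .E * .ι k .Kinv) (q ^ 2 • .ι k .E)
  | K_F : Rel q n (.ι k .K * .ι k .F * .ι k .Kinv) ((q ^ 2)⁻¹ • .ι k .F)
  | E_F : Rel q n (.ι k .E * .ι k .F - .ι k .F * .ι k .E)
      ((q - q⁻¹)⁻¹ • (.ι k .K - .ι k .Kinv))
  | E_pow : Rel q n (.ι k .E ^ n) 0
  | F_pow : Rel q n (.ι k .F ^ n) 0
  | K_pow : Rel q n (.ι k .K ^ n) 1

end SmallQuantumGroup

/-- The small quantum group `u_q(sl₂)` as an algebra: the quotient of `U_q(sl₂)` by the ideal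
generated by `E ^ n`, `F ^ n` and `K ^ n - 1`. -/
def SmallQuantumGroup {k : Type u} [Field k] (q : k) (n : ℕ) : Type u :=
  RingQuot (SmallQuantumGroup.Rel q n)

namespace SmallQuantumGroup

section Algebra

variable {k : Type u} [Field k] (q : k) (n : ℕ)

instance instRing : Ring (SmallQuantumGroup q n) :=
  inferInstanceAs (Ring (RingQuot (Rel q n)))

instance instAlgebra : Algebra k (SmallQuantumGroup q n) :=
  inferInstanceAs (Algebra k (RingQuot (Rel q n)))

/-- The projection of the free algebra onto the small quantum group. -/
def proj : FreeAlgebra k QGen →ₐ[k] SmallQuantumGroup q n :=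
  RingQuot.mkAlgHom k (Rel q n)

theorem proj_surjective : Function.Surjective (proj q n) := RingQuot.mkAlgHom_surjective k _

/-- The generator `E`. -/
def E : SmallQuantumGroup q n := proj q n (.ι k .E)
/-- The generator `F`. -/
def F : SmallQuantumGroup q n := proj q n (.ι k .F)
/-- The generator `K`. -/
def K : SmallQuantumGroup q n := proj q n (.ι k .K)
/-- The generator `K⁻¹`. -/
def Kinv : SmallQuantumGroup q n := proj q n (.ι k .Kinv)

theorem proj_rel {x y : FreeAlgebra k QGen} (h : Rel q n x y) : proj q n x = proj q n y :=
  RingQuot.mkAlgHom_rel k h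

theorem K_mul_Kinv : K q n * Kinv q n = 1 := by
  simpa [K, Kinv] using proj_rel q n .K_mul_Kinv
theorem Kinv_mul_K : Kinv q n * K q n = 1 := by
  simpa [K, Kinv] using proj_rel q n .Kinv_mul_K
theorem K_E : K q n * E q n * Kinv q n = q ^ 2 • E q n := by
  simpa [K, Kinv, E] using proj_rel q n .K_E
theorem K_F : K q n * F q n * Kinv q n = (q ^ 2)⁻¹ • F q n := by
  simpa [K, Kinv, F] using proj_rel q n .K_F
theorem E_F : E q n * F q n - F q n * E q n = (q - q⁻¹)⁻¹ • (K q n - Kinv q n) := by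
  simpa [K, Kinv, E, F] using proj_rel q n .E_F
theorem E_pow : E q n ^ n = 0 := by simpa [E] using proj_rel q n .E_pow
theorem F_pow : F q n ^ n = 0 := by simpa [F] using proj_rel q n .F_pow
theorem K_pow : K q n ^ n = 1 := by simpa [K] using proj_rel q n .K_pow

/-- Elements `e, f, t, t'` of an algebra that satisfy the defining relations. -/
structure Sat {A : Type u} [Ring A] [Algebra k A] (e f t t' : A) : Prop where
  t_t' : t * t' = 1
  t'_t : t' * t = 1
  t_e : t * e * t' = q ^ 2 • e
  t_f : t * f * t' = (q ^ 2)⁻¹ • f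
  e_f : e * f - f * e = (q - q⁻¹)⁻¹ • (t - t')
  e_pow : e ^ n = 0
  f_pow : f ^ n = 0
  t_pow : t ^ n = 1

variable {q n}

theorem sat : Sat q n (E q n) (F q n) (K q n) (Kinv q n) :=
  ⟨K_mul_Kinv q n, Kinv_mul_K q n, K_E q n, K_F q n, E_F q n, E_pow q n, F_pow q n, K_pow q n⟩

/-- The universal property of the small quantum group. -/
def lift {A : Type u} [Ring A] [Algebra k A] (e f t t' : A) (h : Sat q n e f t t') :
    SmallQuantumGroup q n →ₐ[k] A :=
  RingQuot.liftAlgHom k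
    ⟨FreeAlgebra.lift k (fun | .E => e | .F => f | .K => t | .Kinv => t'), by
      intro x y hxy
      cases hxy
      · simpa using h.t_t'
      · simpa using h.t'_t
      · simpa using h.t_e
      · simpa using h.t_f
      · simpa using h.e_f
      · simpa using h.e_pow
      · simpa using h.f_pow
      · simpa using h.t_pow⟩

section Lift

variable {A : Type u} [Ring A] [Algebra k A] {e f t t' : A} (h : Sat q n e f t t')

theorem lift_proj (x : FreeAlgebra k QGen) : lift e f t t' h (proj q n x) =
    FreeAlgebra.lift k (fun | .E => e | .F => f | .K => t | .Kinv => t') x :=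
  RingQuot.liftAlgHom_mkAlgHom_apply k _ _ x

@[simp] theorem lift_E : lift e f t t' h (E q n) = e := by simp [E, lift_proj]
@[simp] theorem lift_F : lift e f t t' h (F q n) = f := by simp [F, lift_proj]
@[simp] theorem lift_K : lift e f t t' h (K q n) = t := by simp [K, lift_proj]
@[simp] theorem lift_Kinv : lift e f t t' h (Kinv q n) = t' := by simp [Kinv, lift_proj]

end Lift

theorem algHom_ext {A : Type u} [Ring A] [Algebra k A] {φ ψ : SmallQuantumGroup q n →ₐ[k] A}
    (hE : φ (E q n) = ψ (E q n)) (hF : φ (F q n) = ψ (F q n)) (hK : φ (K q n) = ψ (K q n))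
    (hK' : φ (Kinv q n) = ψ (Kinv q n)) : φ = ψ := by
  have : φ.comp (proj q n) = ψ.comp (proj q n) := by
    apply FreeAlgebra.hom_ext
    funext x
    cases x
    · exact hE
    · exact hF
    · exact hK
    · exact hK'
  ext x
  obtain ⟨x, rfl⟩ := proj_surjective q n x
  exact DFunLike.congr_fun this x


namespace Sat

variable {A : Type u} [Ring A] [Algebra k A] {e f t t' : A}

theorem te (h : Sat q n e f t t') : t * e = q ^ 2 • (e * t) := by
  have := congrArg (· * t) h.t_e
  simpa [mul_assoc, h.t'_t] using this

theorem tf (h : Sat q n e f t t') : t * f = (q ^ 2)⁻¹ • (f * t) := by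
  have := congrArg (· * t) h.t_f
  simpa [mul_assoc, h.t'_t] using this

theorem t'e (h : Sat q n e f t t') (hq : q ≠ 0) : t' * e = (q ^ 2)⁻¹ • (e * t') := by
  have := congrArg (t' * ·) h.t_e
  simp only [← mul_assoc, h.t'_t, one_mul, mul_smul_comm] at this
  rw [this, smul_smul, inv_mul_cancel₀ (pow_ne_zero 2 hq), one_smul]

theorem t'f (h : Sat q n e f t t') (hq : q ≠ 0) : t' * f = q ^ 2 • (f * t') := by
  have := congrArg (t' * ·) h.t_f
  simp only [← mul_assoc, h.t'_t, one_mul, mul_smul_comm] at this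
  rw [this, smul_smul, mul_inv_cancel₀ (pow_ne_zero 2 hq), one_smul]

theorem t'_pow (h : Sat q n e f t t') : t' ^ n = 1 := by
  have h1 : (t * t') ^ n = t ^ n * t' ^ n :=
    ((show Commute t t' from h.t_t'.trans h.t'_t.symm)).mul_pow n
  rwa [h.t_t', one_pow, h.t_pow, one_mul, eq_comm] at h1

/-- The elements `E ⊗ K + 1 ⊗ E`, `F ⊗ 1 + K⁻¹ ⊗ F`, `K ⊗ K` satisfy the relations. -/
theorem comul (h : Sat q n e f t t') (hq : q ≠ 0) (hQ : IsPrimitiveRoot (q ^ 2) n) (hn : 0 < n) :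
    Sat q n (e ⊗ₜ[k] t + 1 ⊗ₜ[k] e) (f ⊗ₜ[k] 1 + t' ⊗ₜ[k] f) (t ⊗ₜ[k] t) (t' ⊗ₜ[k] t') where
  t_t' := by
    rw [Algebra.TensorProduct.tmul_mul_tmul, h.t_t', Algebra.TensorProduct.one_def]
  t'_t := by
    rw [Algebra.TensorProduct.tmul_mul_tmul, h.t'_t, Algebra.TensorProduct.one_def]
  t_e := by
    simp only [mul_add, add_mul, Algebra.TensorProduct.tmul_mul_tmul, h.t_e, h.t_t', mul_one,
      mul_assoc t t t', smul_add, TensorProduct.smul_tmul', TensorProduct.tmul_smul]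
  t_f := by
    simp only [mul_add, add_mul, Algebra.TensorProduct.tmul_mul_tmul, h.t_f, h.t_t', mul_one,
      one_mul, smul_add, TensorProduct.smul_tmul', TensorProduct.tmul_smul]
  e_f := by
    have h1 : (e * t') ⊗ₜ[k] (t * f) = (t' * e) ⊗ₜ[k] (f * t) := by
      rw [h.tf, h.t'e hq, TensorProduct.tmul_smul, TensorProduct.smul_tmul']
    have h2 : e * f = f * e + (q - q⁻¹)⁻¹ • (t - t') := by rw [← h.e_f]; abel
    simp only [mul_add, add_mul, Algebra.TensorProduct.tmul_mul_tmul, one_mul, mul_one, h1, h2,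
      TensorProduct.add_tmul, TensorProduct.tmul_add, TensorProduct.smul_tmul',
      TensorProduct.tmul_smul, TensorProduct.sub_tmul, TensorProduct.tmul_sub, smul_sub]
    abel
  e_pow := by
    rw [add_comm, add_pow_of_skew_root hQ hn, Algebra.TensorProduct.tmul_pow,
      Algebra.TensorProduct.tmul_pow, h.e_pow, TensorProduct.tmul_zero, TensorProduct.zero_tmul,
      add_zero]
    simp only [Algebra.TensorProduct.tmul_mul_tmul, one_mul, mul_one, h.te,
      TensorProduct.tmul_smul]
  f_pow := by
    rw [add_pow_of_skew_root hQ hn, Algebra.TensorProduct.tmul_pow,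
      Algebra.TensorProduct.tmul_pow, h.f_pow, TensorProduct.tmul_zero, TensorProduct.zero_tmul,
      add_zero]
    simp only [Algebra.TensorProduct.tmul_mul_tmul, one_mul, mul_one, h.t'f hq,
      TensorProduct.smul_tmul']
  t_pow := by
    rw [Algebra.TensorProduct.tmul_pow, h.t_pow, Algebra.TensorProduct.one_def]

open MulOpposite in
/-- The elements `-E K⁻¹`, `-K F`, `K⁻¹` satisfy the relations in the opposite algebra. -/
theorem antipode (h : Sat q n e f t t') (hq : q ≠ 0) :
    Sat q n (op (-(e * t'))) (op (-(t * f))) (op t') (op t) where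
  t_t' := by rw [← op_mul, h.t_t', op_one]
  t'_t := by rw [← op_mul, h.t'_t, op_one]
  t_e := by
    rw [← op_mul, ← op_mul, ← op_smul]
    congr 1
    rw [neg_mul, mul_neg, smul_neg, ← mul_assoc, ← mul_assoc, h.t_e, smul_mul_assoc]
  t_f := by
    rw [← op_mul, ← op_mul, ← op_smul]
    congr 1
    rw [neg_mul, mul_neg, smul_neg, h.t_f, mul_smul_comm]
  e_f := by
    rw [← op_mul, ← op_mul, ← op_sub, ← op_sub, ← op_smul]
    congr 1
    have h1 : t * f * (e * t') = f * e := by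
      calc t * f * (e * t') = (t * f * t') * (t * e * t') := by
            simp only [mul_assoc]
            rw [← mul_assoc t' t, h.t'_t, one_mul]
        _ = f * e := by
            rw [h.t_e, h.t_f, smul_mul_smul_comm, inv_mul_cancel₀ (pow_ne_zero 2 hq), one_smul]
    have h2 : e * t' * (t * f) = e * f := by
      rw [mul_assoc, ← mul_assoc t', h.t'_t, one_mul]
    rw [neg_mul_neg, neg_mul_neg, h1, h2, ← neg_sub t t', smul_neg, ← h.e_f, neg_sub]
  e_pow := by
    obtain ⟨d, hd⟩ := mul_pow_of_skew (h.t'e hq) n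
    rw [← op_pow, neg_pow, hd, h.e_pow, zero_mul, smul_zero, mul_zero, op_zero]
  f_pow := by
    have h1 : f * t = q ^ 2 • (t * f) := by
      rw [h.tf, smul_smul, mul_inv_cancel₀ (pow_ne_zero 2 hq), one_smul]
    obtain ⟨d, hd⟩ := mul_pow_of_skew h1 n
    rw [← op_pow, neg_pow, hd, h.f_pow, mul_zero, smul_zero, mul_zero, op_zero]
  t_pow := by rw [← op_pow, h.t'_pow, op_one]

end Sat

variable (q n) in
theorem induction_on {p : SmallQuantumGroup q n → Prop} (hc : ∀ c : k, p (algebraMap k _ c))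
    (hE : p (E q n)) (hF : p (F q n)) (hK : p (K q n)) (hK' : p (Kinv q n))
    (hadd : ∀ a b, p a → p b → p (a + b)) (hmul : ∀ a b, p a → p b → p (a * b))
    (x : SmallQuantumGroup q n) : p x := by
  obtain ⟨x, rfl⟩ := proj_surjective q n x
  induction x using FreeAlgebra.induction with
  | grade0 c => rw [AlgHom.commutes]; exact hc c
  | grade1 g => cases g <;> assumption
  | mul a b ha hb => rw [map_mul]; exact hmul _ _ ha hb
  | add a b ha hb => rw [map_add]; exact hadd _ _ ha hb

end Algebra

section Hopf

variable {k : Type u} [Field k] (q : k) (n : ℕ)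
  [Fact (2 < n)] [Fact (Odd n)] [Fact (orderOf q = n ∨ orderOf q = 2 * n)]

/-- For odd `n`, if `q` has order `n` or `2 n` then `q ^ 2` has order `n`. -/
theorem isPrimitiveRoot_sq : IsPrimitiveRoot (q ^ 2) n := by
  have h2 : 2 < n := Fact.out
  have hodd : Odd n := Fact.out
  have hq : orderOf q = n ∨ orderOf q = 2 * n := Fact.out
  rw [IsPrimitiveRoot.iff_orderOf]
  rcases hq with hq | hq
  · rw [Nat.Coprime.orderOf_pow, hq]
    rw [hq]
    exact hodd.coprime_two_right
  · rw [orderOf_pow_of_dvd two_ne_zero (by rw [hq]; exact dvd_mul_right 2 n), hq]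
    omega

theorem pos (n : ℕ) [Fact (2 < n)] : 0 < n := by
  have h2 : 2 < n := Fact.out
  omega

theorem q_ne_zero {k : Type u} [Field k] (q : k) (n : ℕ)
    [Fact (2 < n)] [Fact (Odd n)] [Fact (orderOf q = n ∨ orderOf q = 2 * n)] : q ≠ 0 := by
  rintro rfl
  have h := (isPrimitiveRoot_sq (0 : k) n).pow_eq_one
  have hn : 0 < n := lt_trans (by norm_num) (Fact.out : 2 < n)
  rw [zero_pow two_ne_zero, zero_pow hn.ne'] at h
  exact zero_ne_one h

/-- The comultiplication: `Δ E = E ⊗ K + 1 ⊗ E`, `Δ F = F ⊗ 1 + K⁻¹ ⊗ F`, `Δ K = K ⊗ K`. -/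
def comulHom : SmallQuantumGroup q n →ₐ[k] SmallQuantumGroup q n ⊗[k] SmallQuantumGroup q n :=
  lift (E q n ⊗ₜ K q n + 1 ⊗ₜ E q n) (F q n ⊗ₜ 1 + Kinv q n ⊗ₜ F q n) (K q n ⊗ₜ K q n)
    (Kinv q n ⊗ₜ Kinv q n) (sat.comul (q_ne_zero q n) (isPrimitiveRoot_sq q n) (pos n))

/-- The counit: `ε E = ε F = 0`, `ε K = 1`. -/
def counitHom : SmallQuantumGroup q n →ₐ[k] k :=
  lift 0 0 1 1
    { t_t' := by simp
      t'_t := by simp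
      t_e := by simp
      t_f := by simp
      e_f := by simp
      e_pow := zero_pow (pos n).ne'
      f_pow := zero_pow (pos n).ne'
      t_pow := one_pow n }

instance instBialgebra : Bialgebra k (SmallQuantumGroup q n) :=
  Bialgebra.ofAlgHom (comulHom q n) (counitHom q n)
    (by
      apply algHom_ext <;>
        simp [comulHom, TensorProduct.add_tmul, TensorProduct.tmul_add,
          Algebra.TensorProduct.one_def, add_assoc])
    (by apply algHom_ext <;> simp [comulHom, counitHom])
    (by apply algHom_ext <;> simp [comulHom, counitHom])

theorem comul_eq (x : SmallQuantumGroup q n) :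
    Coalgebra.comul (R := k) x = comulHom q n x := rfl

theorem counit_eq (x : SmallQuantumGroup q n) :
    Coalgebra.counit (R := k) x = counitHom q n x := rfl

/-- The antipode, as a map to the opposite algebra: `S E = -E K⁻¹`, `S F = -K F`, `S K = K⁻¹`. -/
def antipodeHom : SmallQuantumGroup q n →ₐ[k] (SmallQuantumGroup q n)ᵐᵒᵖ :=
  lift _ _ _ _ (sat.antipode (q_ne_zero q n))

/-- The antipode. -/
def antipodeLin : SmallQuantumGroup q n →ₗ[k] SmallQuantumGroup q n :=
  (MulOpposite.opLinearEquiv k).symm.toLinearMap ∘ₗ (antipodeHom q n).toLinearMap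

@[simp] theorem antipodeLin_E : antipodeLin q n (E q n) = -(E q n * Kinv q n) := by
  simp [antipodeLin, antipodeHom]
@[simp] theorem antipodeLin_F : antipodeLin q n (F q n) = -(K q n * F q n) := by
  simp [antipodeLin, antipodeHom]
@[simp] theorem antipodeLin_K : antipodeLin q n (K q n) = Kinv q n := by
  simp [antipodeLin, antipodeHom]
@[simp] theorem antipodeLin_Kinv : antipodeLin q n (Kinv q n) = K q n := by
  simp [antipodeLin, antipodeHom]
@[simp] theorem antipodeLin_one : antipodeLin q n 1 = 1 := by
  simp [antipodeLin]
theorem antipodeLin_mul (a b : SmallQuantumGroup q n) :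
    antipodeLin q n (a * b) = antipodeLin q n b * antipodeLin q n a := by
  simp [antipodeLin]

theorem antipode_left (x : SmallQuantumGroup q n) :
    LinearMap.mul' k _ ((antipodeLin q n).rTensor _ (comulHom q n x)) =
      algebraMap k _ (counitHom q n x) := by
  set M : SmallQuantumGroup q n ⊗[k] SmallQuantumGroup q n →ₗ[k] SmallQuantumGroup q n :=
    LinearMap.mul' k _ ∘ₗ (antipodeLin q n).rTensor _ with hM
  have M_tmul : ∀ a b, M (a ⊗ₜ b) = antipodeLin q n a * b := fun a b => by simp [hM]
  change M (comulHom q n x) = _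
  induction x using induction_on with
  | hc c => rw [AlgHom.commutes, AlgHom.commutes, Algebra.algebraMap_eq_smul_one,
      Algebra.TensorProduct.one_def, map_smul, M_tmul, antipodeLin_one, mul_one,
      Algebra.algebraMap_eq_smul_one, Algebra.algebraMap_eq_smul_one, smul_assoc, one_smul]
  | hE => simp [comulHom, counitHom, M_tmul, mul_assoc, Kinv_mul_K]
  | hF => simp [comulHom, counitHom, M_tmul]
  | hK => simp [comulHom, counitHom, M_tmul, Kinv_mul_K]
  | hK' => simp [comulHom, counitHom, M_tmul, K_mul_Kinv]
  | hadd a b ha hb => simp only [map_add, ha, hb]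
  | hmul a b ha hb =>
    have key : ∀ u v, M (u * v) = LinearMap.mul' k _
        (((LinearMap.mulRight k (M u)) ∘ₗ (antipodeLin q n)).rTensor _ v) := by
      intro u v
      induction v with
      | zero => simp
      | add v w hv hw => simp only [mul_add, map_add, hv, hw]
      | tmul c d =>
        induction u with
        | zero => simp
        | add u w hu hw =>
          simp only [add_mul, map_add, hu, hw]
          simp [mul_add, add_mul]
        | tmul r s =>
          simp [M_tmul, antipodeLin_mul, mul_assoc]
    rw [map_mul, key, ha, map_mul, map_mul, ← hb]
    generalize comulHom q n b = v
    induction v with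
    | zero => simp
    | add v w hv hw => simp only [map_add, hv, hw, mul_add]
    | tmul c d =>
      simp [M_tmul, ← mul_assoc, Algebra.commutes]

theorem antipode_right (x : SmallQuantumGroup q n) :
    LinearMap.mul' k _ ((antipodeLin q n).lTensor _ (comulHom q n x)) =
      algebraMap k _ (counitHom q n x) := by
  set M : SmallQuantumGroup q n ⊗[k] SmallQuantumGroup q n →ₗ[k] SmallQuantumGroup q n :=
    LinearMap.mul' k _ ∘ₗ (antipodeLin q n).lTensor _ with hM
  have M_tmul : ∀ a b, M (a ⊗ₜ b) = a * antipodeLin q n b := fun a b => by simp [hM]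
  change M (comulHom q n x) = _
  induction x using induction_on with
  | hc c => rw [AlgHom.commutes, AlgHom.commutes, Algebra.algebraMap_eq_smul_one,
      Algebra.TensorProduct.one_def, map_smul, M_tmul, antipodeLin_one, mul_one,
      Algebra.algebraMap_eq_smul_one, Algebra.algebraMap_eq_smul_one, smul_assoc, one_smul]
  | hE => simp [comulHom, counitHom, M_tmul]
  | hF => simp [comulHom, counitHom, M_tmul, ← mul_assoc, Kinv_mul_K]
  | hK => simp [comulHom, counitHom, M_tmul, K_mul_Kinv]
  | hK' => simp [comulHom, counitHom, M_tmul, Kinv_mul_K]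
  | hadd a b ha hb => simp only [map_add, ha, hb]
  | hmul a b ha hb =>
    have key : ∀ u v, M (u * v) = LinearMap.mul' k _
        (((LinearMap.mulLeft k (M v)) ∘ₗ (antipodeLin q n)).lTensor _ u) := by
      intro u v
      induction u with
      | zero => simp
      | add u w hu hw => simp only [add_mul, map_add, hu, hw]
      | tmul c d =>
        induction v with
        | zero => simp
        | add v w hv hw =>
          simp only [mul_add, map_add, hv, hw]
          simp [mul_add, add_mul]
        | tmul r s =>
          simp [M_tmul, antipodeLin_mul, mul_assoc]
    rw [map_mul, key, hb, map_mul, map_mul, ← ha]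
    generalize comulHom q n a = v
    induction v with
    | zero => simp
    | add v w hv hw => simp only [map_add, hv, hw, add_mul]
    | tmul c d =>
      simp [M_tmul, mul_assoc, Algebra.commutes]

/-- The Hopf algebra structure of the small quantum group. -/
instance instHopfAlgebra : HopfAlgebra k (SmallQuantumGroup q n) where
  antipode := antipodeLin q n
  mul_antipode_rTensor_comul := LinearMap.ext fun x => antipode_left q n x
  mul_antipode_lTensor_comul := LinearMap.ext fun x => antipode_right q n x

end Hopf

section Modules

variable {k : Type u} [Field k] (q : k) (n : ℕ)
  [Fact (2 < n)] [Fact (Odd n)] [Fact (orderOf q = n ∨ orderOf q = 2 * n)]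

theorem q_pow_n_sq : q ^ n * q ^ n = 1 := by
  rw [← (isPrimitiveRoot_sq q n).pow_eq_one, ← pow_mul, ← pow_add, two_mul]

theorem q_sub_inv_ne_zero {k : Type u} [Field k] (q : k) (n : ℕ)
    [Fact (2 < n)] [Fact (Odd n)] [Fact (orderOf q = n ∨ orderOf q = 2 * n)] :
    q - q⁻¹ ≠ 0 := by
  have hq := q_ne_zero q n
  have h2 : 2 < n := Fact.out
  intro h
  rw [sub_eq_zero] at h
  have h1 : q ^ 2 = 1 := by
    rw [sq]
    nth_rewrite 2 [h]
    exact mul_inv_cancel₀ hq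
  exact (isPrimitiveRoot_sq q n).pow_ne_one_of_pos_of_lt one_ne_zero (by omega)
    (by rw [pow_one, h1])

open Matrix in
/-- The matrices that describe `V₂` satisfy the defining relations. -/
theorem sat_V₂ : Sat q n (A := Matrix (Fin 2) (Fin 2) k)
    !![0, 0; 1, 0] !![0, q ^ n; 0, 0] !![q ^ n * q⁻¹, 0; 0, q ^ n * q]
    !![q ^ n * q, 0; 0, q ^ n * q⁻¹] := by
  have hq := q_ne_zero q n
  have hd := q_sub_inv_ne_zero q n
  have hs := q_pow_n_sq q n
  have hQ := (isPrimitiveRoot_sq q n).pow_eq_one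
  have h2 : 2 < n := Fact.out
  have hodd : Odd n := Fact.out
  have hn2 : (q ^ n) ^ n = q ^ n := by
    obtain ⟨m, hm⟩ := hodd
    nth_rewrite 2 [hm]
    rw [pow_succ, pow_mul, sq, hs, one_pow, one_mul]
  generalize hc : q ^ n = c at *
  have hcc : c ^ 2 = 1 := by rw [sq, hs]
  refine ⟨?_, ?_, ?_, ?_, ?_, ?_, ?_, ?_⟩
  · ext i j
    fin_cases i <;> fin_cases j <;> simp <;> field_simp <;> linear_combination hs
  · ext i j
    fin_cases i <;> fin_cases j <;> simp <;> field_simp <;> linear_combination hs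
  · ext i j
    fin_cases i <;> fin_cases j <;> simp
    linear_combination q ^ 2 * hs
  · ext i j
    fin_cases i <;> fin_cases j <;> simp
    field_simp
    linear_combination c * hcc
  · ext i j
    fin_cases i <;> fin_cases j <;> simp
    · rw [eq_inv_mul_iff_mul_eq₀ hd]
      ring
    · rw [eq_inv_mul_iff_mul_eq₀ hd]
      ring
  · obtain ⟨m, rfl⟩ : ∃ m, n = m + 2 := ⟨n - 2, by omega⟩
    have h0 : !![(0 : k), 0; 1, 0] ^ 2 = 0 := by
      ext i j
      fin_cases i <;> fin_cases j <;> simp [sq]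
    rw [pow_add, h0, mul_zero]
  · obtain ⟨m, rfl⟩ : ∃ m, n = m + 2 := ⟨n - 2, by omega⟩
    have h0 : !![(0 : k), c; 0, 0] ^ 2 = 0 := by
      ext i j
      fin_cases i <;> fin_cases j <;> simp [sq]
    rw [pow_add, h0, mul_zero]
  · have : !![c * q⁻¹, 0; 0, c * q] = Matrix.diagonal ![c * q⁻¹, c * q] := by
      ext i j
      fin_cases i <;> fin_cases j <;> simp
    rw [this, Matrix.diagonal_pow, ← Matrix.diagonal_one]
    congr 1
    ext i
    fin_cases i
    · simp [mul_pow, hn2, hc, mul_inv_cancel₀ (left_ne_zero_of_mul_eq_one hs)]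
    · simp [mul_pow, hn2, hc, hs]

/-- The two dimensional simple module `V₂`, with basis `m₁, m₂` and the action
`E m₁ = m₂`, `E m₂ = 0`, `F m₁ = 0`, `F m₂ = q ^ n m₁`, `K m₁ = q ^ (n - 1) m₁`,
`K m₂ = q ^ (n + 1) m₂`. If `q` has order `n`, then `q ^ n = 1`; if it has order `2 n`, then
`q ^ n = -1`. -/
def V₂ : FDMod k (SmallQuantumGroup q n) :=
  FDMod.ofAlgHom (Fin 2 → k)
    ((Matrix.toLinAlgEquiv' (R := k) (n := Fin 2)).toAlgHom.comp
      (lift _ _ _ _ (sat_V₂ q n)))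

end Modules

end SmallQuantumGroup

/-! The integer polynomials that generate the relation. -/

/-- The number `n / (n - i) * (n - i).choose i` is a natural number. -/
theorem sub_dvd_mul_choose {n i : ℕ} (h : i < n) : (n - i) ∣ n * (n - i).choose i := by
  obtain ⟨m, rfl⟩ : ∃ m, n = m + 1 + i := ⟨n - i - 1, by omega⟩
  rw [Nat.add_sub_cancel, add_mul]
  refine dvd_add (dvd_mul_right _ _) ?_
  cases i with
  | zero => simp
  | succ i => exact ⟨_, by rw [mul_comm, ← Nat.add_one_mul_choose_eq]⟩

open Polynomial in
/-- The polynomial `∑ i ≤ (n - 1) / 2, (-1) ^ i * (n / (n - i)) * (n - i).choose i * y ^ (n - 2 i)`.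
The division of natural numbers in its coefficients is exact. -/
def firstPoly (n : ℕ) : ℤ[X] :=
  ∑ i ∈ Finset.range ((n - 1) / 2 + 1),
    C ((-1) ^ i * ((n * (n - i).choose i / (n - i) : ℕ) : ℤ)) * X ^ (n - 2 * i)

open Polynomial in
/-- The polynomial `∑ i ≤ (n - 1) / 2, (-1) ^ i * (n - 1 - i).choose i * y ^ (n - 1 - 2 i)`. -/
def secondPoly (n : ℕ) : ℤ[X] :=
  ∑ i ∈ Finset.range ((n - 1) / 2 + 1),
    C ((-1) ^ i * ((n - 1 - i).choose i : ℤ)) * X ^ (n - 1 - 2 * i)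

end

/-! Evaluation at `[V₂]` is a ring map from `ℤ[X]` to the Green ring. The theorem says that its
range is the projective class ring (`range_aeval_V₂`) and its kernel is the ideal of the single
relation (`ker_aeval_V₂`).

Put `ζ = q ^ n * q`, a primitive `n`-th root of unity with `ζ² = q²`. The simple modules are `V_1,
..., V_n`, where `V_r` has dimension `r` and highest weight `ζ ^ (r - 1)`. Let `P_r` be the
projective cover of `V_r`. The Casimir element takes the same value on `V_r` and `V_{n-r}` and on no
other simple module, which yields idempotents that cut out the `P_r` and shows that `V_n = P_n`.

For `r < n`, `V₂ V_r = V_{r+1} + V_{r-1}`, so `V_{r+1} = S_r(V₂)` with `S` the rescaled Chebyshev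
polynomials of the second kind. The products `V₂ P_r` are found without a basis of `P_r`: the
multiplicity of `P_s` in a projective module is the dimension of its maps to `V_s`, and `Hom(V₂ ⊗
P_r, V_s) = Hom(P_r, V₂ ⊗ V_s)` because `V₂` is self-dual. Only `s = n` needs more: `V₂ V_n =
P_{n-1}`, and `Hom(P_r, P_{n-1})` is read off from weight multiplicities inside a Casimir block. The
outcome is that `C_j(V₂) P_n = P_{n-j}` for `0 < j < n`, with `C` the rescaled Chebyshev polynomials
of the first kind, and that `V₂ P_1 = P_2 + 2 P_n` closes the recursion as `C_n(V₂) P_n = 2 P_n`.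
Since `P_n = S_{n-1}(V₂)`, this is the relation `(C_n - 2) S_{n-1} = 0`; `firstPoly_eq` and
`secondPoly_eq` identify the two factors.

There is no further relation. The polynomials `S_0, ..., S_{n-1}, C_1 S_{n-1}, ..., C_{n-1} S_{n-1}`
contain one monic polynomial in each degree below `2n - 1`, the degree of the monic relation, and
they map to the classes of `V_1, ..., V_n, P_{n-1}, ..., P_1`. These are independent by
`linearIndependent_simpleClass_projClass`, which counts homomorphisms into the `V_r` and out of the
`P_r`, so the Krull–Schmidt theorem is not needed. -/

set_option linter.unusedSectionVars false

noncomputable section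

/-! ### Weights and the Casimir element -/

namespace SmallQuantumGroup

section Casimir

variable {k : Type u} [Field k] (q : k) (n : ℕ)

/-- The primitive `n`-th root of unity `q ^ n * q`, a square root of `q ^ 2`. -/
def root : k := q ^ n * q

/-- The Casimir element `F E + (q K + q⁻¹ K⁻¹) / (q - q⁻¹) ^ 2`. -/
def casimir : SmallQuantumGroup q n :=
  F q n * E q n + ((q - q⁻¹)⁻¹ ^ 2) • (q • K q n + q⁻¹ • Kinv q n)

/-- The scalar by which the Casimir element acts on a highest weight vector of weight `μ`. -/
def casVal (μ : k) : k := ((q - q⁻¹)⁻¹ ^ 2) * (q * μ + q⁻¹ * μ⁻¹)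

/-- The highest weight of the simple module of dimension `r`. -/
def hw (r : ℕ) : k := root q n ^ r * (root q n)⁻¹

variable [Fact (2 < n)] [Fact (Odd n)] [Fact (orderOf q = n ∨ orderOf q = 2 * n)]

theorem root_sq : root q n ^ 2 = q ^ 2 := by
  have := q_pow_n_sq q n
  rw [root, mul_pow, sq (q ^ n), this, one_mul]

/-- The factor `q ^ n` is a sign, and as `n` is odd it equals its own `n`-th power; it cancels the
sign of `q ^ n` when `q` has order `2n`. -/
theorem root_pow : root q n ^ n = 1 := by
  obtain ⟨m, hm⟩ : Odd n := Fact.out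
  have h : (q ^ n) ^ n = q ^ n := by
    nth_rewrite 2 [hm]
    rw [pow_succ, pow_mul, sq, q_pow_n_sq, one_pow, one_mul]
  rw [root, mul_pow, h, q_pow_n_sq]

theorem root_ne_zero : root q n ≠ 0 :=
  mul_ne_zero (pow_ne_zero _ (q_ne_zero q n)) (q_ne_zero q n)

theorem isPrimitiveRoot_root : IsPrimitiveRoot (root q n) n := by
  have h := isPrimitiveRoot_sq q n
  rw [← root_sq q n] at h
  refine ⟨root_pow q n, fun l hl => h.dvd_of_pow_eq_one l ?_⟩
  rw [← pow_mul, mul_comm, pow_mul, hl, one_pow]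

theorem hw_ne_zero (r : ℕ) : hw q n r ≠ 0 :=
  mul_ne_zero (pow_ne_zero _ (root_ne_zero q n)) (inv_ne_zero (root_ne_zero q n))

theorem hw_succ (r : ℕ) : hw q n (r + 1) = root q n ^ r := by
  rw [hw, pow_succ, mul_inv_cancel_right₀ (root_ne_zero q n)]

theorem hw_one : hw q n 1 = 1 := by rw [hw_succ, pow_zero]

theorem root_mul_hw (r : ℕ) : root q n * hw q n r = hw q n (r + 1) := by
  rw [hw, hw, pow_succ']; ring

theorem hw_sq (r : ℕ) : q ^ 2 * hw q n r ^ 2 = (q ^ 2) ^ r := by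
  have := root_ne_zero q n
  rw [← root_sq q n, hw]
  field_simp
  ring

theorem hw_pow (r : ℕ) : hw q n r ^ n = 1 := by
  rw [hw, mul_pow, inv_pow, ← pow_mul, mul_comm r, pow_mul, root_pow, one_pow, inv_one, one_mul]

theorem hw_inj {r s : ℕ} (hr : 1 ≤ r) (hrn : r ≤ n) (hs : 1 ≤ s) (hsn : s ≤ n)
    (h : hw q n r = hw q n s) : r = s := by
  obtain ⟨r, rfl⟩ : ∃ a, r = a + 1 := ⟨r - 1, by omega⟩
  obtain ⟨s, rfl⟩ : ∃ a, s = a + 1 := ⟨s - 1, by omega⟩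
  rw [hw_succ, hw_succ] at h
  rw [(isPrimitiveRoot_root q n).pow_inj (by omega) (by omega) h]

theorem exists_hw_of_pow_eq_one {μ : k} (h : μ ^ n = 1) : ∃ r, 1 ≤ r ∧ r ≤ n ∧ μ = hw q n r := by
  have : NeZero n := ⟨(pos n).ne'⟩
  obtain ⟨i, hi, rfl⟩ := (isPrimitiveRoot_root q n).eq_pow_of_pow_eq_one h
  exact ⟨i + 1, by omega, by omega, (hw_succ q n i).symm⟩

theorem q_sq_pow_eq_one_iff (i : ℕ) : (q ^ 2) ^ i = 1 ↔ n ∣ i :=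
  (isPrimitiveRoot_sq q n).pow_eq_one_iff_dvd i

/-- The difference of the two values is a unit times `(μ - ν) (q² μ ν - 1)`. Casimir values thus
identify a weight only with its reflection `μ ↦ (q² μ)⁻¹`. -/
theorem casVal_eq_iff {k : Type u} [Field k] {q : k} (hq : q ≠ 0) (hd : q - q⁻¹ ≠ 0) {μ ν : k} (hμ : μ ≠ 0) (hν : ν ≠ 0) :
    casVal q μ = casVal q ν ↔ μ = ν ∨ q ^ 2 * μ * ν = 1 := by
  have e : casVal q μ - casVal q ν =
      (q - q⁻¹)⁻¹ ^ 2 * ((q * μ * ν)⁻¹ * ((μ - ν) * (q ^ 2 * μ * ν - 1))) := by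
    unfold casVal
    field_simp
    ring
  rw [← sub_eq_zero, e, mul_eq_zero, mul_eq_zero, mul_eq_zero, sub_eq_zero, sub_eq_zero]
  simp [hq, hd, hμ, hν]

/-- The left argument is the weight reached from `hw q n r` by `i` applications of `E`. This locates
the repeated roots of `weightPoly`. -/
theorem casVal_hw_mul_iff (r i : ℕ) :
    casVal q (hw q n r * (q ^ 2) ^ i) = casVal q (hw q n r) ↔ n ∣ i ∨ n ∣ r + i := by
  have hq := q_ne_zero q n
  rw [casVal_eq_iff (q_ne_zero q n) (q_sub_inv_ne_zero q n) (mul_ne_zero (hw_ne_zero q n r) (pow_ne_zero _ (pow_ne_zero _ hq)))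
    (hw_ne_zero q n r), ← q_sq_pow_eq_one_iff q n i, ← q_sq_pow_eq_one_iff q n (r + i), pow_add,
    ← hw_sq q n r, mul_eq_left₀ (hw_ne_zero q n r)]
  refine or_congr Iff.rfl ?_
  rw [show q ^ 2 * (hw q n r * (q ^ 2) ^ i) * hw q n r = q ^ 2 * hw q n r ^ 2 * (q ^ 2) ^ i by ring]

theorem casVal_hw_mul_inv_iff (r i : ℕ) :
    casVal q (hw q n r * (q ^ 2)⁻¹ ^ i) = casVal q (hw q n r) ↔
      n ∣ i ∨ (q ^ 2) ^ r = (q ^ 2) ^ i := by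
  have hq := q_ne_zero q n
  have hQ : (q ^ 2) ^ i ≠ 0 := pow_ne_zero _ (pow_ne_zero _ hq)
  rw [inv_pow, casVal_eq_iff (q_ne_zero q n) (q_sub_inv_ne_zero q n) (mul_ne_zero (hw_ne_zero q n r) (inv_ne_zero hQ))
    (hw_ne_zero q n r), ← q_sq_pow_eq_one_iff q n i, mul_eq_left₀ (hw_ne_zero q n r),
    inv_eq_one]
  refine or_congr Iff.rfl ?_
  rw [show q ^ 2 * (hw q n r * ((q ^ 2) ^ i)⁻¹) * hw q n r =
    q ^ 2 * hw q n r ^ 2 * ((q ^ 2) ^ i)⁻¹ by ring, hw_sq, mul_inv_eq_one₀ hQ]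

/-- The reflection of `ζ ^ (r - 1)` is `ζ ^ (s - 1)` exactly when `n` divides `r + s`. In the given
range the sum is `n` or `2n`, and `2n` forces `r = s = n`. -/
theorem casVal_hw_eq_iff {r s : ℕ} (hr : 1 ≤ r) (hrn : r ≤ n) (hs : 1 ≤ s) (hsn : s ≤ n) :
    casVal q (hw q n r) = casVal q (hw q n s) ↔ r = s ∨ r + s = n := by
  have h2 : 2 < n := Fact.out
  rw [casVal_eq_iff (q_ne_zero q n) (q_sub_inv_ne_zero q n) (hw_ne_zero q n r) (hw_ne_zero q n s)]
  have e : q ^ 2 * hw q n r * hw q n s = root q n ^ (r + s) := by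
    have := root_ne_zero q n
    rw [← root_sq q n, hw, hw, pow_add]
    field_simp
  rw [e, (isPrimitiveRoot_root q n).pow_eq_one_iff_dvd]
  constructor
  · rintro (h | ⟨a, ha⟩)
    · exact .inl (hw_inj q n hr hrn hs hsn h)
    · have : a ≠ 0 := by rintro rfl; omega
      have : a < 3 := by
        by_contra h3
        have : n * 3 ≤ n * a := Nat.mul_le_mul_left n (by omega)
        omega
      interval_cases a <;> omega
  · rintro (rfl | h)
    · exact .inl rfl
    · exact .inr (by rw [h])

end Casimir

/-! ### Centrality of the Casimir element and its action on weight vectors -/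

section Action

variable {k : Type u} [Field k] {q : k} {n : ℕ}
  [Fact (2 < n)] [Fact (Odd n)] [Fact (orderOf q = n ∨ orderOf q = 2 * n)]

theorem casimir_mul_E : casimir q n * E q n = E q n * casimir q n := by
  have hq := q_ne_zero q n
  have hd := q_sub_inv_ne_zero q n
  have h := (sat (q := q) (n := n))
  have h1 : F q n * E q n = E q n * F q n - (q - q⁻¹)⁻¹ • (K q n - Kinv q n) := by
    rw [← h.e_f]; abel
  have hd' : q ^ 2 - 1 ≠ 0 := by
    intro h0; apply hd; field_simp; rw [h0, mul_zero]
  have e1 : casimir q n * E q n = F q n * E q n * E q n + ((q - q⁻¹)⁻¹ ^ 2) •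
      (q • K q n * E q n + q⁻¹ • Kinv q n * E q n) := by
    rw [casimir, add_mul, smul_mul_assoc, add_mul]
  have e2 : E q n * casimir q n = E q n * F q n * E q n + ((q - q⁻¹)⁻¹ ^ 2) •
      (q • (E q n * K q n) + q⁻¹ • (E q n * Kinv q n)) := by
    rw [casimir, mul_add, mul_smul_comm, mul_add, mul_smul_comm, mul_smul_comm, mul_assoc]
  rw [e1, e2, h1, sub_mul, smul_mul_assoc, sub_mul, smul_mul_assoc, smul_mul_assoc, h.te, h.t'e hq]
  simp only [smul_add, smul_sub, smul_smul]
  match_scalars <;> field_simp <;> ring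

theorem casimir_mul_F : casimir q n * F q n = F q n * casimir q n := by
  have hq := q_ne_zero q n
  have hd := q_sub_inv_ne_zero q n
  have h := (sat (q := q) (n := n))
  have h1 : E q n * F q n = F q n * E q n + (q - q⁻¹)⁻¹ • (K q n - Kinv q n) := by
    rw [← h.e_f]; abel
  have hd' : q ^ 2 - 1 ≠ 0 := by
    intro h0; apply hd; field_simp; rw [h0, mul_zero]
  have e1 : casimir q n * F q n = F q n * (E q n * F q n) + ((q - q⁻¹)⁻¹ ^ 2) •
      (q • K q n * F q n + q⁻¹ • Kinv q n * F q n) := by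
    rw [casimir, add_mul, smul_mul_assoc, add_mul, mul_assoc]
  have e2 : F q n * casimir q n = F q n * (F q n * E q n) + ((q - q⁻¹)⁻¹ ^ 2) •
      (q • (F q n * K q n) + q⁻¹ • (F q n * Kinv q n)) := by
    rw [casimir, mul_add, mul_smul_comm, mul_add, mul_smul_comm, mul_smul_comm]
  rw [e1, e2, h1, mul_add, mul_smul_comm, mul_sub, smul_mul_assoc, smul_mul_assoc, h.tf, h.t'f hq]
  simp only [smul_add, smul_sub, smul_smul]
  match_scalars <;> field_simp <;> ring

theorem Kinv_eq_of_commute {x : SmallQuantumGroup q n} (h : x * K q n = K q n * x) :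
    x * Kinv q n = Kinv q n * x := by
  calc x * Kinv q n = Kinv q n * (K q n * x) * Kinv q n := by
        rw [← mul_assoc (Kinv q n), Kinv_mul_K, one_mul]
    _ = Kinv q n * x := by rw [← h, mul_assoc, mul_assoc, K_mul_Kinv, mul_one]

theorem casimir_mul_K : casimir q n * K q n = K q n * casimir q n := by
  have hq := q_ne_zero q n
  have h := (sat (q := q) (n := n))
  have : K q n * (F q n * E q n) = F q n * E q n * K q n := by
    rw [← mul_assoc, h.tf, smul_mul_assoc, mul_assoc, h.te, mul_smul_comm, smul_smul,
      inv_mul_cancel₀ (pow_ne_zero 2 hq), one_smul, mul_assoc]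
  rw [casimir, add_mul, mul_add, this]
  simp only [smul_mul_assoc, mul_smul_comm, mul_add, add_mul, h.t_t', h.t'_t]

theorem casimir_comm (x : SmallQuantumGroup q n) : Commute (casimir q n) x := by
  induction x using induction_on with
  | hc c => exact (Algebra.commutes c _).symm
  | hE => exact casimir_mul_E
  | hF => exact casimir_mul_F
  | hK => exact casimir_mul_K
  | hK' => exact Kinv_eq_of_commute casimir_mul_K
  | hadd a b ha hb => exact ha.add_right hb
  | hmul a b ha hb => exact ha.mul_right hb

variable {M : Type u} [AddCommGroup M] [Module k M] [Module (SmallQuantumGroup q n) M]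
  [IsScalarTower k (SmallQuantumGroup q n) M]

theorem Kinv_smul {μ : k} {v : M} (hμ : μ ≠ 0) (h : K q n • v = μ • v) :
    Kinv q n • v = μ⁻¹ • v := by
  have h1 : Kinv q n • K q n • v = v := by rw [← mul_smul, Kinv_mul_K, one_smul]
  rw [h, smul_comm] at h1
  rw [eq_inv_smul_iff₀ hμ, h1]

theorem K_smul_E {μ : k} {v : M} (h : K q n • v = μ • v) :
    K q n • E q n • v = (μ * q ^ 2) • E q n • v := by
  rw [← mul_smul, (sat (q := q) (n := n)).te, smul_assoc, mul_smul, h, smul_comm (E q n), smul_smul,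
    mul_comm]

theorem K_smul_F {μ : k} {v : M} (h : K q n • v = μ • v) :
    K q n • F q n • v = (μ * (q ^ 2)⁻¹) • F q n • v := by
  rw [← mul_smul, (sat (q := q) (n := n)).tf, smul_assoc, mul_smul, h, smul_comm (F q n), smul_smul,
    mul_comm]

theorem K_smul_E_pow {μ : k} {v : M} (h : K q n • v = μ • v) (i : ℕ) :
    K q n • E q n ^ i • v = (μ * (q ^ 2) ^ i) • E q n ^ i • v := by
  induction i with
  | zero => simpa using h
  | succ i ih => rw [pow_succ', mul_smul, K_smul_E ih, pow_succ _ i, mul_assoc]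

theorem K_smul_F_pow {μ : k} {v : M} (h : K q n • v = μ • v) (i : ℕ) :
    K q n • F q n ^ i • v = (μ * (q ^ 2)⁻¹ ^ i) • F q n ^ i • v := by
  induction i with
  | zero => simpa using h
  | succ i ih => rw [pow_succ', mul_smul, K_smul_F ih, pow_succ _ i, mul_assoc]

theorem F_smul_E {μ : k} {v : M} (hμ : μ ≠ 0) (h : K q n • v = μ • v) :
    F q n • E q n • v = casimir q n • v - casVal q μ • v := by
  have e : casimir q n • v = F q n • E q n • v + casVal q μ • v := by
    rw [casimir, add_smul, mul_smul, smul_assoc, add_smul, smul_assoc, smul_assoc, h,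
      Kinv_smul hμ h, casVal, smul_smul q, smul_smul q⁻¹, ← add_smul,
      mul_smul (_ ^ 2)]
  rw [e, add_sub_cancel_right]

theorem E_smul_F {μ : k} {v : M} (hμ : μ ≠ 0) (h : K q n • v = μ • v) :
    E q n • F q n • v = casimir q n • v - casVal q (μ * (q ^ 2)⁻¹) • v := by
  have hq := q_ne_zero q n
  have hd := q_sub_inv_ne_zero q n
  have hd' : q ^ 2 - 1 ≠ 0 := by
    intro h0; apply hd; field_simp; rw [h0, mul_zero]
  have h1 : E q n * F q n = F q n * E q n + (q - q⁻¹)⁻¹ • (K q n - Kinv q n) := by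
    rw [← E_F]; abel
  rw [← mul_smul, h1, add_smul, mul_smul, F_smul_E hμ h, smul_assoc, sub_smul, h, Kinv_smul hμ h,
    ← sub_smul, smul_smul, sub_add, ← sub_smul]
  congr 2
  rw [casVal, casVal]
  field_simp
  ring

theorem casimir_smul_comm (x : SmallQuantumGroup q n) (v : M) :
    casimir q n • x • v = x • casimir q n • v := by
  rw [← mul_smul, ← mul_smul, (casimir_comm x).eq]

open Polynomial in
/-- On a vector of weight `μ`, the operator `F ^ i E ^ i` is a polynomial in the Casimir element. -/
theorem F_pow_smul_E_pow {μ : k} {v : M} (hμ : μ ≠ 0) (h : K q n • v = μ • v) (i : ℕ) :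
    F q n ^ i • E q n ^ i • v =
      aeval (casimir q n) (∏ j ∈ Finset.range i, (X - C (casVal q (μ * (q ^ 2) ^ j)))) • v := by
  have hq := q_ne_zero q n
  induction i with
  | zero => simp
  | succ i ih =>
    have hc : Commute (F q n ^ i) (casimir q n) := (casimir_comm _).symm
    rw [pow_succ, pow_succ' (E q n), mul_smul, mul_smul,
      F_smul_E (mul_ne_zero hμ (pow_ne_zero _ (pow_ne_zero _ hq))) (K_smul_E_pow h i), smul_sub,
      ← casimir_smul_comm (F q n ^ i), smul_comm (F q n ^ i) (casVal q _), ih, Finset.prod_range_succ, mul_comm (Finset.prod _ _), map_mul,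
      mul_smul]
    simp [sub_smul]

theorem casimir_smul_of_E_smul {μ : k} {v : M} (hμ : μ ≠ 0) (h : K q n • v = μ • v)
    (hE : E q n • v = 0) : casimir q n • v = casVal q μ • v := by
  have := F_smul_E hμ h
  rw [hE, smul_zero] at this
  exact (sub_eq_zero.mp this.symm)

/-- On a weight vector, `E F` is the Casimir element minus a scalar, and the Casimir element is
itself a scalar on everything generated by a highest weight vector. -/
theorem E_smul_F_pow {μ : k} {v : M} (hμ : μ ≠ 0) (h : K q n • v = μ • v) (hE : E q n • v = 0)
    (i : ℕ) : E q n • F q n ^ (i + 1) • v =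
      (casVal q μ - casVal q (μ * (q ^ 2)⁻¹ ^ (i + 1))) • F q n ^ i • v := by
  have hq := q_ne_zero q n
  rw [pow_succ', mul_smul, E_smul_F (mul_ne_zero hμ (pow_ne_zero _ (inv_ne_zero (pow_ne_zero _ hq))))
    (K_smul_F_pow h i), casimir_smul_comm, casimir_smul_of_E_smul hμ h hE, smul_comm (F q n ^ i),
    ← sub_smul, mul_assoc, pow_succ _ i]

/-- A `k`-linear map that commutes with `E`, `F` and `K` is a map of modules. -/
def homOfComm {N : Type u} [AddCommGroup N] [Module k N] [Module (SmallQuantumGroup q n) N]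
    [IsScalarTower k (SmallQuantumGroup q n) N] (f : M →ₗ[k] N)
    (hE : ∀ v, f (E q n • v) = E q n • f v) (hF : ∀ v, f (F q n • v) = F q n • f v)
    (hK : ∀ v, f (K q n • v) = K q n • f v) : M →ₗ[SmallQuantumGroup q n] N where
  toFun := f
  map_add' := map_add f
  map_smul' := by
    intro x
    change ∀ v, f (x • v) = x • f v
    induction x using induction_on with
    | hc c => intro v; simp
    | hE => exact hE
    | hF => exact hF
    | hK => exact hK
    | hK' =>
      intro v
      rw [← one_smul (SmallQuantumGroup q n) (f (Kinv q n • v)), ← Kinv_mul_K, mul_smul, ← hK,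
        ← mul_smul, K_mul_Kinv, one_smul]
    | hadd a b ha hb => intro v; rw [add_smul, map_add, ha, hb, add_smul]
    | hmul a b ha hb => intro v; rw [mul_smul, ha, hb, mul_smul]

@[simp] theorem homOfComm_apply {N : Type u} [AddCommGroup N] [Module k N]
    [Module (SmallQuantumGroup q n) N]
    [IsScalarTower k (SmallQuantumGroup q n) N] (f : M →ₗ[k] N)
    (hE : ∀ v, f (E q n • v) = E q n • f v) (hF : ∀ v, f (F q n • v) = F q n • f v)
    (hK : ∀ v, f (K q n • v) = K q n • f v) (v : M) : homOfComm f hE hF hK v = f v := rfl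

end Action

end SmallQuantumGroup

/-! ### The simple modules -/

namespace SmallQuantumGroup

section Simple

variable {k : Type u} [Field k] (q : k) (n : ℕ)

/-- The scalar by which `E` maps the `i`-th basis vector of the `r`-dimensional simple module to
the preceding one. -/
def coeffE (r i : ℕ) : k := casVal q (hw q n r) - casVal q (hw q n r * (q ^ 2)⁻¹ ^ i)

/-- The operator of `E` on the simple module of dimension `r`. -/
def opE (r : ℕ) : Module.End k (Fin r → k) where
  toFun f i := if h : (i : ℕ) + 1 < r then coeffE q n r (i + 1) * f ⟨i + 1, h⟩ else 0
  map_add' f g := by ext i; by_cases h : (i : ℕ) + 1 < r <;> simp [h, mul_add]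
  map_smul' c f := by ext i; by_cases h : (i : ℕ) + 1 < r <;> simp [h, mul_left_comm]

/-- The operator of `F` on the simple module of dimension `r`. -/
def opF (k : Type u) [Field k] (r : ℕ) : Module.End k (Fin r → k) where
  toFun f i := if 0 < (i : ℕ) then f ⟨i - 1, by omega⟩ else 0
  map_add' f g := by ext i; by_cases h : 0 < (i : ℕ) <;> simp [h]
  map_smul' c f := by ext i; by_cases h : 0 < (i : ℕ) <;> simp [h]

/-- A diagonal operator. -/
def opDiag {r : ℕ} (d : ℕ → k) : Module.End k (Fin r → k) where
  toFun f i := d i * f i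
  map_add' f g := by ext i; simp [mul_add]
  map_smul' c f := by ext i; simp [mul_left_comm]

theorem opE_apply (r : ℕ) (f : Fin r → k) (i : Fin r) : opE q n r f i =
    if h : (i : ℕ) + 1 < r then coeffE q n r (i + 1) * f ⟨i + 1, h⟩ else 0 := rfl

theorem opF_apply (r : ℕ) (f : Fin r → k) (i : Fin r) : opF k r f i =
    if 0 < (i : ℕ) then f ⟨i - 1, by omega⟩ else 0 := rfl

theorem opDiag_apply {r : ℕ} (d : ℕ → k) (f : Fin r → k) (i : Fin r) :
    opDiag d f i = d i * f i := rfl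

theorem opE_pow_apply (r m : ℕ) (f : Fin r → k) (i : Fin r) (h : r ≤ i + m) :
    (opE q n r ^ m) f i = 0 := by
  induction m generalizing i with
  | zero => omega
  | succ m ih =>
    rw [pow_succ', Module.End.mul_apply, opE_apply]
    split_ifs with h1
    · rw [ih _ (by simp; omega), mul_zero]
    · rfl

theorem opF_pow_apply (r m : ℕ) (f : Fin r → k) (i : Fin r) (h : i < m) :
    (opF k r ^ m) f i = 0 := by
  induction m generalizing i with
  | zero => omega
  | succ m ih =>
    rw [pow_succ', Module.End.mul_apply, opF_apply]
    split_ifs with h1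
    · exact ih _ (by simp; omega)
    · rfl

theorem opDiag_pow {r : ℕ} (d : ℕ → k) (m : ℕ) :
    (opDiag d : Module.End k (Fin r → k)) ^ m = opDiag fun i => d i ^ m := by
  induction m with
  | zero => ext f i; simp [opDiag_apply]
  | succ m ih => ext f i; simp [pow_succ', ih, opDiag_apply, mul_assoc]

variable [Fact (2 < n)] [Fact (Odd n)] [Fact (orderOf q = n ∨ orderOf q = 2 * n)]

theorem casVal_sub {k : Type u} [Field k] {q : k} (hq : q ≠ 0) (hd : q - q⁻¹ ≠ 0) {μ : k} (hμ : μ ≠ 0) :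
    casVal q μ - casVal q (μ * (q ^ 2)⁻¹) = (q - q⁻¹)⁻¹ * (μ - μ⁻¹) := by
  have hd' : q ^ 2 - 1 ≠ 0 := by
    intro h0; apply hd; field_simp; rw [h0, mul_zero]
  rw [casVal, casVal]
  field_simp
  ring

theorem coeffE_zero (r : ℕ) : coeffE q n r 0 = 0 := by simp [coeffE]

/-- Lowering `hw q n r` by `r` steps reaches its reflection, where the Casimir value is the same.
This is why the string of vectors can stop after `r` steps. -/
theorem coeffE_self (r : ℕ) : coeffE q n r r = 0 :=
  sub_eq_zero.2 ((casVal_hw_mul_inv_iff q n r r).2 (.inr rfl)).symm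

theorem coeffE_ne_zero {r i : ℕ} (hr : r ≤ n) (hi : 0 < i) (hir : i < r) :
    coeffE q n r i ≠ 0 := by
  intro h
  have hQ : (q ^ 2) ^ i ≠ 0 := pow_ne_zero _ (pow_ne_zero _ (q_ne_zero q n))
  rcases (casVal_hw_mul_inv_iff q n r i).1 (sub_eq_zero.1 h).symm with h | h
  · exact absurd (Nat.le_of_dvd hi h) (by omega)
  · obtain ⟨j, rfl⟩ : ∃ j, r = i + j := ⟨r - i, by omega⟩
    rw [pow_add, mul_eq_left₀ hQ, q_sq_pow_eq_one_iff q n] at h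
    exact absurd (Nat.le_of_dvd (by omega) h) (by omega)

/-- This is the relation for `E F - F E` evaluated on the `i`-th basis vector. -/
theorem coeffE_succ_sub (r i : ℕ) : coeffE q n r (i + 1) - coeffE q n r i =
    (q - q⁻¹)⁻¹ * (hw q n r * (q ^ 2)⁻¹ ^ i - (hw q n r * (q ^ 2)⁻¹ ^ i)⁻¹) := by
  rw [← casVal_sub (q_ne_zero q n) (q_sub_inv_ne_zero q n), coeffE, coeffE, pow_succ _ i, mul_assoc]
  · ring
  · exact mul_ne_zero (hw_ne_zero q n r) (pow_ne_zero _ (inv_ne_zero (pow_ne_zero _ (q_ne_zero q n))))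

theorem sat_op (r : ℕ) (hr : r ≤ n) : Sat q n (A := Module.End k (Fin r → k)) (opE q n r) (opF k r)
    (opDiag fun i => hw q n r * (q ^ 2)⁻¹ ^ i) (opDiag fun i => (hw q n r * (q ^ 2)⁻¹ ^ i)⁻¹) := by
  have hq := q_ne_zero q n
  have hQ := pow_ne_zero 2 hq
  have hw0 : ∀ i, hw q n r * (q ^ 2)⁻¹ ^ i ≠ 0 := fun i =>
    mul_ne_zero (hw_ne_zero q n r) (pow_ne_zero _ (inv_ne_zero hQ))
  refine ⟨?_, ?_, ?_, ?_, ?_, ?_, ?_, ?_⟩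
  · refine LinearMap.ext fun f => funext fun i => ?_
    simp only [Module.End.mul_apply, opDiag_apply, Module.End.one_apply,
      mul_inv_cancel_left₀ (hw0 _)]
  · refine LinearMap.ext fun f => funext fun i => ?_
    simp only [Module.End.mul_apply, opDiag_apply, Module.End.one_apply,
      inv_mul_cancel_left₀ (hw0 _)]
  · refine LinearMap.ext fun f => funext fun i => ?_
    simp only [Module.End.mul_apply, opDiag_apply, opE_apply, LinearMap.smul_apply, Pi.smul_apply,
      smul_eq_mul]
    split_ifs with h
    · have := hw0 i
      obtain ⟨x, hx⟩ : ∃ x, x = hw q n r * (q ^ 2)⁻¹ ^ (i : ℕ) := ⟨_, rfl⟩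
      rw [pow_succ _ (i : ℕ), ← mul_assoc (hw q n r), ← hx]
      rw [← hx] at this
      field_simp
    · simp
  · refine LinearMap.ext fun f => funext fun i => ?_
    simp only [Module.End.mul_apply, opDiag_apply, opF_apply, LinearMap.smul_apply, Pi.smul_apply,
      smul_eq_mul]
    split_ifs with h
    · obtain ⟨j, hj⟩ : ∃ j, (i : ℕ) = j + 1 := ⟨i - 1, by omega⟩
      have := hw0 j
      simp only [hj, Nat.add_sub_cancel]
      obtain ⟨x, hx⟩ : ∃ x, x = hw q n r * (q ^ 2)⁻¹ ^ j := ⟨_, rfl⟩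
      rw [pow_succ _ j, ← mul_assoc (hw q n r), ← hx]
      rw [← hx] at this
      field_simp
    · simp
  · refine LinearMap.ext fun f => funext fun i => ?_
    have h1 : opE q n r (opF k r f) i = coeffE q n r (i + 1) * f i := by
      rw [opE_apply]
      split_ifs with h
      · rw [opF_apply, if_pos (by simp)]
        rfl
      -- On the last basis vector `F` is zero; the formula `E F = coeffE (i + 1)` survives because
      -- `coeffE` vanishes at `r`.
      · rw [show (i : ℕ) + 1 = r by omega, coeffE_self, zero_mul]
    have h2 : opF k r (opE q n r f) i = coeffE q n r i * f i := by
      rw [opF_apply]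
      split_ifs with h
      · have : (i : ℕ) - 1 + 1 = i := by omega
        simp only [opE_apply, this, i.2, dite_true]
      · rw [show (i : ℕ) = 0 by omega, coeffE_zero, zero_mul]
    simp only [LinearMap.sub_apply, Module.End.mul_apply, Pi.sub_apply, h1, h2,
      LinearMap.smul_apply, Pi.smul_apply, opDiag_apply, smul_eq_mul]
    rw [← sub_mul, ← sub_mul, coeffE_succ_sub, mul_assoc]
  · exact LinearMap.ext fun f => funext fun i => opE_pow_apply q n r n f i (by omega)
  · exact LinearMap.ext fun f => funext fun i => opF_pow_apply r n f i (by omega)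
  · rw [opDiag_pow]
    refine LinearMap.ext fun f => funext fun i => ?_
    rw [opDiag_apply, mul_pow, hw_pow, ← pow_mul, mul_comm (i : ℕ), pow_mul, inv_pow,
      (q_sq_pow_eq_one_iff q n n).2 dvd_rfl]
    simp

/-- The simple module of dimension `r` for `1 ≤ r ≤ n`; it is zero for `r = 0`. -/
def simpleMod (r : ℕ) (hr : r ≤ n) : FDMod k (SmallQuantumGroup q n) :=
  FDMod.ofAlgHom (Fin r → k) (lift _ _ _ _ (sat_op q n r hr))

variable {q n} {r : ℕ} {hr : r ≤ n}

/-- The coordinates of a vector of the simple module. -/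
def coords : simpleMod q n r hr ≃ₗ[k] (Fin r → k) := LinearEquiv.refl k _

theorem smul_eq_lift (x : SmallQuantumGroup q n) (v : simpleMod q n r hr) :
    coords (x • v) = lift _ _ _ _ (sat_op q n r hr) x (coords v) := rfl

theorem coords_E (v : simpleMod q n r hr) : coords (E q n • v) = opE q n r (coords v) := by
  rw [smul_eq_lift, lift_E]

theorem coords_F (v : simpleMod q n r hr) : coords (F q n • v) = opF k r (coords v) := by
  rw [smul_eq_lift, lift_F]

theorem coords_K (v : simpleMod q n r hr) :
    coords (K q n • v) = opDiag (fun i => hw q n r * (q ^ 2)⁻¹ ^ i) (coords v) := by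
  rw [smul_eq_lift, lift_K]

variable (hr) in
/-- The `i`-th basis vector of the simple module; it is zero for `i ≥ r`. -/
def vec (i : ℕ) : simpleMod q n r hr := coords.symm fun j => if (j : ℕ) = i then 1 else 0

theorem coords_vec (i : ℕ) (j : Fin r) :
    coords (vec (q := q) hr i) j = if (j : ℕ) = i then 1 else 0 := by
  rw [vec, LinearEquiv.apply_symm_apply]

theorem vec_eq_zero {i : ℕ} (h : r ≤ i) : vec (q := q) hr i = 0 := by
  apply coords.injective
  ext j
  rw [coords_vec, if_neg (by omega), map_zero]
  rfl

theorem vec_ne_zero {i : ℕ} (h : i < r) : vec (q := q) hr i ≠ 0 := by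
  intro h0
  have := coords_vec (q := q) (hr := hr) i ⟨i, h⟩
  rw [h0, map_zero] at this
  simp at this

theorem F_smul_vec (i : ℕ) : F q n • vec (q := q) hr i = vec hr (i + 1) := by
  apply coords.injective
  ext j
  rw [coords_F, opF_apply, coords_vec, coords_vec, ← ite_and]
  exact if_congr (by simp only; omega) rfl rfl

theorem F_pow_smul_vec (m i : ℕ) : F q n ^ m • vec (q := q) hr i = vec hr (i + m) := by
  induction m with
  | zero => simp
  | succ m ih => rw [pow_succ', mul_smul, ih, F_smul_vec, add_assoc]

theorem K_smul_vec (i : ℕ) :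
    K q n • vec (q := q) hr i = (hw q n r * (q ^ 2)⁻¹ ^ i) • vec hr i := by
  apply coords.injective
  ext j
  rw [coords_K, opDiag_apply, map_smul, Pi.smul_apply, coords_vec, smul_eq_mul]
  split_ifs with h
  · rw [h]
  · simp

theorem E_smul_vec_zero : E q n • vec (q := q) hr 0 = 0 := by
  apply coords.injective
  ext j
  rw [coords_E, opE_apply, map_zero]
  split_ifs with h
  · rw [coords_vec, if_neg (by simp), mul_zero]; rfl
  · rfl

theorem E_smul_vec_succ (i : ℕ) :
    E q n • vec (q := q) hr (i + 1) = coeffE q n r (i + 1) • vec hr i := by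
  apply coords.injective
  ext j
  rw [coords_E, opE_apply, map_smul, Pi.smul_apply, coords_vec, smul_eq_mul]
  split_ifs with h h1 h1
  · rw [coords_vec, if_pos (by simpa using h1), h1]
  · rw [coords_vec, if_neg (by simpa using h1), mul_zero, mul_zero]
  · rw [← h1, show (j : ℕ) + 1 = r by omega, coeffE_self, zero_mul]
  · rw [mul_zero]

theorem eq_sum_vec (v : simpleMod q n r hr) : v = ∑ i : Fin r, coords v i • vec hr i := by
  apply coords.injective
  ext j
  rw [map_sum, Finset.sum_apply]
  simp [coords_vec, Fin.val_inj]

theorem linearMap_ext_vec {M : Type u} [AddCommGroup M] [Module k M]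
    {f g : simpleMod q n r hr →ₗ[k] M} (h : ∀ i, f (vec hr i) = g (vec hr i)) : f = g := by
  ext v
  rw [eq_sum_vec v, map_sum, map_sum]
  simp only [map_smul, h]

section Hom

variable {M : Type u} [AddCommGroup M] [Module k M] [Module (SmallQuantumGroup q n) M]
  [IsScalarTower k (SmallQuantumGroup q n) M]

/-- The linear map that sends the `i`-th basis vector to `F ^ i w`. -/
def simpleLin (hr : r ≤ n) (w : M) : simpleMod q n r hr →ₗ[k] M :=
  (Fintype.linearCombination k fun i : Fin r => F q n ^ (i : ℕ) • w) ∘ₗ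
    coords.toLinearMap

theorem simpleLin_vec {w : M} (hF : F q n ^ r • w = 0) (i : ℕ) :
    simpleLin hr w (vec (q := q) hr i) = F q n ^ i • w := by
  by_cases h : i < r
  · have : ∀ x : Fin r, ((x : ℕ) = i) = (x = ⟨i, h⟩) := fun x => by simp [Fin.ext_iff]
    simp [simpleLin, Fintype.linearCombination_apply, coords_vec, this]
  · obtain ⟨j, rfl⟩ : ∃ j, i = j + r := ⟨i - r, by omega⟩
    rw [vec_eq_zero (by omega), map_zero, pow_add, mul_smul, hF, smul_zero]

/-- The map from the simple module attached to a highest weight vector. -/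
def simpleHom (hr : r ≤ n) (w : M) (hK : K q n • w = hw q n r • w) (hE : E q n • w = 0)
    (hF : F q n ^ r • w = 0) : simpleMod q n r hr →ₗ[SmallQuantumGroup q n] M :=
  homOfComm (simpleLin hr w)
    (LinearMap.congr_fun (linearMap_ext_vec (f := simpleLin hr w ∘ₗ Algebra.lsmul k k _ (E q n))
      (g := Algebra.lsmul k k _ (E q n) ∘ₗ simpleLin hr w) fun i => by
        simp only [LinearMap.comp_apply, Algebra.lsmul_coe, simpleLin_vec hF]
        cases i with
        | zero => rw [E_smul_vec_zero, map_zero, pow_zero, one_smul, hE]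
        | succ i =>
          rw [E_smul_vec_succ, map_smul, simpleLin_vec hF,
            E_smul_F_pow (hw_ne_zero q n r) hK hE, coeffE]))
    (LinearMap.congr_fun (linearMap_ext_vec (f := simpleLin hr w ∘ₗ Algebra.lsmul k k _ (F q n))
      (g := Algebra.lsmul k k _ (F q n) ∘ₗ simpleLin hr w) fun i => by
        simp only [LinearMap.comp_apply, Algebra.lsmul_coe, simpleLin_vec hF, F_smul_vec]
        rw [pow_succ', mul_smul]))
    (LinearMap.congr_fun (linearMap_ext_vec (f := simpleLin hr w ∘ₗ Algebra.lsmul k k _ (K q n))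
      (g := Algebra.lsmul k k _ (K q n) ∘ₗ simpleLin hr w) fun i => by
        simp only [LinearMap.comp_apply, Algebra.lsmul_coe, simpleLin_vec hF, K_smul_vec, map_smul,
          K_smul_F_pow hK]))

theorem simpleHom_vec (hr : r ≤ n) (w : M) (hK : K q n • w = hw q n r • w) (hE : E q n • w = 0)
    (hF : F q n ^ r • w = 0) (i : ℕ) :
    simpleHom hr w hK hE hF (vec hr i) = F q n ^ i • w := simpleLin_vec hF i

theorem simpleHom_vec_zero (hr : r ≤ n) (w : M) (hK : K q n • w = hw q n r • w)
    (hE : E q n • w = 0) (hF : F q n ^ r • w = 0) :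
    simpleHom hr w hK hE hF (vec hr 0) = w := by rw [simpleHom_vec, pow_zero, one_smul]

end Hom

/-- The coefficients of `E` strictly inside the string are nonzero since `r ≤ n`, so the kernel of
`E` is the highest weight line. -/
theorem eq_smul_vec_zero_of_E_smul (h1 : 1 ≤ r) {v : simpleMod q n r hr} (h : E q n • v = 0) :
    v = coords v ⟨0, h1⟩ • vec hr 0 := by
  apply coords.injective
  ext ⟨j, hj⟩
  rw [map_smul, Pi.smul_apply, coords_vec]
  cases j with
  | zero => simp
  | succ j =>
    have h2 := congrFun (congrArg coords h) ⟨j, by omega⟩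
    rw [coords_E, opE_apply, dif_pos hj, map_zero] at h2
    simpa using (mul_eq_zero.1 h2).resolve_left (coeffE_ne_zero q n hr (by omega) hj)

theorem exists_E_pow_smul_ne_zero {M : Type u} [AddCommGroup M] [Module (SmallQuantumGroup q n) M]
    {v : M} (hv : v ≠ 0) : ∃ i, E q n ^ i • v ≠ 0 ∧ E q n ^ (i + 1) • v = 0 := by
  classical
  have h : ∃ i, E q n ^ i • v = 0 := ⟨n, by rw [E_pow, zero_smul]⟩
  have h0 : Nat.find h ≠ 0 := fun h0 => hv (by simpa [h0] using Nat.find_spec h)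
  refine ⟨Nat.find h - 1, Nat.find_min h (by omega), ?_⟩
  rw [Nat.sub_add_cancel (by omega)]
  exact Nat.find_spec h

theorem span_vec_zero : Submodule.span (SmallQuantumGroup q n) {vec (q := q) hr 0} = ⊤ := by
  rw [eq_top_iff]
  intro v _
  rw [eq_sum_vec v]
  refine Submodule.sum_mem _ fun i _ => ?_
  rw [← algebraMap_smul (SmallQuantumGroup q n), ← zero_add (i : ℕ), ← F_pow_smul_vec]
  exact Submodule.smul_mem _ _ (Submodule.smul_mem _ _ (Submodule.mem_span_singleton_self _))

theorem isSimpleModule_simpleMod (h1 : 1 ≤ r) :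
    IsSimpleModule (SmallQuantumGroup q n) (simpleMod q n r hr) := by
  have : Nontrivial (simpleMod q n r hr) := ⟨_, _, vec_ne_zero (i := 0) (by omega)⟩
  rw [isSimpleModule_iff_toSpanSingleton_surjective]
  refine ⟨this, fun v hv => ?_⟩
  rw [← LinearMap.range_eq_top, ← LinearMap.span_singleton_eq_range (SmallQuantumGroup q n),
    eq_top_iff,
    ← span_vec_zero (q := q) (hr := hr), Submodule.span_singleton_le_iff_mem]
  -- The last nonzero vector among the `E ^ i v` lies in the kernel of `E`, so it is a nonzero
  -- multiple of `vec hr 0`, which generates the module.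
  obtain ⟨i, hi, hi'⟩ := exists_E_pow_smul_ne_zero (q := q) (n := n) hv
  rw [pow_succ', mul_smul] at hi'
  have e := eq_smul_vec_zero_of_E_smul h1 hi'
  set c := coords (E q n ^ i • v) ⟨0, h1⟩
  have hc : c ≠ 0 := by
    intro hc
    rw [hc, zero_smul] at e
    exact hi e
  have : vec hr 0 = (algebraMap k _ c⁻¹ * E q n ^ i) • v := by
    rw [mul_smul, e, algebraMap_smul, smul_smul, inv_mul_cancel₀ hc, one_smul]
  rw [this]
  exact Submodule.smul_mem _ _ (Submodule.mem_span_singleton_self _)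

theorem finrank_simpleMod : Module.finrank k (simpleMod q n r hr) = r := by
  rw [(coords (hr := hr) (q := q)).finrank_eq, Module.finrank_fin_fun]

end Simple

end SmallQuantumGroup

/-! ### Classification of the simple modules -/

namespace SmallQuantumGroup

section Classification

variable {k : Type u} [Field k] {q : k} {n : ℕ}
  [Fact (2 < n)] [Fact (Odd n)] [Fact (orderOf q = n ∨ orderOf q = 2 * n)]

/-- If `w` has weight `hw q n r`, then `F ^ r w` has this weight; the reflection exchanges `r` and
`n - r`. -/
theorem hw_mul_inv_pow {r : ℕ} (hr : r ≤ n) : hw q n r * (q ^ 2)⁻¹ ^ r = hw q n (n - r) := by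
  have h0 := root_ne_zero q n
  obtain ⟨s, hs⟩ : ∃ s, n = r + s := ⟨n - r, by omega⟩
  have h := root_pow q n
  have e : n - r = s := by omega
  rw [← root_sq q n, e, hw, hw, inv_pow, ← pow_mul, mul_comm 2, pow_mul, sq]
  have h' : root q n ^ r * root q n ^ s = 1 := by rw [← pow_add, ← hs, h]
  have hr0 := pow_ne_zero r h0
  field_simp
  exact h'.symm

theorem weight_pow_eq_one {M : Type u} [AddCommGroup M] [Module k M]
    [Module (SmallQuantumGroup q n) M] [IsScalarTower k (SmallQuantumGroup q n) M]
    {μ : k} {v : M} (hv : v ≠ 0) (h : K q n • v = μ • v) : μ ^ n = 1 := by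
  have e : ∀ m : ℕ, K q n ^ m • v = μ ^ m • v := by
    intro m
    induction m with
    | zero => simp
    | succ m ih => rw [pow_succ', mul_smul, ih, smul_comm, h, smul_smul, pow_succ]
  have := e n
  rw [K_pow, one_smul] at this
  by_contra h1
  have h2 : (μ ^ n - 1) • v = 0 := by rw [sub_smul, ← this, one_smul, sub_self]
  rcases smul_eq_zero.1 h2 with h | h
  · exact h1 (sub_eq_zero.1 h)
  · exact hv h

variable {M : Type u} [AddCommGroup M] [Module k M] [Module (SmallQuantumGroup q n) M]
  [IsScalarTower k (SmallQuantumGroup q n) M]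

theorem exists_highest_weight_vector [IsAlgClosed k] [Module.Finite k M] [Nontrivial M] :
    ∃ r, 1 ≤ r ∧ r ≤ n ∧ ∃ w : M, w ≠ 0 ∧ K q n • w = hw q n r • w ∧ E q n • w = 0 := by
  obtain ⟨μ, hμ⟩ := Module.End.exists_eigenvalue (Algebra.lsmul k k M (K q n))
  obtain ⟨v, hv⟩ := hμ.exists_hasEigenvector
  obtain ⟨i, hi, hi'⟩ := exists_E_pow_smul_ne_zero (q := q) (n := n) hv.2
  have hK := K_smul_E_pow (q := q) (n := n) hv.apply_eq_smul i
  obtain ⟨r, h1, hr, e⟩ := exists_hw_of_pow_eq_one q n (weight_pow_eq_one hi hK)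
  exact ⟨r, h1, hr, _, hi, e ▸ hK, by rwa [pow_succ', mul_smul] at hi'⟩

theorem exists_equiv_simpleMod [IsAlgClosed k] [Module.Finite k M]
    [IsSimpleModule (SmallQuantumGroup q n) M] :
    ∃ r, ∃ hr : r ≤ n, 1 ≤ r ∧ Nonempty (simpleMod q n r hr ≃ₗ[SmallQuantumGroup q n] M) := by
  have := IsSimpleModule.nontrivial (SmallQuantumGroup q n) M
  obtain ⟨r, h1, hr, w, hw0, hK, hE⟩ := exists_highest_weight_vector (q := q) (n := n) (M := M)
  have main : ∀ (s : ℕ) (hs : s ≤ n) (h1 : 1 ≤ s) (w : M) (_ : w ≠ 0)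
      (hK : K q n • w = hw q n s • w) (hE : E q n • w = 0) (hF : F q n ^ s • w = 0),
      Nonempty (simpleMod q n s hs ≃ₗ[SmallQuantumGroup q n] M) := by
    intro s hs h1 w hw0 hK hE hF
    have := isSimpleModule_simpleMod (q := q) (hr := hs) h1
    refine ⟨LinearEquiv.ofBijective (simpleHom hs w hK hE hF)
      (LinearMap.bijective_of_ne_zero fun h => hw0 ?_)⟩
    rw [← simpleHom_vec_zero hs w hK hE hF, h, LinearMap.zero_apply]
  -- A highest weight vector whose string stops after `r` steps gives a nonzero map from the simple
  -- module of dimension `r`. Otherwise `F ^ r w` is again a highest weight vector, now for `n - r`,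
  -- and its string stops in time because `F ^ n = 0`.
  by_cases hF : F q n ^ r • w = 0
  · exact ⟨r, hr, h1, main r hr h1 w hw0 hK hE hF⟩
  · have hrn : r < n := lt_of_le_of_ne hr fun h => hF (by rw [h, F_pow, zero_smul])
    refine ⟨n - r, by omega, by omega, main _ _ (by omega) _ hF ?_ ?_ ?_⟩
    · rw [← hw_mul_inv_pow hr, K_smul_F_pow hK]
    · obtain ⟨s, rfl⟩ : ∃ s, r = s + 1 := ⟨r - 1, by omega⟩
      rw [E_smul_F_pow (hw_ne_zero q n _) hK hE]
      exact (congrArg (· • _) (coeffE_self q n (s + 1))).trans (zero_smul _ _)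
    · rw [← mul_smul, ← pow_add, Nat.sub_add_cancel hr, F_pow, zero_smul]

theorem simpleMod_equiv_iff {r s : ℕ} {hr : r ≤ n} {hs : s ≤ n}
    (e : simpleMod q n r hr ≃ₗ[SmallQuantumGroup q n] simpleMod q n s hs) : r = s := by
  rw [← finrank_simpleMod (q := q) (hr := hr), ← finrank_simpleMod (q := q) (hr := hs)]
  exact (e.restrictScalars k).finrank_eq

theorem casimir_smul_simpleMod {r : ℕ} {hr : r ≤ n} (v : simpleMod q n r hr) :
    casimir q n • v = casVal q (hw q n r) • v := by
  have h : Algebra.lsmul k k (simpleMod q n r hr) (casimir q n) =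
      casVal q (hw q n r) • LinearMap.id := by
    refine linearMap_ext_vec fun i => ?_
    have h0 := casimir_smul_of_E_smul (hw_ne_zero q n r)
      (by simpa using K_smul_vec (q := q) (hr := hr) 0) (E_smul_vec_zero (q := q) (hr := hr))
    rw [LinearMap.smul_apply, LinearMap.id_apply, Algebra.lsmul_coe, ← zero_add i,
      ← F_pow_smul_vec i]
    change casimir q n • F q n ^ i • _ = _
    rw [casimir_smul_comm, h0, smul_comm]
  exact LinearMap.congr_fun h v

end Classification

/-! ### The small quantum group is finite dimensional -/

section Finite

variable {k : Type u} [Field k] (q : k) (n : ℕ)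
  [Fact (2 < n)] [Fact (Odd n)] [Fact (orderOf q = n ∨ orderOf q = 2 * n)]

theorem Kinv_eq_pow : Kinv q n = K q n ^ (n - 1) := by
  have h : K q n * K q n ^ (n - 1) = 1 := by
    rw [← pow_succ', Nat.sub_add_cancel (pos n), K_pow]
  rw [← mul_one (Kinv q n), ← h, ← mul_assoc, Kinv_mul_K, one_mul]

theorem exists_K_pow_mul_E_pow (m j : ℕ) :
    ∃ c : k, K q n ^ m * E q n ^ j = c • (E q n ^ j * K q n ^ m) := by
  have h1 : ∀ m, ∃ c : k, K q n ^ m * E q n = c • (E q n * K q n ^ m) := by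
    intro m
    induction m with
    | zero => exact ⟨1, by simp⟩
    | succ m ih =>
      obtain ⟨c, hc⟩ := ih
      exact ⟨q ^ 2 * c, by
        rw [pow_succ, mul_assoc, sat.te, mul_smul_comm, ← mul_assoc, hc, smul_mul_assoc, smul_smul,
          mul_assoc]⟩
  obtain ⟨c, hc⟩ := h1 m
  refine ⟨c ^ j, ?_⟩
  induction j with
  | zero => simp
  | succ j ih =>
    rw [pow_succ, ← mul_assoc, ih, smul_mul_assoc, mul_assoc, hc, mul_smul_comm, smul_smul,
      pow_succ, mul_assoc]

theorem exists_K_mul_F_pow (i : ℕ) : ∃ c : k, K q n * F q n ^ i = c • (F q n ^ i * K q n) := by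
  refine ⟨(q ^ 2)⁻¹ ^ i, ?_⟩
  induction i with
  | zero => simp
  | succ i ih =>
    rw [pow_succ, ← mul_assoc, ih, smul_mul_assoc, mul_assoc, sat.tf, mul_smul_comm, smul_smul,
      pow_succ _ i, mul_assoc]

/-- Only the shape of the commutator matters for the spanning argument, so the scalars stay
anonymous. -/
theorem exists_E_mul_F_pow (i : ℕ) : ∃ a b : k, E q n * F q n ^ (i + 1) =
    F q n ^ (i + 1) * E q n + F q n ^ i * (a • K q n + b • Kinv q n) := by
  have h1 : E q n * F q n = F q n * E q n + (q - q⁻¹)⁻¹ • (K q n - Kinv q n) := by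
    rw [← E_F]; abel
  induction i with
  | zero =>
    refine ⟨(q - q⁻¹)⁻¹, -(q - q⁻¹)⁻¹, ?_⟩
    simp [h1, sub_eq_add_neg]
  | succ i ih =>
    obtain ⟨a, b, h⟩ := ih
    refine ⟨(q - q⁻¹)⁻¹ + a * (q ^ 2)⁻¹, -(q - q⁻¹)⁻¹ + b * q ^ 2, ?_⟩
    rw [pow_succ, ← mul_assoc, h, add_mul, mul_assoc, h1, mul_assoc (F q n ^ i), add_mul,
      smul_mul_assoc, smul_mul_assoc, sat.tf, sat.t'f (q_ne_zero q n), pow_succ _ i]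
    simp only [mul_add, mul_smul_comm, mul_assoc, mul_sub, smul_sub, add_smul, smul_smul, neg_smul, mul_neg]
    abel

/-- The span of the monomials `F ^ i E ^ j K ^ l`. -/
def monomialSpan : Submodule k (SmallQuantumGroup q n) :=
  Submodule.span k (Set.range fun t : Fin n × Fin n × Fin n =>
    F q n ^ (t.1 : ℕ) * (E q n ^ (t.2.1 : ℕ) * K q n ^ (t.2.2 : ℕ)))

theorem mem_monomialSpan (i j l : ℕ) :
    F q n ^ i * (E q n ^ j * K q n ^ l) ∈ monomialSpan q n := by
  by_cases hi : i < n
  · by_cases hj : j < n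
    · rw [← pow_mod_orderOf (K q n)]
      have hl : l % orderOf (K q n) < n :=
        lt_of_lt_of_le (Nat.mod_lt _ (orderOf_pos_iff.2 (isOfFinOrder_iff_pow_eq_one.2
          ⟨n, pos n, K_pow q n⟩))) (orderOf_le_of_pow_eq_one (pos n) (K_pow q n))
      exact Submodule.subset_span ⟨(⟨i, hi⟩, ⟨j, hj⟩, ⟨_, hl⟩), rfl⟩
    · obtain ⟨s, rfl⟩ : ∃ s, j = n + s := ⟨j - n, by omega⟩
      simp [pow_add, E_pow]
  · obtain ⟨s, rfl⟩ : ∃ s, i = n + s := ⟨i - n, by omega⟩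
    simp [pow_add, F_pow]

theorem mul_mem_monomialSpan_of {x : SmallQuantumGroup q n}
    (h : ∀ i j l : ℕ, x * (F q n ^ i * (E q n ^ j * K q n ^ l)) ∈ monomialSpan q n)
    {y : SmallQuantumGroup q n} (hy : y ∈ monomialSpan q n) : x * y ∈ monomialSpan q n := by
  induction hy using Submodule.span_induction with
  | mem y hy =>
    obtain ⟨t, rfl⟩ := hy
    exact h _ _ _
  | zero => simp
  | add a b _ _ ha hb => rw [mul_add]; exact add_mem ha hb
  | smul c a _ ha => rw [mul_smul_comm]; exact Submodule.smul_mem _ _ ha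

theorem K_mul_mem_monomialSpan {y : SmallQuantumGroup q n} (hy : y ∈ monomialSpan q n) :
    K q n * y ∈ monomialSpan q n := by
  refine mul_mem_monomialSpan_of q n (fun i j l => ?_) hy
  obtain ⟨c, hc⟩ := exists_K_mul_F_pow q n i
  obtain ⟨d, hd⟩ := exists_K_pow_mul_E_pow q n 1 j
  rw [pow_one] at hd
  rw [← mul_assoc, hc, smul_mul_assoc, mul_assoc, ← mul_assoc (K q n), hd, smul_mul_assoc,
    mul_smul_comm, mul_assoc, ← pow_succ']
  exact Submodule.smul_mem _ _ (Submodule.smul_mem _ _ (mem_monomialSpan q n _ _ _))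

theorem E_mul_mem_monomialSpan {y : SmallQuantumGroup q n} (hy : y ∈ monomialSpan q n) :
    E q n * y ∈ monomialSpan q n := by
  refine mul_mem_monomialSpan_of q n (fun i j l => ?_) hy
  cases i with
  | zero =>
    rw [pow_zero, one_mul, ← mul_assoc, ← pow_succ']
    simpa using mem_monomialSpan q n 0 (j + 1) l
  | succ i =>
    have key : ∀ m, F q n ^ i * (K q n ^ m * (E q n ^ j * K q n ^ l)) ∈ monomialSpan q n := by
      intro m
      obtain ⟨c, hc⟩ := exists_K_pow_mul_E_pow q n m j
      rw [← mul_assoc (K q n ^ m), hc, smul_mul_assoc, mul_smul_comm, mul_assoc, ← pow_add]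
      exact Submodule.smul_mem _ _ (mem_monomialSpan q n _ _ _)
    obtain ⟨a, b, h⟩ := exists_E_mul_F_pow q n i
    rw [← mul_assoc, h, add_mul, mul_assoc, ← mul_assoc (E q n), ← pow_succ', mul_assoc, add_mul,
      mul_add, smul_mul_assoc, smul_mul_assoc, mul_smul_comm, mul_smul_comm, Kinv_eq_pow]
    refine add_mem (mem_monomialSpan q n _ _ _) (add_mem ?_ ?_)
    · refine Submodule.smul_mem _ _ ?_
      simpa using key 1
    · exact Submodule.smul_mem _ _ (key _)

/-- The span contains `1` and is stable under left multiplication by the generators. Finite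
dimensionality needs only this spanning half of the PBW theorem. -/
theorem monomialSpan_eq_top : monomialSpan q n = ⊤ := by
  rw [eq_top_iff]
  have main : ∀ x y, y ∈ monomialSpan q n → x * y ∈ monomialSpan q n := by
    intro x
    induction x using induction_on with
    | hc c =>
      intro y hy
      rw [← Algebra.smul_def]
      exact Submodule.smul_mem _ _ hy
    | hE => exact fun y => E_mul_mem_monomialSpan q n
    | hF =>
      intro y
      refine mul_mem_monomialSpan_of q n (fun i j l => ?_)
      rw [← mul_assoc, ← pow_succ']
      exact mem_monomialSpan q n _ _ _
    | hK => exact fun y => K_mul_mem_monomialSpan q n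
    | hK' =>
      rw [Kinv_eq_pow]
      generalize n - 1 = m
      induction m with
      | zero => simp
      | succ m ih =>
        intro y hy
        rw [pow_succ', mul_assoc]
        exact K_mul_mem_monomialSpan q n (ih y hy)
    | hadd a b ha hb => intro y hy; rw [add_mul]; exact add_mem (ha y hy) (hb y hy)
    | hmul a b ha hb => intro y hy; rw [mul_assoc]; exact ha _ (hb y hy)
  intro x _
  rw [← mul_one x]
  exact main x 1 (by simpa using mem_monomialSpan q n 0 0 0)

instance finite : Module.Finite k (SmallQuantumGroup q n) :=
  ⟨monomialSpan_eq_top q n ▸ Submodule.fg_span (Set.finite_range _)⟩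

end Finite

end SmallQuantumGroup

/-! ### The indecomposable projective modules -/

namespace SmallQuantumGroup

open Polynomial

section Idempotents

variable {k : Type u} [Field k] (q : k) (n : ℕ)

/-- The projection onto the vectors of weight `μ`. -/
def weightProj (μ : k) : SmallQuantumGroup q n :=
  ∑ i ∈ Finset.range n, ((n : k)⁻¹ * μ⁻¹ ^ i) • K q n ^ i

theorem K_mul_weightProj {μ : k} (hμ : μ ^ n = 1) :
    K q n * weightProj q n μ = μ • weightProj q n μ := by
  rcases Nat.eq_zero_or_pos n with rfl | hn
  · simp [weightProj]
  have hμ0 : μ ≠ 0 := by rintro rfl; simp [hn.ne'] at hμ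
  have h1 : K q n * weightProj q n μ =
      ∑ i ∈ Finset.range n, μ • (((n : k)⁻¹ * μ⁻¹ ^ (i + 1)) • K q n ^ (i + 1)) := by
    rw [weightProj, Finset.mul_sum]
    refine Finset.sum_congr rfl fun i _ => ?_
    rw [mul_smul_comm, ← pow_succ', smul_smul]
    congr 1
    rw [pow_succ]
    field_simp
  rw [h1, ← Finset.smul_sum, weightProj]
  congr 1
  have h2 := Finset.sum_range_succ (fun i => ((n : k)⁻¹ * μ⁻¹ ^ i) • K q n ^ i) n
  rw [Finset.sum_range_succ'] at h2
  simpa [K_pow, inv_pow, hμ] using h2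

variable [Fact (2 < n)] [Fact (Odd n)] [Fact (orderOf q = n ∨ orderOf q = 2 * n)]

theorem weightProj_smul [CharZero k] {M : Type u} [AddCommGroup M] [Module k M]
    [Module (SmallQuantumGroup q n) M] [IsScalarTower k (SmallQuantumGroup q n) M] {μ : k}
    (hμ : μ ^ n = 1) {v : M} (h : K q n • v = μ • v) : weightProj q n μ • v = v := by
  have hn : (n : k) ≠ 0 := Nat.cast_ne_zero.2 (pos n).ne'
  have hμ0 : μ ≠ 0 := by rintro rfl; simp [(pos n).ne'] at hμ
  have e : ∀ m : ℕ, K q n ^ m • v = μ ^ m • v := by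
    intro m
    induction m with
    | zero => simp
    | succ m ih => rw [pow_succ', mul_smul, ih, smul_comm, h, smul_smul, pow_succ]
  rw [weightProj, Finset.sum_smul]
  have : ∀ i ∈ Finset.range n, (((n : k)⁻¹ * μ⁻¹ ^ i) • K q n ^ i) • v = (n : k)⁻¹ • v := by
    intro i _
    rw [smul_assoc, e, smul_smul, mul_assoc, ← mul_pow, inv_mul_cancel₀ hμ0, one_pow, mul_one]
  rw [Finset.sum_congr rfl this, Finset.sum_const, Finset.card_range, ← Nat.cast_smul_eq_nsmul k,
    smul_smul, mul_inv_cancel₀ hn, one_smul]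

/-- The polynomial in the Casimir element that `F ^ n E ^ n` equals on vectors of weight
`hw q n r`. -/
def weightPoly (r : ℕ) : k[X] :=
  ∏ j ∈ Finset.range n, (X - C (casVal q (hw q n r * (q ^ 2) ^ j)))

/-- The polynomial is `F ^ n E ^ n` on vectors of this weight, and `E ^ n = 0`. -/
theorem aeval_weightPoly_smul {M : Type u} [AddCommGroup M] [Module k M]
    [Module (SmallQuantumGroup q n) M] [IsScalarTower k (SmallQuantumGroup q n) M] {r : ℕ}
    {v : M} (h : K q n • v = hw q n r • v) : aeval (casimir q n) (weightPoly q n r) • v = 0 := by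
  rw [weightPoly, ← F_pow_smul_E_pow (hw_ne_zero q n r) h, E_pow, zero_smul, smul_zero]

/-- The value `c` of the Casimir element on the simple module of dimension `r` is at most a double
root of `weightPoly`. Hence there is a polynomial `e` that is `1` modulo `(X - c)²` and vanishes on
the rest: `e` of the Casimir element projects onto the generalized eigenspace of `c`. -/
theorem exists_blockPoly {r : ℕ} (h1 : 1 ≤ r) (hr : r ≤ n) :
    ∃ e : k[X], weightPoly q n r ∣ (X - C (casVal q (hw q n r))) ^ 2 * e ∧
      (X - C (casVal q (hw q n r))) ^ 2 ∣ 1 - e := by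
  classical
  set c := casVal q (hw q n r) with hc
  set f : ℕ → k := fun j => casVal q (hw q n r * (q ^ 2) ^ j) with hf
  have hsplit := Finset.prod_filter_mul_prod_filter_not (Finset.range n) (fun j => f j = c)
    (fun j => X - C (f j))
  have hA : ∏ j ∈ (Finset.range n).filter (fun j => f j = c), (X - C (f j)) ∣ (X - C c) ^ 2 := by
    rw [Finset.prod_congr rfl (g := fun _ => X - C c)
      (fun j hj => by rw [(Finset.mem_filter.1 hj).2]), Finset.prod_const]
    -- The root `c` occurs only at `j = 0` and `j = n - r`; for `r = n` the two coincide.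
    refine pow_dvd_pow _ ((Finset.card_le_card (t := {0, n - r}) fun j hj => ?_).trans
      Finset.card_le_two)
    rw [Finset.mem_filter, Finset.mem_range] at hj
    have hj2 := (casVal_hw_mul_iff q n r j).1 hj.2
    rw [Finset.mem_insert, Finset.mem_singleton]
    rcases hj2 with ⟨a, ha⟩ | ⟨a, ha⟩
    · left
      rcases Nat.eq_zero_or_pos a with rfl | h
      · simpa using ha
      · have := Nat.le_mul_of_pos_right n h
        omega
    · have : a ≠ 0 := by rintro rfl; omega
      have : a < 2 := by
        by_contra h3
        have : n * 2 ≤ n * a := Nat.mul_le_mul_left n (by omega)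
        omega
      interval_cases a <;> omega
  have hB : IsCoprime ((X - C c) ^ 2)
      (∏ j ∈ (Finset.range n).filter (fun j => ¬ f j = c), (X - C (f j))) := by
    refine IsCoprime.pow_left (IsCoprime.prod_right fun j hj => ?_)
    exact isCoprime_X_sub_C_of_isUnit_sub
      (sub_ne_zero.2 fun h => (Finset.mem_filter.1 hj).2 h.symm).isUnit
  -- Bézout: with `a (X - c)² + b B = 1`, where `B` is the product of the other factors, take `e = b
  -- B`.
  obtain ⟨a, b, hab⟩ := hB
  refine ⟨b * ∏ j ∈ (Finset.range n).filter (fun j => ¬ f j = c), (X - C (f j)), ?_, ?_⟩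
  · rw [weightPoly]
    change ∏ j ∈ Finset.range n, (X - C (f j)) ∣ _
    rw [← hsplit, mul_left_comm]
    exact dvd_mul_of_dvd_right (mul_dvd_mul_right hA _) _
  · exact ⟨a, by rw [← hab]; ring⟩

/-- The idempotent that projects onto the generalized eigenvectors of the Casimir element among the
vectors of weight `hw q n r`. -/
def idem (r : ℕ) : SmallQuantumGroup q n :=
  if h : 1 ≤ r ∧ r ≤ n then
    aeval (casimir q n) (exists_blockPoly q n h.1 h.2).choose * weightProj q n (hw q n r)
  else 0

section Action

variable {q n} {M : Type u} [AddCommGroup M] [Module k M]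
  [Module (SmallQuantumGroup q n) M] [IsScalarTower k (SmallQuantumGroup q n) M] {r : ℕ}

theorem aeval_casimir_smul_comm (p : k[X]) (x : SmallQuantumGroup q n) (v : M) :
    aeval (casimir q n) p • x • v = x • aeval (casimir q n) p • v := by
  have h : Commute (aeval (casimir q n) p) x := by
    induction p using Polynomial.induction_on' with
    | add a b ha hb => rw [map_add]; exact ha.add_left hb
    | monomial i c =>
      rw [aeval_monomial]
      exact Commute.mul_left (Algebra.commutes c x) ((casimir_comm x).pow_left i)
  rw [← mul_smul, ← mul_smul, h.eq]

theorem aeval_casimir_smul {c : k} {v : M} (h : casimir q n • v = c • v) (p : k[X]) :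
    aeval (casimir q n) p • v = p.eval c • v := by
  induction p using Polynomial.induction_on' with
  | add a b ha hb => rw [map_add, add_smul, ha, hb, eval_add, add_smul]
  | monomial i a =>
    rw [aeval_monomial, eval_monomial, mul_smul, mul_smul, algebraMap_smul]
    congr 1
    induction i with
    | zero => simp
    | succ i ih => rw [pow_succ', mul_smul, ih, smul_comm, h, smul_smul, pow_succ]

theorem K_smul_idem_smul (h1 : 1 ≤ r) (hr : r ≤ n) (v : M) :
    K q n • idem q n r • v = hw q n r • idem q n r • v := by
  rw [idem, dif_pos ⟨h1, hr⟩, mul_smul, ← aeval_casimir_smul_comm, ← mul_smul (K q n),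
    K_mul_weightProj q n (hw_pow q n r), smul_assoc, smul_comm]

theorem casimir_smul_idem_smul (h1 : 1 ≤ r) (hr : r ≤ n) (v : M) :
    aeval (casimir q n) ((X - C (casVal q (hw q n r))) ^ 2) • idem q n r • v = 0 := by
  obtain ⟨g, hg⟩ := (exists_blockPoly q n h1 hr).choose_spec.1
  rw [idem, dif_pos ⟨h1, hr⟩, mul_smul, ← mul_smul, ← map_mul, hg, mul_comm, map_mul, mul_smul,
    aeval_weightPoly_smul, smul_zero]
  rw [← mul_smul, K_mul_weightProj q n (hw_pow q n r), smul_assoc]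

theorem idem_smul [CharZero k] (h1 : 1 ≤ r) (hr : r ≤ n) {v : M} (hK : K q n • v = hw q n r • v)
    (hC : aeval (casimir q n) ((X - C (casVal q (hw q n r))) ^ 2) • v = 0) :
    idem q n r • v = v := by
  obtain ⟨g, hg⟩ := (exists_blockPoly q n h1 hr).choose_spec.2
  have e : (exists_blockPoly q n h1 hr).choose =
      1 - g * (X - C (casVal q (hw q n r))) ^ 2 := by
    rw [mul_comm, ← hg]; ring
  rw [idem, dif_pos ⟨h1, hr⟩, mul_smul, weightProj_smul q n (hw_pow q n r) hK, e, map_sub, map_mul,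
    sub_smul, mul_smul, hC, smul_zero, map_one, one_smul, sub_zero]

theorem idem_smul_eq_iff [CharZero k] (h1 : 1 ≤ r) (hr : r ≤ n) {v : M} :
    idem q n r • v = v ↔ K q n • v = hw q n r • v ∧
      aeval (casimir q n) ((X - C (casVal q (hw q n r))) ^ 2) • v = 0 := by
  refine ⟨fun h => ?_, fun h => idem_smul h1 hr h.1 h.2⟩
  have h2 := K_smul_idem_smul (q := q) h1 hr v
  have h3 := casimir_smul_idem_smul (q := q) h1 hr v
  rw [h] at h2 h3
  exact ⟨h2, h3⟩

theorem idem_smul_idem_smul [CharZero k] (h1 : 1 ≤ r) (hr : r ≤ n) (v : M) :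
    idem q n r • idem q n r • v = idem q n r • v :=
  idem_smul h1 hr (K_smul_idem_smul h1 hr v) (casimir_smul_idem_smul h1 hr v)

variable (q n M) in
/-- The vectors fixed by the idempotent `idem q n r`. -/
def block (r : ℕ) : Submodule k M :=
  LinearMap.ker (Algebra.lsmul k k M (idem q n r) - LinearMap.id)

theorem mem_block {v : M} : v ∈ block q n M r ↔ idem q n r • v = v := by
  simp [block, sub_eq_zero]

/-- On the highest weight `hw q n n`, the block consists of highest weight vectors. -/
theorem E_smul_eq_zero_of_mem_block [CharZero k] {v : M} (h : v ∈ block q n M n) :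
    E q n • v = 0 := by
  have hn := pos n
  obtain ⟨hK, hC⟩ := (idem_smul_eq_iff hn le_rfl).1 (mem_block.1 h)
  -- If the Casimir element acts on `E u` by the scalar `c`, then `F ^ (n - 1) E ^ (n - 1)`
  -- multiplies `E u` by a product of differences between `c` and the values at `j = 1, ..., n - 1`,
  -- none of which is zero. But `E ^ n = 0`, so `E u = 0`.
  have key : ∀ u : M, K q n • u = hw q n n • u → casimir q n • E q n • u =
      casVal q (hw q n n) • E q n • u → E q n • u = 0 := by
    intro u hKu hCu
    have h0 : hw q n n * q ^ 2 ≠ 0 := mul_ne_zero (hw_ne_zero q n n)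
      (pow_ne_zero _ (q_ne_zero q n))
    have h2 := F_pow_smul_E_pow h0 (K_smul_E hKu) (n - 1)
    rw [← mul_smul (E q n ^ (n - 1)), ← pow_succ, Nat.sub_add_cancel hn, E_pow, zero_smul,
      smul_zero, aeval_casimir_smul hCu, eq_comm, smul_eq_zero, eval_prod,
      Finset.prod_eq_zero_iff] at h2
    refine h2.resolve_left ?_
    rintro ⟨j, hj, h⟩
    rw [Finset.mem_range] at hj
    rw [eval_sub, eval_X, eval_C, sub_eq_zero, mul_assoc, ← pow_succ', eq_comm,
      casVal_hw_mul_iff, Nat.dvd_add_right dvd_rfl, or_self] at h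
    exact absurd (Nat.le_of_dvd (by omega) h) (by omega)
  have hFE : F q n • E q n • v = aeval (casimir q n) (X - C (casVal q (hw q n n))) • v := by
    rw [F_smul_E (hw_ne_zero q n n) hK]
    simp [sub_smul]
  have hK' : K q n • F q n • E q n • v = hw q n n • F q n • E q n • v := by
    rw [K_smul_F (K_smul_E hK), mul_assoc,
      mul_inv_cancel₀ (pow_ne_zero _ (q_ne_zero q n)), mul_one]
  have hC' : casimir q n • F q n • E q n • v = casVal q (hw q n n) • F q n • E q n • v := by
    rw [hFE, ← sub_eq_zero]
    rw [sq, map_mul, mul_smul] at hC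
    rw [← hC]
    simp [sub_smul]
  refine key v hK ?_
  -- A priori `v` is only a generalized eigenvector. Since `F E v = (C - c) v` is an honest
  -- eigenvector, `key` shows that `E` kills it; thus `(C - c) E v = 0`, and `key` applies to `v`
  -- itself.
  have := key _ hK' (by rw [casimir_smul_comm, hC', smul_comm])
  rw [F_smul_E (hw_ne_zero q n n) hK, smul_sub, sub_eq_zero] at this
  rw [casimir_smul_comm, this, smul_comm]

end Action

end Idempotents

/-! ### Projective covers as left ideals generated by idempotents -/

section Projective

variable {k : Type u} [Field k] [CharZero k] (q : k) (n : ℕ)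
  [Fact (2 < n)] [Fact (Odd n)] [Fact (orderOf q = n ∨ orderOf q = 2 * n)]

/-- The projective cover of the simple module of dimension `r`. -/
def projMod (r : ℕ) : FDMod k (SmallQuantumGroup q n) where
  carrier := Submodule.span (SmallQuantumGroup q n) {idem q n r}
  finite := Module.Finite.of_injective
    ((Submodule.span (SmallQuantumGroup q n) {idem q n r}).subtype.restrictScalars k)
    Subtype.val_injective

/-- The generator of `projMod q n r`. -/
def projGen (r : ℕ) : projMod q n r :=
  ⟨idem q n r, Submodule.mem_span_singleton_self _⟩

variable {q n} {r : ℕ}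

theorem exists_smul_projGen (x : projMod q n r) :
    ∃ y : SmallQuantumGroup q n, x = y • projGen q n r := by
  obtain ⟨y, hy⟩ := Submodule.mem_span_singleton.1 x.2
  exact ⟨y, Subtype.ext hy.symm⟩

theorem idem_smul_projGen (h1 : 1 ≤ r) (hr : r ≤ n) :
    idem q n r • projGen q n r = projGen q n r := by
  refine Subtype.ext ?_
  have := idem_smul_idem_smul (q := q) h1 hr (1 : SmallQuantumGroup q n)
  rwa [smul_eq_mul _ 1, mul_one] at this

section Hom

variable {M : Type u} [AddCommGroup M] [Module k M]
  [Module (SmallQuantumGroup q n) M] [IsScalarTower k (SmallQuantumGroup q n) M]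

/-- The map from `projMod q n r` attached to a vector. -/
def projHom (r : ℕ) (v : M) : projMod q n r →ₗ[SmallQuantumGroup q n] M :=
  (LinearMap.toSpanSingleton (SmallQuantumGroup q n) M v) ∘ₗ
    (Submodule.span (SmallQuantumGroup q n) {idem q n r}).subtype

theorem projHom_projGen (v : M) : projHom r v (projGen q n r) = idem q n r • v := rfl

theorem projHom_ext {f g : projMod q n r →ₗ[SmallQuantumGroup q n] M}
    (h : f (projGen q n r) = g (projGen q n r)) : f = g := by
  ext x
  obtain ⟨y, rfl⟩ := exists_smul_projGen x
  rw [map_smul, map_smul, h]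

/-- Maps from `projMod q n r` are the vectors fixed by the idempotent. -/
def projHomEquiv (h1 : 1 ≤ r) (hr : r ≤ n) :
    (projMod q n r →ₗ[SmallQuantumGroup q n] M) ≃ₗ[k] block q n M r where
  toFun f := ⟨f (projGen q n r), by rw [mem_block, ← map_smul, idem_smul_projGen h1 hr]⟩
  map_add' f g := rfl
  map_smul' c f := rfl
  invFun v := projHom r v.1
  left_inv f := projHom_ext (by rw [projHom_projGen, ← map_smul, idem_smul_projGen h1 hr])
  right_inv v := Subtype.ext (by simp only [projHom_projGen, mem_block.1 v.2])

end Hom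

/-- The left ideal generated by an idempotent is a direct summand of the algebra: right
multiplication by the idempotent retracts onto it. -/
theorem projective_projMod (h1 : 1 ≤ r) (hr : r ≤ n) :
    Module.Projective (SmallQuantumGroup q n) (projMod q n r) := by
  refine Module.Projective.of_split (P := projMod q n r) (M := SmallQuantumGroup q n)
    (Submodule.span (SmallQuantumGroup q n) {idem q n r}).subtype
    (LinearMap.toSpanSingleton _ _ (projGen q n r)) ?_
  exact projHom_ext (idem_smul_projGen h1 hr)

/-- The Casimir value leaves only `s = r` and `s = n - r`, and the weights decide between them. This
is what makes `projMod q n r` map onto the simple module of dimension `r` and no other. -/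
theorem coords_eq_zero_of_mem_block {s : ℕ} {hs : s ≤ n} (h1 : 1 ≤ r) (hr : r ≤ n) (hs1 : 1 ≤ s)
    {v : simpleMod q n s hs} (hv : v ∈ block q n (simpleMod q n s hs) r) (i : Fin s)
    (hi : coords v i ≠ 0) : s = r ∧ (i : ℕ) = 0 := by
  have hq := q_ne_zero q n
  have hv0 : v ≠ 0 := by rintro rfl; simp at hi
  obtain ⟨hK, hC⟩ := (idem_smul_eq_iff h1 hr).1 (mem_block.1 hv)
  rw [aeval_casimir_smul (casimir_smul_simpleMod v), smul_eq_zero, or_iff_left hv0, eval_pow,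
    eval_sub, eval_X, eval_C, sq_eq_zero_iff, sub_eq_zero, casVal_hw_eq_iff q n hs1 hs h1 hr] at hC
  have hKi := congrFun (congrArg coords hK) i
  rw [coords_K, opDiag_apply, map_smul, Pi.smul_apply, smul_eq_mul, mul_left_inj' hi] at hKi
  have hQ : ∀ j : ℕ, (q ^ 2)⁻¹ ^ j ≠ 0 := fun j => pow_ne_zero _ (inv_ne_zero (pow_ne_zero _ hq))
  have hi2 := i.2
  rcases hC with rfl | h
  · refine ⟨rfl, ?_⟩
    rw [mul_eq_left₀ (hw_ne_zero q n s), inv_pow, inv_eq_one, q_sq_pow_eq_one_iff q n] at hKi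
    exact Nat.eq_zero_of_dvd_of_lt hKi (by omega)
  -- For `r = n - s` the weight would be the one reached after `s` steps down. The string holds only
  -- the steps `i < s`, and weights repeat with period `n > s`.
  · exfalso
    obtain rfl : r = n - s := by omega
    rw [← hw_mul_inv_pow hs, mul_right_inj' (hw_ne_zero q n s)] at hKi
    obtain ⟨j, hj⟩ : ∃ j, s = i + j := ⟨s - i, by omega⟩
    have hKi' : (q ^ 2)⁻¹ ^ (i : ℕ) = (q ^ 2)⁻¹ ^ ((i : ℕ) + j) := by rw [← hj]; exact hKi
    rw [pow_add, eq_comm, mul_eq_left₀ (hQ i), inv_pow, inv_eq_one, q_sq_pow_eq_one_iff q n] at hKi'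
    exact absurd (Nat.le_of_dvd (by omega) hKi') (by omega)

theorem vec_zero_mem_block {hr : r ≤ n} (h1 : 1 ≤ r) :
    vec hr 0 ∈ block q n (simpleMod q n r hr) r := by
  refine mem_block.2 (idem_smul h1 hr (by simpa using K_smul_vec (q := q) (hr := hr) 0) ?_)
  rw [aeval_casimir_smul (casimir_smul_simpleMod _)]
  simp

theorem eq_of_mem_block {s : ℕ} {hs : s ≤ n} (h1 : 1 ≤ r) (hr : r ≤ n) (hs1 : 1 ≤ s)
    {v : simpleMod q n s hs} (hv : v ∈ block q n (simpleMod q n s hs) r) (hv0 : v ≠ 0) : s = r := by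
  by_contra h
  refine hv0 (coords.injective ?_)
  ext i
  by_contra hi
  exact h (coords_eq_zero_of_mem_block h1 hr hs1 hv i (by simpa using hi)).1

theorem eq_smul_vec_of_mem_block {hr : r ≤ n} (h1 : 1 ≤ r) {v : simpleMod q n r hr}
    (hv : v ∈ block q n (simpleMod q n r hr) r) : v = coords v ⟨0, h1⟩ • vec hr 0 := by
  apply coords.injective
  ext i
  rw [map_smul, Pi.smul_apply, coords_vec]
  split_ifs with h
  · rw [show i = ⟨0, h1⟩ from Fin.ext h]; simp
  · rw [smul_zero]
    by_contra hi
    exact h (coords_eq_zero_of_mem_block h1 hr h1 hv i hi).2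

theorem finrank_block_simpleMod {s : ℕ} {hs : s ≤ n} (h1 : 1 ≤ r) (hr : r ≤ n) (hs1 : 1 ≤ s) :
    Module.finrank k (block q n (simpleMod q n s hs) r) = if s = r then 1 else 0 := by
  split_ifs with h
  · subst h
    have : block q n (simpleMod q n s hs) s = Submodule.span k {vec hs 0} := by
      refine le_antisymm (fun v hv => ?_) ?_
      · rw [eq_smul_vec_of_mem_block h1 hv]
        exact Submodule.smul_mem _ _ (Submodule.mem_span_singleton_self _)
      · rw [Submodule.span_singleton_le_iff_mem]
        exact vec_zero_mem_block h1
    rw [this, finrank_span_singleton (vec_ne_zero (by omega))]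
  · have : block q n (simpleMod q n s hs) r = ⊥ := by
      rw [eq_bot_iff]
      intro v hv
      by_contra hv0
      exact h (eq_of_mem_block h1 hr hs1 hv hv0)
    rw [this, finrank_bot]

/-- The projection of `projMod q n r` onto the simple module of dimension `r`. -/
def toSimple (hr : r ≤ n) : projMod q n r →ₗ[SmallQuantumGroup q n] simpleMod q n r hr :=
  projHom r (vec hr 0)

theorem toSimple_projGen (h1 : 1 ≤ r) (hr : r ≤ n) :
    toSimple hr (projGen q n r) = vec hr 0 :=
  (projHom_projGen _).trans (mem_block.1 (vec_zero_mem_block h1))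

theorem toSimple_surjective (h1 : 1 ≤ r) (hr : r ≤ n) :
    Function.Surjective (toSimple (q := q) hr) := by
  have := isSimpleModule_simpleMod (q := q) (hr := hr) h1
  refine LinearMap.surjective_of_ne_zero fun h => vec_ne_zero (q := q) (hr := hr) (i := 0) h1 ?_
  rw [← toSimple_projGen h1 hr, h, LinearMap.zero_apply]

theorem projGen_ne_zero (h1 : 1 ≤ r) (hr : r ≤ n) : projGen q n r ≠ 0 := by
  intro h
  apply vec_ne_zero (q := q) (hr := hr) (i := 0) h1
  rw [← toSimple_projGen h1 hr, h, map_zero]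

/-- The kernel of `toSimple` is superfluous. -/
theorem surjective_of_toSimple_comp_ne_zero [IsAlgClosed k] (h1 : 1 ≤ r) (hr : r ≤ n)
    {M : Type u} [AddCommGroup M] [Module (SmallQuantumGroup q n) M]
    (f : M →ₗ[SmallQuantumGroup q n] projMod q n r) (hf : toSimple hr ∘ₗ f ≠ 0) :
    Function.Surjective f := by
  rw [← LinearMap.range_eq_top]
  by_contra htop
  have : IsNoetherian (SmallQuantumGroup q n) (projMod q n r) := isNoetherian_of_tower k inferInstance
  -- If `f` were not onto, its range would lie in a maximal submodule `N` with simple quotient. The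
  -- block computation makes the quotient map a nonzero multiple of `toSimple`, so `toSimple` would
  -- kill the range of `f`.
  obtain ⟨N, hN, hle⟩ := (eq_top_or_exists_le_coatom (LinearMap.range f)).resolve_left htop
  have hsimple : IsSimpleModule (SmallQuantumGroup q n) (projMod q n r ⧸ N) :=
    isSimpleModule_iff_isCoatom.2 hN
  have : Module.Finite k (projMod q n r ⧸ N) :=
    Module.Finite.of_surjective (N.mkQ.restrictScalars k) N.mkQ_surjective
  obtain ⟨s, hs, hs1, ⟨e⟩⟩ := exists_equiv_simpleMod (q := q) (n := n) (M := projMod q n r ⧸ N)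
  set h : projMod q n r →ₗ[SmallQuantumGroup q n] simpleMod q n s hs := e.symm.toLinearMap ∘ₗ N.mkQ
  have hh : Function.Surjective h := e.symm.surjective.comp N.mkQ_surjective
  have hmem : h (projGen q n r) ∈ block q n (simpleMod q n s hs) r :=
    (projHomEquiv h1 hr h).2
  have hne : h (projGen q n r) ≠ 0 := by
    intro h0
    obtain ⟨x, hx⟩ := hh (vec hs 0)
    obtain ⟨y, rfl⟩ := exists_smul_projGen x
    rw [map_smul, h0, smul_zero] at hx
    exact vec_ne_zero (by omega) hx.symm
  obtain rfl := eq_of_mem_block h1 hr hs1 hmem hne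
  have e1 := eq_smul_vec_of_mem_block h1 hmem
  set c := coords (h (projGen q n s)) ⟨0, h1⟩
  have hc : c ≠ 0 := by
    intro hc
    rw [hc, zero_smul] at e1
    exact hne e1
  have e2 : h = c • toSimple hs := projHom_ext (by
    rw [e1, LinearMap.smul_apply, toSimple_projGen h1])
  apply hf
  ext x
  have hx : h (f x) = 0 := by
    change e.symm (N.mkQ (f x)) = 0
    have hf0 : N.mkQ (f x) = 0 := (Submodule.Quotient.mk_eq_zero N).2 (hle ⟨x, rfl⟩)
    rw [hf0, map_zero]
  rw [e2, LinearMap.smul_apply, smul_eq_zero] at hx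
  exact hx.resolve_left hc

/-- The simple module of dimension `n` is projective. -/
theorem simpleMod_iso_projMod : simpleMod q n n le_rfl ≈ projMod q n n := by
  have hn := pos n
  have h := mem_block.2 (idem_smul_projGen (q := q) hn le_rfl)
  have := isSimpleModule_simpleMod (q := q) (hr := le_refl n) hn
  -- For `r = n` the generator is a highest weight vector by `E_smul_eq_zero_of_mem_block`, so it
  -- receives a map from the simple module, which is injective by simplicity and surjective because
  -- it hits the generator.
  set f := simpleHom le_rfl (projGen q n n) ((idem_smul_eq_iff hn le_rfl).1 (mem_block.1 h)).1
    (E_smul_eq_zero_of_mem_block h) (by rw [F_pow, zero_smul])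
  have hf : f (vec le_rfl 0) = projGen q n n := simpleHom_vec_zero _ _ _ _ _
  refine ⟨LinearEquiv.ofBijective f ⟨LinearMap.injective_of_ne_zero fun h0 => ?_, fun x => ?_⟩⟩
  · apply projGen_ne_zero (q := q) hn le_rfl
    rw [← hf, h0, LinearMap.zero_apply]
  · obtain ⟨y, rfl⟩ := exists_smul_projGen x
    exact ⟨y • vec le_rfl 0, by rw [map_smul, hf]⟩

end Projective

end SmallQuantumGroup

/-! ### Tensor products with the two dimensional simple module -/

namespace SmallQuantumGroup

section Pair

variable {k : Type u} [Field k] {q : k} {n : ℕ}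
  [Fact (2 < n)] [Fact (Odd n)] [Fact (orderOf q = n ∨ orderOf q = 2 * n)]

/-- The coordinates of a vector of `V₂`. -/
def coordsV₂ : V₂ q n ≃ₗ[k] (Fin 2 → k) := LinearEquiv.refl k _

open Matrix in
theorem coordsV₂_E (v : V₂ q n) : coordsV₂ (E q n • v) = ![0, coordsV₂ v 0] := by
  have : coordsV₂ (E q n • v) = lift _ _ _ _ (sat_V₂ q n) (E q n) *ᵥ coordsV₂ v := rfl
  rw [this, lift_E]
  ext i
  fin_cases i <;> simp [Matrix.mulVec, dotProduct]

open Matrix in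
theorem coordsV₂_F (v : V₂ q n) : coordsV₂ (F q n • v) = ![q ^ n * coordsV₂ v 1, 0] := by
  have : coordsV₂ (F q n • v) = lift _ _ _ _ (sat_V₂ q n) (F q n) *ᵥ coordsV₂ v := rfl
  rw [this, lift_F]
  ext i
  fin_cases i <;> simp [Matrix.mulVec, dotProduct]

theorem pow_mul_inv_eq : q ^ n * q⁻¹ = (root q n)⁻¹ := by
  rw [root, mul_inv, ← eq_inv_of_mul_eq_one_left (q_pow_n_sq q n)]

open Matrix in
theorem coordsV₂_K (v : V₂ q n) :
    coordsV₂ (K q n • v) = ![(root q n)⁻¹ * coordsV₂ v 0, root q n * coordsV₂ v 1] := by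
  have : coordsV₂ (K q n • v) = lift _ _ _ _ (sat_V₂ q n) (K q n) *ᵥ coordsV₂ v := rfl
  rw [this, lift_K]
  ext i
  fin_cases i <;> simp [Matrix.mulVec, dotProduct, pow_mul_inv_eq, root]

open Matrix in
theorem coordsV₂_Kinv (v : V₂ q n) :
    coordsV₂ (Kinv q n • v) = ![root q n * coordsV₂ v 0, (root q n)⁻¹ * coordsV₂ v 1] := by
  have : coordsV₂ (Kinv q n • v) = lift _ _ _ _ (sat_V₂ q n) (Kinv q n) *ᵥ coordsV₂ v := rfl
  rw [this, lift_Kinv]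
  ext i
  fin_cases i <;> simp [Matrix.mulVec, dotProduct, pow_mul_inv_eq, root]

/-- A vector of `V₂ ⊗ M` is `m₁ ⊗ a + m₂ ⊗ b` for a unique pair `(a, b)`. -/
def pair (M : FDMod k (SmallQuantumGroup q n)) : (V₂ q n).tensor M ≃ₗ[k] M × M :=
  (FDMod.tensorEquiv (V₂ q n) M).trans
    ((TensorProduct.congr coordsV₂ (LinearEquiv.refl k M)).trans
      ((TensorProduct.comm k (Fin 2 → k) M).trans
        ((TensorProduct.piScalarRight k k M (Fin 2)).trans (LinearEquiv.finTwoArrow k M))))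

variable {M N : FDMod k (SmallQuantumGroup q n)}

theorem pair_tmul (x : V₂ q n) (m : M) :
    pair M ((FDMod.tensorEquiv (V₂ q n) M).symm (x ⊗ₜ m)) =
      (coordsV₂ x 0 • m, coordsV₂ x 1 • m) := by
  simp [pair]

theorem pair_smul (h : SmallQuantumGroup q n) (t : (V₂ q n).tensor M) :
    pair M (h • t) = pair M ((FDMod.tensorEquiv (V₂ q n) M).symm
      (FDMod.tensorAction (V₂ q n) M (comulHom q n h) (FDMod.tensorEquiv (V₂ q n) M t))) := rfl

theorem tensor_induction {p : (V₂ q n).tensor M → Prop} (t : (V₂ q n).tensor M) (h0 : p 0)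
    (hadd : ∀ s t, p s → p t → p (s + t))
    (ht : ∀ (x : V₂ q n) (m : M), p ((FDMod.tensorEquiv (V₂ q n) M).symm (x ⊗ₜ m))) : p t := by
  obtain ⟨t, rfl⟩ := (FDMod.tensorEquiv (V₂ q n) M).symm.surjective t
  induction t with
  | zero => rwa [map_zero]
  | add s t hs ht => rw [map_add]; exact hadd _ _ hs ht
  | tmul x m => exact ht x m

theorem pair_E (t : (V₂ q n).tensor M) : pair M (E q n • t) =
    (E q n • (pair M t).1, K q n • (pair M t).1 + E q n • (pair M t).2) := by
  induction t using tensor_induction with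
  | h0 => simp [Prod.ext_iff]
  | hadd s t hs ht =>
    rw [smul_add, map_add, hs, ht, map_add]
    ext <;> simp [smul_add]
    abel
  | ht x m =>
    rw [pair_smul, LinearEquiv.apply_symm_apply, comulHom, lift_E, map_add, LinearMap.add_apply,
      FDMod.tensorAction_tmul, FDMod.tensorAction_tmul, map_add, map_add, pair_tmul, pair_tmul,
      pair_tmul, coordsV₂_E, one_smul]
    ext <;> simp [smul_comm (_ : SmallQuantumGroup q n) (_ : k) m]

theorem pair_F (t : (V₂ q n).tensor M) : pair M (F q n • t) =
    (root q n • F q n • (pair M t).1 + q ^ n • (pair M t).2,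
      (root q n)⁻¹ • F q n • (pair M t).2) := by
  induction t using tensor_induction with
  | h0 => simp [Prod.ext_iff]
  | hadd s t hs ht =>
    rw [smul_add, map_add, hs, ht, map_add]
    ext <;> simp [smul_add]
    abel
  | ht x m =>
    rw [pair_smul, LinearEquiv.apply_symm_apply, comulHom, lift_F, map_add, LinearMap.add_apply,
      FDMod.tensorAction_tmul, FDMod.tensorAction_tmul, map_add, map_add, pair_tmul, pair_tmul,
      pair_tmul, coordsV₂_F, coordsV₂_Kinv, one_smul]
    ext
    · simp [smul_comm (_ : SmallQuantumGroup q n) (_ : k) m, mul_smul, add_comm]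
    · simp [smul_comm (_ : SmallQuantumGroup q n) (_ : k) m, mul_smul]

theorem pair_K (t : (V₂ q n).tensor M) : pair M (K q n • t) =
    ((root q n)⁻¹ • K q n • (pair M t).1, root q n • K q n • (pair M t).2) := by
  induction t using tensor_induction with
  | h0 => simp [Prod.ext_iff]
  | hadd s t hs ht =>
    rw [smul_add, map_add, hs, ht, map_add]
    ext <;> simp [smul_add]
  | ht x m =>
    rw [pair_smul, LinearEquiv.apply_symm_apply, comulHom, lift_K,
      FDMod.tensorAction_tmul, pair_tmul, pair_tmul, coordsV₂_K]
    ext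
    · simp [smul_comm (_ : SmallQuantumGroup q n) (_ : k) m, mul_smul]
    · simp [smul_comm (_ : SmallQuantumGroup q n) (_ : k) m, mul_smul]

/-- The scalar `γ` is never needed: the lemma is applied either where `F ^ j` kills the second
coordinate or for its second coordinate alone. -/
theorem exists_pair_F_pow (t : (V₂ q n).tensor M) (j : ℕ) : ∃ γ : k,
    pair M (F q n ^ (j + 1) • t) =
      (root q n ^ (j + 1) • F q n ^ (j + 1) • (pair M t).1 + γ • F q n ^ j • (pair M t).2,
        (root q n)⁻¹ ^ (j + 1) • F q n ^ (j + 1) • (pair M t).2) := by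
  induction j with
  | zero => exact ⟨q ^ n, by simpa using pair_F t⟩
  | succ j ih =>
    obtain ⟨γ, h⟩ := ih
    refine ⟨root q n * γ + q ^ n * (root q n)⁻¹ ^ (j + 1), ?_⟩
    rw [pow_succ' (F q n), mul_smul, pair_F, h]
    refine Prod.ext ?_ ?_
    · simp only [smul_add, smul_comm (F q n) (_ : k), add_smul, mul_smul, pow_succ' _ (j + 1),
        pow_succ' (F q n) j]
      abel
    · simp only [smul_comm (F q n) (_ : k), mul_smul, pow_succ' _ (j + 1)]

/-! ### Adjunction -/

/-- `V₂ ⊗ g`. -/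
def tensorMap (g : M →ₗ[SmallQuantumGroup q n] N) :
    (V₂ q n).tensor M →ₗ[SmallQuantumGroup q n] (V₂ q n).tensor N :=
  homOfComm ((pair N).symm.toLinearMap ∘ₗ
      ((g.restrictScalars k).prodMap (g.restrictScalars k)) ∘ₗ (pair M).toLinearMap)
    (fun v => (pair N).injective (by simp [pair_E]))
    (fun v => (pair N).injective (by simp [pair_F]))
    (fun v => (pair N).injective (by simp [pair_K]))

theorem pair_tensorMap (g : M →ₗ[SmallQuantumGroup q n] N) (t : (V₂ q n).tensor M) :
    pair N (tensorMap g t) = (g (pair M t).1, g (pair M t).2) := by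
  simp [tensorMap]

theorem tensorMap_surjective {g : M →ₗ[SmallQuantumGroup q n] N} (hg : Function.Surjective g) :
    Function.Surjective (tensorMap g) := by
  intro t
  obtain ⟨a, ha⟩ := hg (pair N t).1
  obtain ⟨b, hb⟩ := hg (pair N t).2
  refine ⟨(pair M).symm (a, b), (pair N).injective ?_⟩
  rw [pair_tensorMap, LinearEquiv.apply_symm_apply, ha, hb]

theorem map_pair (φ : (V₂ q n).tensor M →ₗ[SmallQuantumGroup q n] N) (a b : M) :
    φ ((pair M).symm (a, b)) = φ ((pair M).symm (a, 0)) + φ ((pair M).symm (0, b)) := by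
  rw [← map_add, ← map_add, Prod.mk_add_mk, add_zero, zero_add]

theorem smul_pair_symm_E (a b : M) : E q n • (pair M).symm (a, b) =
    (pair M).symm (E q n • a, K q n • a + E q n • b) :=
  (pair M).injective (by simp [pair_E])

theorem smul_pair_symm_F (a b : M) : F q n • (pair M).symm (a, b) =
    (pair M).symm (root q n • F q n • a + q ^ n • b, (root q n)⁻¹ • F q n • b) :=
  (pair M).injective (by simp [pair_F])

theorem smul_pair_symm_K (a b : M) : K q n • (pair M).symm (a, b) =
    (pair M).symm ((root q n)⁻¹ • K q n • a, root q n • K q n • b) :=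
  (pair M).injective (by simp [pair_K])

/-- The linear map underlying the adjoint of a map from `V₂ ⊗ M`. -/
def adjLin (φ : (V₂ q n).tensor M →ₗ[k] N) : M →ₗ[k] (V₂ q n).tensor N :=
  (pair N).symm.toLinearMap ∘ₗ
    (φ ∘ₗ (pair M).symm.toLinearMap ∘ₗ LinearMap.inr k M M).prod
      -- The constant is that of the invariant vector `m₁ ⊗ m₂ - ζ m₂ ⊗ m₁` in `V₂ ⊗ V₂`, which
      -- exhibits `V₂` as its own dual; the adjoint of `φ` is `a ↦ m₁ ⊗ φ (m₂ ⊗ a) - ζ m₂ ⊗ φ (m₁ ⊗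
      -- a)`.
      (-(root q n) • (φ ∘ₗ (pair M).symm.toLinearMap ∘ₗ LinearMap.inl k M M))

theorem pair_adjLin (φ : (V₂ q n).tensor M →ₗ[k] N) (a : M) : pair N (adjLin φ a) =
    (φ ((pair M).symm (0, a)), -(root q n) • φ ((pair M).symm (a, 0))) := by
  rw [adjLin, LinearMap.comp_apply, LinearEquiv.coe_coe, LinearEquiv.apply_symm_apply]
  rfl

/-- The adjoint of a map from `V₂ ⊗ M`. -/
def adj (φ : (V₂ q n).tensor M →ₗ[SmallQuantumGroup q n] N) :
    M →ₗ[SmallQuantumGroup q n] (V₂ q n).tensor N :=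
  homOfComm (adjLin (φ.restrictScalars k))
    (fun a => (pair N).injective (by
      have h0 := root_ne_zero q n
      have h1 := φ.map_smul (E q n) ((pair M).symm (a, 0))
      have h2 := φ.map_smul (E q n) ((pair M).symm (0, a))
      have h3 := φ.map_smul (K q n) ((pair M).symm (0, a))
      rw [smul_pair_symm_E, smul_zero, add_zero, map_pair] at h1
      rw [smul_pair_symm_E, smul_zero, smul_zero, zero_add] at h2
      rw [smul_pair_symm_K, smul_zero, smul_zero] at h3
      have h4 : φ ((pair M).symm (0, root q n • K q n • a)) =
        root q n • φ ((pair M).symm (0, K q n • a)) := by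
        rw [← LinearMap.map_smul_of_tower, ← map_smul, Prod.smul_mk, smul_zero]
      rw [h4] at h3
      rw [pair_adjLin, pair_E, pair_adjLin]
      simp only [LinearMap.restrictScalars_apply]
      refine Prod.ext h2 ?_
      simp only [smul_comm (E q n) (_ : k), ← h1, ← h3, smul_add, neg_smul, smul_neg]
      abel))
    (fun a => (pair N).injective (by
      have h0 := root_ne_zero q n
      have h1 := φ.map_smul (F q n) ((pair M).symm (a, 0))
      have h2 := φ.map_smul (F q n) ((pair M).symm (0, a))
      rw [smul_pair_symm_F, smul_zero, smul_zero, smul_zero, add_zero] at h1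
      rw [smul_pair_symm_F, smul_zero, smul_zero, zero_add, map_pair] at h2
      have h4 : φ ((pair M).symm (0, (root q n)⁻¹ • F q n • a)) =
        (root q n)⁻¹ • φ ((pair M).symm (0, F q n • a)) := by
        rw [← LinearMap.map_smul_of_tower, ← map_smul, Prod.smul_mk, smul_zero]
      have h5 : φ ((pair M).symm (root q n • F q n • a, 0)) =
        root q n • φ ((pair M).symm (F q n • a, 0)) := by
        rw [← LinearMap.map_smul_of_tower, ← map_smul, Prod.smul_mk, smul_zero]
      have h6 : φ ((pair M).symm (q ^ n • a, 0)) = q ^ n • φ ((pair M).symm (a, 0)) := by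
        rw [← LinearMap.map_smul_of_tower, ← map_smul, Prod.smul_mk, smul_zero]
      rw [h5] at h1
      rw [h4, h6] at h2
      rw [pair_adjLin, pair_F, pair_adjLin]
      simp only [LinearMap.restrictScalars_apply]
      refine Prod.ext ?_ ?_
      · simp only [← h2, smul_add, smul_smul, mul_inv_cancel₀ h0, one_smul, neg_smul, smul_neg,
          mul_comm (root q n) (q ^ n)]
        abel
      · simp only [smul_comm (F q n) (_ : k), ← h1, smul_smul]
        congr 1
        field_simp))
    (fun a => (pair N).injective (by
      have h0 := root_ne_zero q n
      have h1 := φ.map_smul (K q n) ((pair M).symm (a, 0))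
      have h2 := φ.map_smul (K q n) ((pair M).symm (0, a))
      rw [smul_pair_symm_K, smul_zero, smul_zero] at h1
      rw [smul_pair_symm_K, smul_zero, smul_zero] at h2
      have h4 : φ ((pair M).symm (0, root q n • K q n • a)) =
        root q n • φ ((pair M).symm (0, K q n • a)) := by
        rw [← LinearMap.map_smul_of_tower, ← map_smul, Prod.smul_mk, smul_zero]
      have h5 : φ ((pair M).symm ((root q n)⁻¹ • K q n • a, 0)) =
        (root q n)⁻¹ • φ ((pair M).symm (K q n • a, 0)) := by
        rw [← LinearMap.map_smul_of_tower, ← map_smul, Prod.smul_mk, smul_zero]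
      rw [h5] at h1
      rw [h4] at h2
      rw [pair_adjLin, pair_K, pair_adjLin]
      simp only [LinearMap.restrictScalars_apply]
      refine Prod.ext ?_ ?_
      · simp only [← h2, smul_smul, inv_mul_cancel₀ h0, one_smul]
      · simp only [smul_comm (K q n) (_ : k), ← h1, smul_smul]
        congr 1
        field_simp))

theorem pair_adj (φ : (V₂ q n).tensor M →ₗ[SmallQuantumGroup q n] N) (a : M) :
    pair N (adj φ a) =
      (φ ((pair M).symm (0, a)), -(root q n) • φ ((pair M).symm (a, 0))) :=
  pair_adjLin (φ.restrictScalars k) a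

theorem adj_comp {L : FDMod k (SmallQuantumGroup q n)}
    (φ : (V₂ q n).tensor M →ₗ[SmallQuantumGroup q n] N) (g : N →ₗ[SmallQuantumGroup q n] L) :
    adj (g ∘ₗ φ) = tensorMap g ∘ₗ adj φ := by
  ext a
  apply (pair L).injective
  rw [LinearMap.comp_apply, pair_tensorMap, pair_adj, pair_adj]
  simp

end Pair

end SmallQuantumGroup

/-! ### Additive functions on the Green ring -/

section GreenFunctions

variable {k H : Type u} [Field k] [Ring H]

section Green

variable [Bialgebra k H]

theorem greenClass_eq {V W : FDMod k H} (h : V ≈ W) : greenClass V = greenClass W :=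
  congrArg (greenIdeal k H).ringCon.mk' (greenGen_eq h)

theorem greenClass_mul (V W : FDMod k H) :
    greenClass V * greenClass W = greenClass (V.tensor W) := by
  rw [greenClass, greenClass, ← map_mul, greenGen_mul]
  rfl

theorem greenClass_directSum (V W : FDMod k H) :
    greenClass (V.directSum W) = greenClass V + greenClass W := by
  rw [greenClass, greenClass, greenClass, ← map_add]
  refine (RingCon.eq _).2 ((TwoSidedIdeal.rel_iff _ _ _).2 ?_)
  rw [← sub_sub]
  exact (TwoSidedIdeal.mem_mk' ..).2 (AddSubgroup.subset_closure ⟨V, W, rfl⟩)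

theorem greenClass_triv : greenClass (FDMod.triv k H) = 1 := map_one _

/-- The extension of an invariant of modules to the free abelian group on isomorphism classes. -/
def greenGenLift (d : FDMod k H → ℤ) (hd : ∀ V W : FDMod k H, V ≈ W → d V = d W) :
    FreeAbelianGroup (IsoClass k H) →+ ℤ :=
  FreeAbelianGroup.lift (α := IsoClass k H) (Quotient.lift d hd)

theorem greenGenLift_greenGen (d : FDMod k H → ℤ) (hd : ∀ V W : FDMod k H, V ≈ W → d V = d W)
    (V : FDMod k H) : greenGenLift d hd (greenGen k H V) = d V :=
  FreeAbelianGroup.lift_apply_of _ _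

/-- An additive invariant of modules is an additive function on the Green ring. -/
def greenLift (d : FDMod k H → ℤ) (hd : ∀ V W : FDMod k H, V ≈ W → d V = d W)
    (hadd : ∀ V W : FDMod k H, d (V.directSum W) = d V + d W) : GreenRing k H →+ ℤ :=
  AddCon.lift (greenIdeal k H).ringCon.toAddCon
    (greenGenLift d hd) (by
      intro x y hxy
      have h : x - y ∈ greenRelations k H :=
        (TwoSidedIdeal.mem_mk' ..).1 ((TwoSidedIdeal.rel_iff (greenIdeal k H) x y).1 hxy)
      have h2 : greenRelations k H ≤ (greenGenLift d hd).ker := by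
        rw [greenRelations, AddSubgroup.closure_le]
        rintro _ ⟨U, V, rfl⟩
        simp only [SetLike.mem_coe, AddMonoidHom.mem_ker, map_sub,
          greenGenLift_greenGen, hadd]
        ring
      have h3 := h2 h
      rw [AddMonoidHom.mem_ker, map_sub, sub_eq_zero] at h3
      exact h3)

theorem greenLift_greenClass (d : FDMod k H → ℤ) (hd : ∀ V W : FDMod k H, V ≈ W → d V = d W)
    (hadd : ∀ V W : FDMod k H, d (V.directSum W) = d V + d W) (V : FDMod k H) :
    greenLift d hd hadd (greenClass V) = d V :=
  greenGenLift_greenGen d hd V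

end Green

section HomDim

variable [Algebra k H]

instance FDMod.finite_hom (M N : FDMod k H) : Module.Finite k (M →ₗ[H] N) :=
  Module.Finite.of_injective (LinearMap.restrictScalarsₗ k H M N k)
    (LinearMap.restrictScalars_injective k)

/-- The dimension of the space of module maps. -/
def homDim (M N : FDMod k H) : ℕ := Module.finrank k (M →ₗ[H] N)

theorem homDim_congr {M M' N N' : FDMod k H} (hM : M ≈ M') (hN : N ≈ N') :
    homDim M N = homDim M' N' := by
  obtain ⟨e⟩ := hM
  obtain ⟨f⟩ := hN
  exact LinearEquiv.finrank_eq
    { toFun := fun φ => f.toLinearMap ∘ₗ φ ∘ₗ e.symm.toLinearMap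
      invFun := fun φ => f.symm.toLinearMap ∘ₗ φ ∘ₗ e.toLinearMap
      map_add' := fun φ ψ => by ext; simp
      map_smul' := fun c φ => by
        ext x
        exact (f.restrictScalars k).map_smul c (φ (e.symm x))
      left_inv := fun φ => by ext; simp
      right_inv := fun φ => by ext; simp }

theorem homDim_directSum_right (M N N' : FDMod k H) :
    homDim M (N.directSum N') = homDim M N + homDim M N' := by
  rw [homDim, homDim, homDim, ← Module.finrank_prod]
  exact (LinearMap.prodEquiv (R := H) (M := M) (M₂ := N) (M₃ := N') k).symm.finrank_eq

theorem homDim_directSum_left (M M' N : FDMod k H) :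
    homDim (M.directSum M') N = homDim M N + homDim M' N := by
  rw [homDim, homDim, homDim, ← Module.finrank_prod]
  exact (LinearMap.coprodEquiv (R := H) (M := M) (M₂ := M') (M₃ := N) k).symm.finrank_eq

end HomDim

end GreenFunctions

/-! ### The functor `V₂ ⊗ -` is adjoint to itself and preserves projective modules -/

namespace SmallQuantumGroup

section Adjunction

variable {k : Type u} [Field k] {q : k} {n : ℕ}
  [Fact (2 < n)] [Fact (Odd n)] [Fact (orderOf q = n ∨ orderOf q = 2 * n)]
  {M N : FDMod k (SmallQuantumGroup q n)}

/-- The linear map underlying the inverse of `adj`. -/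
def adjInvLin (ψ : M →ₗ[k] (V₂ q n).tensor N) : (V₂ q n).tensor M →ₗ[k] N :=
  (-(root q n)⁻¹ • (LinearMap.snd k N N ∘ₗ (pair N).toLinearMap ∘ₗ ψ)).coprod
    (LinearMap.fst k N N ∘ₗ (pair N).toLinearMap ∘ₗ ψ) ∘ₗ (pair M).toLinearMap

theorem adjInvLin_apply (ψ : M →ₗ[k] (V₂ q n).tensor N) (t : (V₂ q n).tensor M) :
    adjInvLin ψ t =
      -(root q n)⁻¹ • (pair N (ψ (pair M t).1)).2 + (pair N (ψ (pair M t).2)).1 := rfl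

/-- The inverse of `adj`. -/
def adjInv (ψ : M →ₗ[SmallQuantumGroup q n] (V₂ q n).tensor N) :
    (V₂ q n).tensor M →ₗ[SmallQuantumGroup q n] N :=
  have hs : ∀ (c : k) (a : M), ψ (c • a) = c • ψ a := fun c a => ψ.map_smul_of_tower c a
  homOfComm (adjInvLin (ψ.restrictScalars k))
    (fun t => by
      rw [adjInvLin_apply, adjInvLin_apply, pair_E]
      simp only [LinearMap.restrictScalars_apply, map_add, map_smul, pair_E, pair_K, Prod.fst_add,
        smul_add, neg_smul, smul_neg, smul_comm (E q n) (_ : k)]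
      abel)
    (fun t => by
      have h0 := root_ne_zero q n
      rw [adjInvLin_apply, adjInvLin_apply, pair_F]
      simp only [LinearMap.restrictScalars_apply, map_add, map_smul, pair_F, Prod.snd_add,
        Prod.smul_fst, Prod.smul_snd, smul_add, neg_smul, smul_neg, smul_smul, neg_mul,
        smul_comm (F q n) (_ : k), inv_mul_cancel₀ h0, mul_inv_cancel₀ h0, one_smul,
        mul_comm (root q n)⁻¹ (q ^ n)]
      abel)
    (fun t => by
      have h0 := root_ne_zero q n
      rw [adjInvLin_apply, adjInvLin_apply, pair_K]
      simp only [LinearMap.restrictScalars_apply, map_smul, pair_K, Prod.smul_fst, Prod.smul_snd, smul_add, neg_smul, smul_neg, smul_smul,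
        smul_comm (K q n) (_ : k), inv_mul_cancel₀ h0, mul_inv_cancel₀ h0, one_smul])

/-- Maps from `V₂ ⊗ M` to `N` are maps from `M` to `V₂ ⊗ N`. -/
def adjEquiv : ((V₂ q n).tensor M →ₗ[SmallQuantumGroup q n] N) ≃ₗ[k]
    (M →ₗ[SmallQuantumGroup q n] (V₂ q n).tensor N) where
  toFun := adj
  map_add' φ φ' := by
    ext a
    apply (pair N).injective
    rw [LinearMap.add_apply, map_add, pair_adj, pair_adj, pair_adj]
    simp
  map_smul' c φ := by
    ext a
    apply (pair N).injective
    rw [LinearMap.smul_apply, map_smul, pair_adj, pair_adj]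
    simp [smul_comm c]
  invFun := adjInv
  left_inv φ := by
    have h0 := root_ne_zero q n
    ext t
    obtain ⟨⟨a, b⟩, rfl⟩ := (pair M).symm.surjective t
    change adjInvLin ((adj φ).restrictScalars k) _ = _
    rw [adjInvLin_apply, map_pair]
    simp only [LinearEquiv.apply_symm_apply, LinearMap.restrictScalars_apply, pair_adj, smul_smul,
      neg_mul_neg, inv_mul_cancel₀ h0, one_smul]
  right_inv ψ := by
    have h0 := root_ne_zero q n
    ext a
    apply (pair N).injective
    rw [pair_adj]
    change (adjInvLin (ψ.restrictScalars k) _, _ • adjInvLin (ψ.restrictScalars k) _) = _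
    rw [adjInvLin_apply, adjInvLin_apply]
    simp [smul_smul, mul_inv_cancel₀ h0]

theorem homDim_tensor_left : homDim ((V₂ q n).tensor M) N = homDim M ((V₂ q n).tensor N) :=
  adjEquiv.finrank_eq

/-- A left adjoint of a functor that preserves surjections preserves projectives. Concretely, the
adjoint of the identity of `V₂ ⊗ M` lifts along `V₂ ⊗ g`, for `g` a surjection from a free module,
and the lift is adjoint to a section of `g`. -/
theorem projective_tensor [hM : Module.Projective (SmallQuantumGroup q n) M] :
    Module.Projective (SmallQuantumGroup q n) ((V₂ q n).tensor M) := by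
  have : Module.Finite (SmallQuantumGroup q n) ((V₂ q n).tensor M) :=
    Module.Finite.of_restrictScalars_finite k _ _
  obtain ⟨m, g, hg⟩ := Module.Finite.exists_fin' (SmallQuantumGroup q n) ((V₂ q n).tensor M)
  let L : FDMod k (SmallQuantumGroup q n) := { carrier := Fin m → SmallQuantumGroup q n }
  let g' : L →ₗ[SmallQuantumGroup q n] (V₂ q n).tensor M := g
  obtain ⟨ψ, hψ⟩ := Module.projective_lifting_property (tensorMap g')
    (adj (LinearMap.id : (V₂ q n).tensor M →ₗ[SmallQuantumGroup q n] _))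
    (tensorMap_surjective hg)
  refine Module.Projective.of_split (M := Fin m → SmallQuantumGroup q n) (adjInv ψ) g ?_
  apply (adjEquiv (M := M) (N := (V₂ q n).tensor M)).injective
  change adj (g' ∘ₗ adjEquiv.symm ψ) = adj _
  rw [adj_comp, ← hψ]
  congr 1
  exact adjEquiv.apply_symm_apply ψ

end Adjunction

end SmallQuantumGroup

namespace SmallQuantumGroup

/-! ### Decomposition of tensor products of simple modules -/

section Decomposition

variable {k : Type u} [Field k] {q : k} {n : ℕ}
  [Fact (2 < n)] [Fact (Odd n)] [Fact (orderOf q = n ∨ orderOf q = 2 * n)]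

theorem bijective_of_finrank_eq {M N : FDMod k (SmallQuantumGroup q n)}
    (f : M →ₗ[SmallQuantumGroup q n] N) (hf : Function.Injective f)
    (h : Module.finrank k M = Module.finrank k N) : Function.Bijective f :=
  ⟨hf, (LinearMap.injective_iff_surjective_of_finrank_eq_finrank
    (f := f.restrictScalars k) h).1 hf⟩

theorem simpleHom_injective {M : FDMod k (SmallQuantumGroup q n)} {r : ℕ} (hr : r ≤ n)
    (h1 : 1 ≤ r) {w : M} (hK : K q n • w = hw q n r • w) (hE : E q n • w = 0)
    (hF : F q n ^ r • w = 0) (hw0 : w ≠ 0) : Function.Injective (simpleHom hr w hK hE hF) := by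
  have := isSimpleModule_simpleMod (q := q) (hr := hr) h1
  refine LinearMap.injective_of_ne_zero fun h => hw0 ?_
  rw [← simpleHom_vec_zero hr w hK hE hF, h, LinearMap.zero_apply]

theorem iso_V₂ (h2 : 2 ≤ n) : simpleMod q n 2 h2 ≈ V₂ q n := by
  set w : V₂ q n := coordsV₂.symm ![0, 1] with hw
  have hc : coordsV₂ w = ![0, 1] := by rw [hw, LinearEquiv.apply_symm_apply]
  have hK : K q n • w = SmallQuantumGroup.hw q n 2 • w := by
    apply coordsV₂.injective
    rw [coordsV₂_K, map_smul, hc, hw_succ, pow_one]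
    ext i
    fin_cases i <;> simp
  have hE : E q n • w = 0 := by
    apply coordsV₂.injective
    rw [coordsV₂_E, map_zero, hc]
    ext i
    fin_cases i <;> simp
  have hF : F q n ^ 2 • w = 0 := by
    apply coordsV₂.injective
    rw [sq, mul_smul, coordsV₂_F, coordsV₂_F, map_zero]
    ext i
    fin_cases i <;> simp
  have hw0 : w ≠ 0 := by
    intro h
    rw [h, map_zero] at hc
    simpa using congrFun hc 1
  refine ⟨LinearEquiv.ofBijective _ (bijective_of_finrank_eq _
    (simpleHom_injective h2 (by omega) hK hE hF hw0) ?_)⟩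
  rw [finrank_simpleMod, (coordsV₂ (q := q) (n := n)).finrank_eq, Module.finrank_fin_fun]

theorem iso_triv (h1 : 1 ≤ n) : simpleMod q n 1 h1 ≈ FDMod.triv k (SmallQuantumGroup q n) := by
  have hx : ∀ (x : SmallQuantumGroup q n) (v : FDMod.triv k (SmallQuantumGroup q n)),
      FDMod.trivEquiv (x • v) = counitHom q n x * FDMod.trivEquiv v := fun _ _ => rfl
  set w : FDMod.triv k (SmallQuantumGroup q n) := FDMod.trivEquiv.symm 1
  have hK : K q n • w = hw q n 1 • w := by
    apply FDMod.trivEquiv.injective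
    rw [hx, hw_one, counitHom, lift_K, one_mul, one_smul]
  have hE : E q n • w = 0 := by
    apply FDMod.trivEquiv.injective
    rw [hx, counitHom, lift_E, zero_mul, map_zero]
  have hF : F q n ^ 1 • w = 0 := by
    apply FDMod.trivEquiv.injective
    rw [pow_one, hx, counitHom, lift_F, zero_mul, map_zero]
  have hw0 : w ≠ 0 := by
    intro h
    exact one_ne_zero (FDMod.trivEquiv.symm.injective (h.trans (map_zero _).symm))
  refine ⟨LinearEquiv.ofBijective _ (bijective_of_finrank_eq _
    (simpleHom_injective h1 le_rfl hK hE hF hw0) ?_)⟩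
  rw [finrank_simpleMod, (FDMod.trivEquiv (H := SmallQuantumGroup q n)).finrank_eq,
    Module.finrank_self]

theorem finrank_tensor (M : FDMod k (SmallQuantumGroup q n)) :
    Module.finrank k ((V₂ q n).tensor M) = 2 * Module.finrank k M := by
  rw [(pair M).finrank_eq, Module.finrank_prod, two_mul]

theorem smul_eq_zero_of_K_smul {M : Type u} [AddCommGroup M] [Module (SmallQuantumGroup q n) M]
    {v : M} (h : K q n • v = 0) : v = 0 := by
  rw [← one_smul (SmallQuantumGroup q n) v, ← Kinv_mul_K, mul_smul, h, smul_zero]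

/-- Two highest weight vectors, of weights `hw (s + 3)` and `hw (s + 1)`, generate non-isomorphic
simple submodules whose dimensions add up to the total. The bound `s + 3 ≤ n` is what lets the
larger one exist. -/
theorem tensor_simpleMod_iso {s : ℕ} (hs : s + 3 ≤ n) :
    (V₂ q n).tensor (simpleMod q n (s + 2) (by omega)) ≈
      (simpleMod q n (s + 3) hs).directSum (simpleMod q n (s + 1) (by omega)) := by
  have hr : s + 2 ≤ n := by omega
  have h0 := root_ne_zero q n
  have hα : coeffE q n (s + 2) 1 ≠ 0 := coeffE_ne_zero q n hr (by omega) (by omega)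
  -- The value of `β` solves `E (m₁ ⊗ v₀ + β m₂ ⊗ v₁) = 0`, that is `hw (s + 2) + β * coeffE 1 = 0`.
  set β : k := -(hw q n (s + 2) / coeffE q n (s + 2) 1) with hβ
  have hKv := K_smul_vec (q := q) (hr := hr) 0
  rw [pow_zero, mul_one] at hKv
  -- the highest weight vector of the larger summand
  set w₁ := (pair (simpleMod q n (s + 2) hr)).symm (0, vec hr 0)
  have e₁ : pair _ w₁ = (0, vec hr 0) := LinearEquiv.apply_symm_apply _ _
  have hK₁ : K q n • w₁ = hw q n (s + 3) • w₁ := by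
    apply (pair _).injective
    rw [pair_K, map_smul, e₁, hKv, smul_smul, root_mul_hw]
    simp
  have hE₁ : E q n • w₁ = 0 := by
    apply (pair _).injective
    rw [pair_E, e₁, E_smul_vec_zero, map_zero]
    simp
  have hF₁ : F q n ^ (s + 3) • w₁ = 0 := by
    apply (pair _).injective
    obtain ⟨γ, h⟩ := exists_pair_F_pow w₁ (s + 2)
    rw [h, e₁, F_pow_smul_vec, F_pow_smul_vec, vec_eq_zero (i := 0 + (s + 2)) (by omega),
      vec_eq_zero (i := 0 + (s + 2 + 1)) (by omega)]
    simp
  have hw₁ : w₁ ≠ 0 := by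
    intro h
    rw [h, map_zero] at e₁
    exact vec_ne_zero (q := q) (hr := hr) (i := 0) (by omega) (congrArg Prod.snd e₁).symm
  -- the highest weight vector of the smaller summand
  set w₂ := (pair (simpleMod q n (s + 2) hr)).symm (vec hr 0, β • vec hr 1)
  have e₂ : pair _ w₂ = (vec hr 0, β • vec hr 1) := LinearEquiv.apply_symm_apply _ _
  have hK₂ : K q n • w₂ = hw q n (s + 1) • w₂ := by
    apply (pair _).injective
    rw [pair_K, map_smul, e₂, hKv, smul_comm (K q n) β, K_smul_vec, pow_one]
    refine Prod.ext ?_ ?_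
    · change (root q n)⁻¹ • hw q n (s + 2) • vec hr 0 = hw q n (s + 1) • vec hr 0
      rw [smul_smul, ← root_mul_hw q n (s + 1), inv_mul_cancel_left₀ h0]
    · change root q n • β • (hw q n (s + 2) * (q ^ 2)⁻¹) • vec hr 1 =
        hw q n (s + 1) • β • vec hr 1
      rw [smul_smul, smul_smul, smul_smul, ← root_sq q n, ← root_mul_hw q n (s + 1)]
      congr 1
      field_simp
  have hE₂ : E q n • w₂ = 0 := by
    apply (pair _).injective
    rw [pair_E, e₂, E_smul_vec_zero, hKv, smul_comm (E q n) β, map_zero]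
    have := E_smul_vec_succ (q := q) (hr := hr) 0
    rw [zero_add] at this
    rw [this, smul_smul, ← add_smul, hβ, neg_mul, div_mul_cancel₀ _ hα, add_neg_cancel, zero_smul]
    rfl
  -- The `m₂`-component vanishes because the string of `V_{s+2}` has ended. The vector is also
  -- killed by `E`, as `coeffE (s + 1) (s + 1) = 0`; with no `m₂`-component this says that `K` kills
  -- the `m₁`-component, hence that it is zero.
  have hF₂ : F q n ^ (s + 1) • w₂ = 0 := by
    have hE := E_smul_F_pow (hw_ne_zero q n (s + 1)) hK₂ hE₂ s
    have h1 : casVal q (hw q n (s + 1)) - casVal q (hw q n (s + 1) * (q ^ 2)⁻¹ ^ (s + 1)) = 0 :=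
      coeffE_self q n (s + 1)
    rw [h1, zero_smul] at hE
    obtain ⟨γ, h⟩ := exists_pair_F_pow w₂ s
    have h2 : (pair _ (F q n ^ (s + 1) • w₂)).2 = 0 := by
      rw [h, e₂]
      change _ • F q n ^ (s + 1) • β • vec hr 1 = 0
      rw [smul_comm (F q n ^ (s + 1)) β, F_pow_smul_vec, vec_eq_zero (by omega), smul_zero,
        smul_zero]
    apply (pair _).injective
    rw [map_zero]
    refine Prod.ext ?_ h2
    have h3 := congrArg Prod.snd (congrArg (pair _) hE)
    rw [pair_E, h2, smul_zero, add_zero, map_zero] at h3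
    exact smul_eq_zero_of_K_smul h3
  have hw₂ : w₂ ≠ 0 := by
    intro h
    rw [h, map_zero] at e₂
    exact vec_ne_zero (q := q) (hr := hr) (i := 0) (by omega) (congrArg Prod.fst e₂).symm
  set f := simpleHom hs w₁ hK₁ hE₁ hF₁
  have hf : Function.Injective f := simpleHom_injective hs (by omega) hK₁ hE₁ hF₁ hw₁
  set g := simpleHom (by omega : s + 1 ≤ n) w₂ hK₂ hE₂ hF₂
  have hg : Function.Injective g := simpleHom_injective _ (by omega) hK₂ hE₂ hF₂ hw₂
  have h1 := isSimpleModule_simpleMod (q := q) (hr := hs) (by omega)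
  have h2 := isSimpleModule_simpleMod (q := q) (hr := (by omega : s + 1 ≤ n)) (by omega)
  have hf1 : IsAtom (LinearMap.range f) :=
    isSimpleModule_iff_isAtom.1 (IsSimpleModule.congr (LinearEquiv.ofInjective f hf).symm)
  have hg1 : IsAtom (LinearMap.range g) :=
    isSimpleModule_iff_isAtom.1 (IsSimpleModule.congr (LinearEquiv.ofInjective g hg).symm)
  -- Distinct simple submodules meet in zero, and these two have different dimensions.
  have hd : Disjoint (LinearMap.range f) (LinearMap.range g) := by
    refine hf1.disjoint_of_ne hg1 fun h => ?_
    have := simpleMod_equiv_iff ((LinearEquiv.ofInjective f hf).trans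
      ((LinearEquiv.ofEq _ _ h).trans (LinearEquiv.ofInjective g hg).symm))
    omega
  have hinj : Function.Injective (f.coprod g) := by
    rw [← LinearMap.ker_eq_bot, LinearMap.ker_coprod_of_disjoint_range f g hd,
      LinearMap.ker_eq_bot.2 hf, LinearMap.ker_eq_bot.2 hg, Submodule.prod_bot]
  suffices h : (simpleMod q n (s + 3) hs).directSum (simpleMod q n (s + 1) (by omega)) ≈
      (V₂ q n).tensor (simpleMod q n (s + 2) hr) from Setoid.symm h
  refine ⟨LinearEquiv.ofBijective _ (bijective_of_finrank_eq
    (M := (simpleMod q n (s + 3) hs).directSum (simpleMod q n (s + 1) (by omega)))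
    (f.coprod g) hinj ?_)⟩
  rw [finrank_tensor, finrank_simpleMod]
  refine (Module.finrank_prod (R := k) (M := simpleMod q n (s + 3) hs)).trans ?_
  rw [finrank_simpleMod, finrank_simpleMod]
  omega

/-- A vector `m₁ ⊗ a + m₂ ⊗ b` of this block is killed by `E` and has weight `ζ⁻¹`. Then `a` is
killed by `E` with weight `1`, and once `a = 0`, `b` is killed by `E` with weight `ζ⁻²`; but the
highest weight vectors of the `n`-dimensional simple module have weight `ζ⁻¹`. So `P_n` is not a
summand of `V₂ ⊗ P_n`. -/
theorem block_tensor_simpleMod [CharZero k] :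
    block q n ((V₂ q n).tensor (simpleMod q n n le_rfl)) n = ⊥ := by
  have h2 : 2 < n := Fact.out
  have h0 := root_ne_zero q n
  have h1 : root q n ≠ 1 := fun h => (isPrimitiveRoot_root q n).pow_ne_one_of_pos_of_lt
    one_ne_zero (by omega) (by rw [pow_one, h])
  have hwn : hw q n n = (root q n)⁻¹ := by rw [hw, root_pow, one_mul]
  rw [eq_bot_iff]
  intro v hv
  obtain ⟨hK, -⟩ := (idem_smul_eq_iff (pos n) le_rfl).1 (mem_block.1 hv)
  have hE := E_smul_eq_zero_of_mem_block hv
  have key : ∀ (x : simpleMod q n n le_rfl) (c : k), E q n • x = 0 → K q n • x = c • x →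
      c ≠ (root q n)⁻¹ → x = 0 := by
    intro x c hx hKx hc
    by_contra hx0
    have e := eq_smul_vec_zero_of_E_smul (pos n) hx
    have : K q n • x = (root q n)⁻¹ • x := by
      rw [e, smul_comm, K_smul_vec, pow_zero, mul_one, hwn, smul_comm]
    rw [hKx, ← sub_eq_zero, ← sub_smul, smul_eq_zero, sub_eq_zero] at this
    exact this.elim hc hx0
  have hK' := congrArg (pair _) hK
  have hE' := congrArg (pair _) hE
  rw [pair_K, map_smul, hwn] at hK'
  rw [pair_E, map_zero] at hE'
  have ha : (pair _ v).1 = 0 := by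
    refine key _ 1 (congrArg Prod.fst hE') ?_ ?_
    · rw [one_smul]
      exact smul_right_injective _ (inv_ne_zero h0) (congrArg Prod.fst hK')
    · rwa [ne_eq, eq_comm, inv_eq_one]
  rw [Submodule.mem_bot]
  apply (pair _).injective
  rw [map_zero]
  refine Prod.ext ha (key _ ((root q n)⁻¹ * (root q n)⁻¹) ?_ ?_ ?_)
  · have := congrArg Prod.snd hE'
    simpa [ha] using this
  · have h3 : root q n • K q n • (pair _ v).2 = (root q n)⁻¹ • (pair _ v).2 :=
      congrArg Prod.snd hK'
    rw [mul_smul, ← h3, smul_smul, inv_mul_cancel₀ h0, one_smul]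
  · rw [ne_eq, mul_eq_left₀ (inv_ne_zero h0), inv_eq_one]
    exact h1

end Decomposition

/-! ### Weight multiplicities -/

section Weights

variable {k : Type u} [Field k] {q : k} {n : ℕ}
  [Fact (2 < n)] [Fact (Odd n)] [Fact (orderOf q = n ∨ orderOf q = 2 * n)]

/-- The vectors of weight `μ`. -/
def weightSpace (M : FDMod k (SmallQuantumGroup q n)) (μ : k) : Submodule k M :=
  LinearMap.ker (Algebra.lsmul k k M (K q n) - μ • LinearMap.id)

theorem mem_weightSpace {M : FDMod k (SmallQuantumGroup q n)} {μ : k} {v : M} :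
    v ∈ weightSpace M μ ↔ K q n • v = μ • v := by
  simp [weightSpace, sub_eq_zero]

theorem finrank_eq_add_of_mem_iff {V A B : Type u} [AddCommGroup V] [Module k V] [AddCommGroup A]
    [Module k A] [AddCommGroup B] [Module k B] [Module.Finite k A] [Module.Finite k B]
    (e : V ≃ₗ[k] A × B) (S : Submodule k V) (S₁ : Submodule k A) (S₂ : Submodule k B)
    (h : ∀ v, v ∈ S ↔ (e v).1 ∈ S₁ ∧ (e v).2 ∈ S₂) :
    Module.finrank k S = Module.finrank k S₁ + Module.finrank k S₂ := by
  rw [← Module.finrank_prod]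
  exact LinearEquiv.finrank_eq
    { toFun := fun v => (⟨(e v.1).1, ((h v).1 v.2).1⟩, ⟨(e v.1).2, ((h v).1 v.2).2⟩)
      map_add' := fun v w => by ext <;> simp
      map_smul' := fun c v => by ext <;> simp
      invFun := fun t => ⟨e.symm (t.1, t.2), (h _).2 (by simp)⟩
      left_inv := fun v => by ext; simp
      right_inv := fun t => by ext <;> simp }

theorem finrank_weightSpace_congr (μ : k) {M N : FDMod k (SmallQuantumGroup q n)} (h : M ≈ N) :
    Module.finrank k (weightSpace M μ) = Module.finrank k (weightSpace N μ) := by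
  obtain ⟨e⟩ := h
  exact LinearEquiv.finrank_eq
    { toFun := fun v => ⟨e v.1, by
        have h1 : e (μ • v.1) = μ • e v.1 := (e.restrictScalars k).map_smul μ v.1
        rw [mem_weightSpace, ← map_smul, mem_weightSpace.1 v.2, h1]⟩
      map_add' := fun v w => by ext; simp
      map_smul' := fun c v => Subtype.ext ((e.restrictScalars k).map_smul c v.1)
      invFun := fun v => ⟨e.symm v.1, by
        have h1 : e.symm (μ • v.1) = μ • e.symm v.1 := (e.symm.restrictScalars k).map_smul μ v.1
        rw [mem_weightSpace, ← map_smul, mem_weightSpace.1 v.2, h1]⟩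
      left_inv := fun v => by ext; simp
      right_inv := fun t => by ext; simp }

/-- The multiplicity of the weight `μ`, as a function on the Green ring. -/
def weightMult (μ : k) : GreenRing k (SmallQuantumGroup q n) →+ ℤ :=
  greenLift (fun M => (Module.finrank k (weightSpace M μ) : ℤ))
    (fun M N h => congrArg _ (finrank_weightSpace_congr μ h))
    (fun M N => by
      rw [← Nat.cast_add]
      refine congrArg _ (finrank_eq_add_of_mem_iff (LinearEquiv.refl k (M × N)) _ _ _ fun v => ?_)
      exact mem_weightSpace.trans
        (Prod.ext_iff.trans (and_congr mem_weightSpace.symm mem_weightSpace.symm)))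

theorem weightMult_greenClass (μ : k) (M : FDMod k (SmallQuantumGroup q n)) :
    weightMult μ (greenClass M) = (Module.finrank k (weightSpace M μ) : ℤ) :=
  greenLift_greenClass _ _ _ M

theorem weightMult_tensor (μ : k) (M : FDMod k (SmallQuantumGroup q n)) :
    weightMult μ (greenClass (V₂ q n) * greenClass M) =
      weightMult (root q n * μ) (greenClass M) +
        weightMult ((root q n)⁻¹ * μ) (greenClass M) := by
  have h0 := root_ne_zero q n
  rw [greenClass_mul, weightMult_greenClass, weightMult_greenClass, weightMult_greenClass,
    ← Nat.cast_add]
  refine congrArg _ (finrank_eq_add_of_mem_iff (pair M) _ _ _ fun v => ?_)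
  rw [mem_weightSpace, mem_weightSpace, mem_weightSpace, ← (pair M).injective.eq_iff, pair_K,
    map_smul, Prod.ext_iff]
  refine and_congr ?_ ?_
  · rw [mul_smul, ← inv_smul_eq_iff₀ h0]
    rfl
  · rw [mul_smul, eq_inv_smul_iff₀ h0]
    rfl

/-- The `n` basis vectors have distinct weights, which therefore exhaust the `n`-th roots of unity.
-/
theorem finrank_weightSpace_simpleMod {μ : k} (hμ : μ ^ n = 1) :
    Module.finrank k (weightSpace (simpleMod q n n le_rfl) μ) = 1 := by
  have hn : NeZero n := ⟨(pos n).ne'⟩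
  have hQ : IsPrimitiveRoot (q ^ 2)⁻¹ n := (isPrimitiveRoot_sq q n).inv
  have h0 := hw_ne_zero q n n
  obtain ⟨i, hi, e⟩ := hQ.eq_pow_of_pow_eq_one (ξ := (hw q n n)⁻¹ * μ)
    (by rw [mul_pow, inv_pow, hw_pow, inv_one, one_mul, hμ])
  have hμ' : μ = hw q n n * (q ^ 2)⁻¹ ^ i := by rw [e, mul_inv_cancel_left₀ h0]
  have : weightSpace (simpleMod q n n le_rfl) μ = Submodule.span k {vec le_rfl i} := by
    refine le_antisymm (fun v hv => ?_) ?_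
    · rw [Submodule.mem_span_singleton]
      refine ⟨coords v ⟨i, hi⟩, coords.injective ?_⟩
      ext j
      rw [map_smul, Pi.smul_apply, coords_vec, smul_eq_mul]
      split_ifs with h
      · rw [show j = ⟨i, hi⟩ from Fin.ext h, mul_one]
      · rw [mul_zero]
        by_contra hj
        have h2 := congrFun (congrArg coords (mem_weightSpace.1 hv)) j
        rw [coords_K, opDiag_apply, map_smul, Pi.smul_apply, smul_eq_mul,
          mul_left_inj' (Ne.symm hj), hμ', mul_right_inj' h0] at h2
        exact h (hQ.pow_inj j.2 hi h2)
    · rw [Submodule.span_singleton_le_iff_mem, mem_weightSpace, hμ', K_smul_vec]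
  rw [this, finrank_span_singleton (vec_ne_zero hi)]

end Weights

end SmallQuantumGroup

/-! ### Dimensions of homomorphism spaces as functions on the Green ring; split surjections -/

section HomFunctions

variable {k H : Type u} [Field k] [Ring H] [Bialgebra k H]

/-- The dimension of the maps from `M`, as a function on the Green ring. -/
def homFrom (M : FDMod k H) : GreenRing k H →+ ℤ :=
  greenLift (fun N => (homDim M N : ℤ))
    (fun _ _ h => congrArg _ (homDim_congr (Setoid.refl M) h))
    (fun N N' => by rw [homDim_directSum_right, Nat.cast_add])

/-- The dimension of the maps to `N`, as a function on the Green ring. -/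
def homTo (N : FDMod k H) : GreenRing k H →+ ℤ :=
  greenLift (fun M => (homDim M N : ℤ))
    (fun _ _ h => congrArg _ (homDim_congr h (Setoid.refl N)))
    (fun M M' => by rw [homDim_directSum_left, Nat.cast_add])

theorem homFrom_greenClass (M N : FDMod k H) : homFrom M (greenClass N) = (homDim M N : ℤ) :=
  greenLift_greenClass _ _ _ N

theorem homTo_greenClass (M N : FDMod k H) : homTo N (greenClass M) = (homDim M N : ℤ) :=
  greenLift_greenClass _ _ _ M

theorem homDim_of_subsingleton_left {M : FDMod k H} [Subsingleton M] (N : FDMod k H) :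
    homDim M N = 0 := by
  have : Subsingleton (M →ₗ[H] N) := ⟨fun f g => by
    ext x
    rw [Subsingleton.elim x 0, map_zero, map_zero]⟩
  exact Module.finrank_zero_of_subsingleton

theorem greenClass_of_subsingleton (M : FDMod k H) [Subsingleton M] :
    greenClass M = 0 := by
  have h : M.directSum M ≈ M := ⟨
    { toFun := fun x => x.1
      map_add' := fun _ _ => rfl
      map_smul' := fun _ _ => rfl
      invFun := fun x => (x, 0)
      left_inv := fun x => Prod.ext rfl (Subsingleton.elim _ _)
      right_inv := fun _ => rfl }⟩
  have h2 := greenClass_directSum M M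
  rw [greenClass_eq h] at h2
  exact left_eq_add.1 h2

/-- The kernel of a map of modules. -/
def FDMod.ker {M N : FDMod k H} (f : M →ₗ[H] N) : FDMod k H where
  carrier := LinearMap.ker f
  finite := Module.Finite.of_injective ((LinearMap.ker f).subtype.restrictScalars k)
    Subtype.val_injective

theorem FDMod.iso_directSum_ker {M N : FDMod k H} (f : M →ₗ[H] N) (g : N →ₗ[H] M)
    (h : f ∘ₗ g = LinearMap.id) : M ≈ (FDMod.ker f).directSum N := by
  have h' : ∀ x, f (g x) = x := LinearMap.congr_fun h
  exact ⟨
    { toFun := fun x => ((⟨x - g (f x), by simp [h']⟩ : LinearMap.ker f), f x)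
      map_add' := fun x y => Prod.ext (Subtype.ext (by
        change x + y - g (f (x + y)) = (x - g (f x)) + (y - g (f y))
        rw [map_add, map_add]; abel)) (map_add f x y)
      map_smul' := fun c x => Prod.ext (Subtype.ext (by
        change c • x - g (f (c • x)) = c • (x - g (f x))
        rw [map_smul, map_smul, smul_sub])) (map_smul f c x)
      invFun := fun t => (show LinearMap.ker f from t.1).1 + g t.2
      left_inv := fun x => by
        change x - g (f x) + g (f x) = x
        abel
      right_inv := fun t => by
        obtain ⟨⟨x, hx⟩, y⟩ := t
        have e : f (x + g y) = y := by rw [map_add, h', LinearMap.mem_ker.1 hx, zero_add]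
        refine Prod.ext (Subtype.ext ?_) e
        change x + g y - g (f (x + g y)) = x
        rw [e]; abel }⟩

theorem FDMod.projective_ker {M N : FDMod k H} [Module.Projective H M] (f : M →ₗ[H] N)
    (g : N →ₗ[H] M) (h : f ∘ₗ g = LinearMap.id) : Module.Projective H (FDMod.ker f) := by
  have h' : ∀ x, f (g x) = x := LinearMap.congr_fun h
  refine Module.Projective.of_split (P := LinearMap.ker f) (M := M) (LinearMap.ker f).subtype
    ((LinearMap.id - g ∘ₗ f).codRestrict _ fun x => by simp [h']) ?_
  refine LinearMap.ext fun x => Subtype.ext ?_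
  change x.1 - g (f x.1) = x.1
  rw [LinearMap.mem_ker.1 x.2, map_zero, sub_zero]

end HomFunctions

/-! ### Classes of simple and projective modules and their products with `[V₂]` -/

namespace SmallQuantumGroup

section Classes

variable {k : Type u} [Field k] (q : k) (n : ℕ)
  [Fact (2 < n)] [Fact (Odd n)] [Fact (orderOf q = n ∨ orderOf q = 2 * n)]

/-- The class of the simple module of dimension `r`, and `0` for `r > n`. -/
def simpleClass (r : ℕ) : GreenRing k (SmallQuantumGroup q n) :=
  if h : r ≤ n then greenClass (simpleMod q n r h) else 0

variable {q n}

theorem simpleClass_eq {r : ℕ} (h : r ≤ n) :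
    simpleClass q n r = greenClass (simpleMod q n r h) := dif_pos h

theorem simpleClass_zero : simpleClass q n 0 = 0 := by
  rw [simpleClass_eq (Nat.zero_le n)]
  have : Subsingleton (simpleMod q n 0 (Nat.zero_le n)) :=
    (coords (q := q) (hr := Nat.zero_le n)).toEquiv.subsingleton
  exact greenClass_of_subsingleton _

theorem simpleClass_one : simpleClass q n 1 = 1 := by
  rw [simpleClass_eq (pos n), greenClass_eq (iso_triv (pos n)), greenClass_triv]

theorem simpleClass_two : simpleClass q n 2 = greenClass (V₂ q n) := by
  have h2 : 2 < n := Fact.out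
  rw [simpleClass_eq h2.le, greenClass_eq (iso_V₂ h2.le)]

/-- The convention that the class of dimension `0` is zero makes the recursion start at `s = 0`. -/
theorem mul_simpleClass {s : ℕ} (hs : s + 2 ≤ n) :
    greenClass (V₂ q n) * simpleClass q n (s + 1) =
      simpleClass q n (s + 2) + simpleClass q n s := by
  cases s with
  | zero => rw [simpleClass_one, mul_one, simpleClass_zero, add_zero, simpleClass_two]
  | succ s =>
    rw [simpleClass_eq (by omega : s + 1 + 1 ≤ n), simpleClass_eq (by omega : s + 1 + 2 ≤ n),
      simpleClass_eq (by omega : s + 1 ≤ n), greenClass_mul,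
      greenClass_eq (tensor_simpleMod_iso (by omega)), greenClass_directSum]

variable [CharZero k]

variable (q n) in
/-- The class of the projective cover of the simple module of dimension `r`. -/
def projClass (r : ℕ) : GreenRing k (SmallQuantumGroup q n) := greenClass (projMod q n r)

theorem simpleClass_self : simpleClass q n n = projClass q n n := by
  rw [simpleClass_eq le_rfl, projClass, greenClass_eq simpleMod_iso_projMod]

theorem projClass_zero : projClass q n 0 = 0 := by
  have h : idem q n 0 = 0 := dif_neg (by omega)
  have : Subsingleton (projMod q n 0) := by
    refine ⟨fun x y => ?_⟩
    obtain ⟨a, rfl⟩ := exists_smul_projGen x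
    obtain ⟨b, rfl⟩ := exists_smul_projGen y
    have : projGen q n 0 = 0 := Subtype.ext h
    rw [this, smul_zero, smul_zero]
  exact greenClass_of_subsingleton _

theorem homDim_projMod {r : ℕ} (h1 : 1 ≤ r) (hr : r ≤ n) (M : FDMod k (SmallQuantumGroup q n)) :
    homDim (projMod q n r) M = Module.finrank k (block q n M r) :=
  (projHomEquiv h1 hr).finrank_eq

theorem homDim_projMod_simpleMod {r s : ℕ} (h1 : 1 ≤ r) (hr : r ≤ n) (hs1 : 1 ≤ s) (hs : s ≤ n) :
    homDim (projMod q n r) (simpleMod q n s hs) = if s = r then 1 else 0 := by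
  rw [homDim_projMod h1 hr, finrank_block_simpleMod h1 hr hs1]

theorem homFrom_projMod_simpleClass {r s : ℕ} (h1 : 1 ≤ r) (hr : r ≤ n) (hs : s ≤ n) :
    homFrom (projMod q n r) (simpleClass q n s) = if s = r then 1 else 0 := by
  rcases Nat.eq_zero_or_pos s with rfl | hs1
  · rw [simpleClass_zero, map_zero, if_neg (by omega)]
  · rw [simpleClass_eq hs, homFrom_greenClass, homDim_projMod_simpleMod h1 hr hs1 hs]
    split_ifs <;> simp

variable [IsAlgClosed k]

/-- A projective module is determined by its simple quotients. -/
theorem greenClass_of_projective (P : FDMod k (SmallQuantumGroup q n))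
    (hP : Module.Projective (SmallQuantumGroup q n) P) :
    greenClass P = ∑ i ∈ Finset.range n,
      homFrom P (simpleClass q n (i + 1)) • projClass q n (i + 1) := by
  obtain ⟨d, hd⟩ : ∃ d, Module.finrank k P = d := ⟨_, rfl⟩
  induction d using Nat.strong_induction_on generalizing P with
  | _ d ih =>
  rcases subsingleton_or_nontrivial P with hsub | hnt
  · rw [greenClass_of_subsingleton, Finset.sum_eq_zero]
    intro i hi
    rw [simpleClass_eq (by simpa using hi), homFrom_greenClass, homDim_of_subsingleton_left]
    simp
  · have : IsNoetherian (SmallQuantumGroup q n) P := isNoetherian_of_tower k inferInstance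
    obtain ⟨N, hN, -⟩ := (eq_top_or_exists_le_coatom
      (⊥ : Submodule (SmallQuantumGroup q n) P)).resolve_left bot_ne_top
    have hsimple : IsSimpleModule (SmallQuantumGroup q n) (P ⧸ N) :=
      isSimpleModule_iff_isCoatom.2 hN
    have : Module.Finite k (P ⧸ N) :=
      Module.Finite.of_surjective (N.mkQ.restrictScalars k) N.mkQ_surjective
    obtain ⟨r, hr, h1, ⟨e⟩⟩ := exists_equiv_simpleMod (q := q) (n := n) (M := P ⧸ N)
    -- A simple quotient of `P` lifts to a map to its projective cover, onto because the kernel of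
    -- `toSimple` is superfluous and split because the cover is projective. The kernel of the lift
    -- is a smaller projective module, to which the induction applies.
    obtain ⟨f, hf⟩ := Module.projective_lifting_property (toSimple hr)
      (e.symm.toLinearMap ∘ₗ N.mkQ) (toSimple_surjective h1 hr)
    have hf' : Function.Surjective f := by
      refine surjective_of_toSimple_comp_ne_zero h1 hr f fun h0 => ?_
      rw [h0] at hf
      obtain ⟨x, hx⟩ := (e.symm.surjective.comp N.mkQ_surjective) (vec hr 0)
      exact vec_ne_zero (q := q) (hr := hr) (i := 0) (by omega)
        (hx.symm.trans (LinearMap.congr_fun hf x).symm)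
    have hproj := projective_projMod (q := q) h1 hr
    obtain ⟨g, hg⟩ := Module.projective_lifting_property f LinearMap.id hf'
    have hiso := FDMod.iso_directSum_ker f g hg
    have hker := FDMod.projective_ker f g hg
    have hlt : Module.finrank k (FDMod.ker f) < d := by
      obtain ⟨e'⟩ := hiso
      have h2 : Module.finrank k P =
          Module.finrank k (FDMod.ker f) + Module.finrank k (projMod q n r) :=
        (e'.restrictScalars k).finrank_eq.trans (Module.finrank_prod (R := k))
      have : Nontrivial (projMod q n r) := ⟨_, _, projGen_ne_zero h1 hr⟩
      have h3 : 0 < Module.finrank k (projMod q n r) := Module.finrank_pos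
      omega
    have hsum : ∀ x, homFrom P x = homFrom (FDMod.ker f) x + homFrom (projMod q n r) x := by
      have : ∀ M : FDMod k (SmallQuantumGroup q n), homFrom P (greenClass M) =
          homFrom (FDMod.ker f) (greenClass M) + homFrom (projMod q n r) (greenClass M) := by
        intro M
        rw [homFrom_greenClass, homFrom_greenClass, homFrom_greenClass,
          homDim_congr hiso (Setoid.refl M), homDim_directSum_left, Nat.cast_add]
      intro x
      obtain ⟨x, rfl⟩ := (greenIdeal k (SmallQuantumGroup q n)).ringCon.mk'_surjective x
      induction x using FreeAbelianGroup.induction_on with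
      | zero => simp only [map_zero, add_zero]
      | of c => obtain ⟨M⟩ := c; exact this M
      | neg c hc => obtain ⟨M⟩ := c; rw [map_neg, map_neg, map_neg, map_neg, hc, neg_add]
      | add a b ha hb => rw [map_add, map_add, map_add, map_add, ha, hb]; abel
    rw [greenClass_eq hiso, greenClass_directSum, ih _ hlt (FDMod.ker f) hker rfl]
    simp only [hsum, add_smul, Finset.sum_add_distrib]
    congr 1
    rw [Finset.sum_eq_single (r - 1)]
    · rw [Nat.sub_add_cancel h1, homFrom_projMod_simpleClass h1 hr hr, if_pos rfl, one_smul]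
      rfl
    · intro i hi hne
      rw [homFrom_projMod_simpleClass h1 hr (by simpa using hi), if_neg (by omega), zero_smul]
    · intro h
      exact absurd (Finset.mem_range.2 (by omega)) h

theorem homFrom_tensor (P : FDMod k (SmallQuantumGroup q n)) {s : ℕ} (hs : s ≤ n) :
    homFrom ((V₂ q n).tensor P) (simpleClass q n s) =
      homFrom P (greenClass (V₂ q n) * simpleClass q n s) := by
  rw [simpleClass_eq hs, greenClass_mul, homFrom_greenClass, homFrom_greenClass,
    homDim_tensor_left]

/-- The multiplicity of `P_s` is the dimension of `Hom(V₂ ⊗ P_r, V_s) = Hom(P_r, V₂ ⊗ V_s)`. For `s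
< n` the product `V₂ V_s` is `V_{s+1} + V_{s-1}`, so only `s = r - 1` and `s = r + 1` contribute;
the contribution of `s = n` is left as a dimension still to be found. -/
theorem mul_projClass {r : ℕ} (h1 : 1 ≤ r) (hr : r ≤ n) :
    greenClass (V₂ q n) * projClass q n r = projClass q n (r - 1) +
      (if r + 1 < n then projClass q n (r + 1) else 0) +
      homFrom (projMod q n r) (greenClass (V₂ q n) * projClass q n n) • projClass q n n := by
  have hproj := projective_projMod (q := q) h1 hr
  obtain ⟨m, hm⟩ : ∃ m, n = m + 1 := ⟨n - 1, by have := pos n; omega⟩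
  have hterm : ∀ i ∈ Finset.range m, homFrom ((V₂ q n).tensor (projMod q n r))
      (simpleClass q n (i + 1)) • projClass q n (i + 1) =
      (if i + 2 = r then projClass q n (i + 1) else 0) +
        (if i = r then projClass q n (i + 1) else 0) := by
    intro i hi
    rw [Finset.mem_range] at hi
    rw [homFrom_tensor _ (by omega), mul_simpleClass (by omega), map_add,
      homFrom_projMod_simpleClass h1 hr (by omega), homFrom_projMod_simpleClass h1 hr (by omega),
      add_smul]
    congr 1 <;> split_ifs <;> simp
  have hrange : Finset.range n = Finset.range (m + 1) := by rw [← hm]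
  have hlast : homFrom ((V₂ q n).tensor (projMod q n r)) (simpleClass q n (m + 1)) •
      projClass q n (m + 1) =
      homFrom (projMod q n r) (greenClass (V₂ q n) * projClass q n n) • projClass q n n := by
    rw [← hm, homFrom_tensor _ le_rfl, simpleClass_self]
  rw [projClass, greenClass_mul, greenClass_of_projective _ projective_tensor, hrange,
    Finset.sum_range_succ, hlast, Finset.sum_congr rfl hterm, Finset.sum_add_distrib]
  congr 2
  · rcases Nat.lt_or_ge r 2 with h | h
    · rw [show r - 1 = 0 by omega, projClass_zero]
      exact Finset.sum_eq_zero fun i _ => if_neg (by omega)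
    · rw [Finset.sum_eq_single (r - 2)]
      · rw [if_pos (by omega), show r - 2 + 1 = r - 1 by omega]
      · exact fun i _ hne => if_neg (by omega)
      · exact fun h => absurd (Finset.mem_range.2 (by omega)) h
  · rw [Finset.sum_ite_eq']
    exact if_congr (by rw [Finset.mem_range]; omega) rfl rfl

/-- By `block_tensor_simpleMod` the undetermined multiplicity is zero for `r = n`. -/
theorem mul_projClass_self :
    greenClass (V₂ q n) * projClass q n n = projClass q n (n - 1) := by
  have h := mul_projClass (q := q) (n := n) (pos n) le_rfl
  have h0 : homFrom (projMod q n n) (greenClass (V₂ q n) * projClass q n n) = 0 := by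
    rw [← simpleClass_self, simpleClass_eq le_rfl, greenClass_mul, homFrom_greenClass,
      homDim_projMod (pos n) le_rfl, block_tensor_simpleMod, finrank_bot, Nat.cast_zero]
  rwa [h0, zero_smul, if_neg (by omega), add_zero, add_zero] at h

/-! ### Maps between the indecomposable projective modules -/

open Polynomial in
theorem casimir_smul_projMod {r : ℕ} (h1 : 1 ≤ r) (hr : r ≤ n) (v : projMod q n r) :
    aeval (casimir q n) ((X - C (casVal q (hw q n r))) ^ 2) • v = 0 := by
  obtain ⟨y, rfl⟩ := exists_smul_projGen v
  rw [aeval_casimir_smul_comm, ((idem_smul_eq_iff h1 hr).1 (idem_smul_projGen h1 hr)).2, smul_zero]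

open Polynomial in
-- All of `P_s` is killed by the square of the Casimir element minus its value, since the generator
-- is and the Casimir element is central. The Casimir condition in the block is therefore automatic
-- when the values agree and excludes everything when they differ.
theorem finrank_block_projMod {r s : ℕ} (h1 : 1 ≤ r) (hr : r ≤ n) (hs1 : 1 ≤ s) (hs : s ≤ n) :
    Module.finrank k (block q n (projMod q n s) r) =
      if r = s ∨ r + s = n then Module.finrank k (weightSpace (projMod q n s) (hw q n r))
      else 0 := by
  split_ifs with h
  · have hc := (casVal_hw_eq_iff q n h1 hr hs1 hs).2 h
    have : block q n (projMod q n s) r = weightSpace (projMod q n s) (hw q n r) := by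
      ext v
      rw [mem_block, mem_weightSpace, idem_smul_eq_iff h1 hr, hc]
      exact and_iff_left (casimir_smul_projMod hs1 hs v)
    rw [this]
  · have hc := mt (casVal_hw_eq_iff q n h1 hr hs1 hs).1 h
    have : block q n (projMod q n s) r = ⊥ := by
      rw [eq_bot_iff]
      intro v hv
      have hv1 := ((idem_smul_eq_iff h1 hr).1 (mem_block.1 hv)).2
      have hv2 := casimir_smul_projMod hs1 hs v
      obtain ⟨a, b, hab⟩ : IsCoprime ((X - C (casVal q (hw q n r))) ^ 2)
          ((X - C (casVal q (hw q n s))) ^ 2) :=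
        (isCoprime_X_sub_C_of_isUnit_sub (sub_ne_zero.2 hc).isUnit).pow
      rw [Submodule.mem_bot, ← one_smul (SmallQuantumGroup q n) v, ← map_one (aeval (R := k) (casimir q n)),
        ← hab, map_add, map_mul, map_mul, add_smul, mul_smul, mul_smul, hv1, hv2, smul_zero,
        smul_zero, add_zero]
    rw [this, finrank_bot]

theorem weightMult_mul (μ : k) (x : GreenRing k (SmallQuantumGroup q n)) :
    weightMult μ (greenClass (V₂ q n) * x) =
      weightMult (root q n * μ) x + weightMult ((root q n)⁻¹ * μ) x := by
  obtain ⟨x, rfl⟩ := (greenIdeal k (SmallQuantumGroup q n)).ringCon.mk'_surjective x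
  induction x using FreeAbelianGroup.induction_on with
  | zero => simp only [map_zero, mul_zero, add_zero]
  | of c => obtain ⟨M⟩ := c; exact weightMult_tensor μ M
  | neg c hc =>
    obtain ⟨M⟩ := c
    rw [map_neg, mul_neg, map_neg, map_neg, map_neg, hc, neg_add]
  | add a b ha hb => rw [map_add, mul_add, map_add, map_add, map_add, ha, hb]; abel

theorem root_mul_pow {μ : k} (hμ : μ ^ n = 1) : (root q n * μ) ^ n = 1 := by
  rw [mul_pow, root_pow, hμ, one_mul]

theorem root_inv_mul_pow {μ : k} (hμ : μ ^ n = 1) : ((root q n)⁻¹ * μ) ^ n = 1 := by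
  rw [mul_pow, inv_pow, root_pow, hμ, inv_one, one_mul]

theorem weightMult_projClass_self {μ : k} (hμ : μ ^ n = 1) :
    weightMult μ (projClass q n n) = 1 := by
  rw [← simpleClass_self, simpleClass_eq le_rfl, weightMult_greenClass,
    finrank_weightSpace_simpleMod hμ, Nat.cast_one]

theorem weightMult_projClass_pred {μ : k} (hμ : μ ^ n = 1) :
    weightMult μ (projClass q n (n - 1)) = 2 := by
  rw [← mul_projClass_self, weightMult_mul, weightMult_projClass_self (root_mul_pow hμ),
    weightMult_projClass_self (root_inv_mul_pow hμ)]
  rfl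

theorem homFrom_projMod_projClass {r s : ℕ} (h1 : 1 ≤ r) (hr : r ≤ n) (hs1 : 1 ≤ s) (hs : s ≤ n) :
    homFrom (projMod q n r) (projClass q n s) =
      if r = s ∨ r + s = n then weightMult (hw q n r) (projClass q n s) else 0 := by
  rw [projClass, homFrom_greenClass, homDim_projMod h1 hr, finrank_block_projMod h1 hr hs1 hs,
    weightMult_greenClass]
  split_ifs <;> simp

/-- The missing multiplicity is the dimension of `Hom(P_r, P_{n-1})`. It is zero unless `r` is `n -
1` or `1`, and then it is a weight multiplicity of `P_{n-1} = V₂ ⊗ V_n`, which is `1 + 1`. -/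
theorem mul_projClass_of_lt {r : ℕ} (h1 : 1 ≤ r) (hr : r < n) :
    greenClass (V₂ q n) * projClass q n r = projClass q n (r - 1) +
      (if r + 1 < n then projClass q n (r + 1) else 0) +
      (if r = 1 ∨ r + 1 = n then 2 else 0 : ℤ) • projClass q n n := by
  have h2 : 2 < n := Fact.out
  rw [mul_projClass h1 hr.le, mul_projClass_self,
    homFrom_projMod_projClass h1 hr.le (by omega) (by omega),
    weightMult_projClass_pred (hw_pow q n r)]
  congr 2
  exact if_congr (by omega) rfl rfl

/-- The relation between the classes of the projective modules, away from the end of the range. -/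
theorem mul_projClass_sub {j : ℕ} (hj : 1 ≤ j) (hjn : j + 2 ≤ n) :
    greenClass (V₂ q n) * projClass q n (n - j) = projClass q n (n - (j + 1)) +
      (if j = 1 then 2 • projClass q n n else projClass q n (n - (j - 1))) := by
  have h2 : 2 < n := Fact.out
  rw [mul_projClass_of_lt (by omega) (by omega), Nat.sub_sub, add_assoc]
  congr 1
  by_cases h : j = 1
  · subst h
    rw [if_neg (by omega), if_pos (by omega), if_pos rfl, zero_add, ofNat_zsmul]
  · rw [if_pos (by omega), if_neg (by omega), if_neg h, zero_smul, add_zero]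
    congr 1
    omega

theorem mul_projClass_one : greenClass (V₂ q n) * projClass q n 1 =
    projClass q n 2 + 2 • projClass q n n := by
  have h2 : 2 < n := Fact.out
  rw [mul_projClass_of_lt le_rfl (by omega), projClass_zero, zero_add, if_pos h2,
    if_pos (.inl rfl), ofNat_zsmul]

/-- The recursion for `P_{n-j}` preserves the value: each step gives `2 + 2` minus `2`, where at the
first step the subtracted `2` comes from two copies of `P_n`. -/
theorem weightMult_projClass {j : ℕ} (hj : 1 ≤ j) (hjn : j + 1 ≤ n) {μ : k} (hμ : μ ^ n = 1) :
    weightMult μ (projClass q n (n - j)) = 2 := by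
  induction j using Nat.strong_induction_on generalizing μ with
  | _ j ih =>
  obtain rfl | ⟨j, rfl⟩ : j = 1 ∨ ∃ i, j = i + 2 := by
    rcases j with _ | _ | j
    · omega
    · exact .inl rfl
    · exact .inr ⟨j, rfl⟩
  · exact weightMult_projClass_pred hμ
  · have h := congrArg (weightMult μ) (mul_projClass_sub (q := q) (n := n) (j := j + 1)
      (by omega) (by omega))
    rw [weightMult_mul, ih (j + 1) (by omega) (by omega) (by omega) (root_mul_pow hμ),
      ih (j + 1) (by omega) (by omega) (by omega) (root_inv_mul_pow hμ), map_add] at h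
    have h3 : weightMult μ (if j + 1 = 1 then 2 • projClass q n n
        else projClass q n (n - (j + 1 - 1))) = 2 := by
      split_ifs with h0
      · rw [map_nsmul, weightMult_projClass_self hμ]; rfl
      · exact ih (j + 1 - 1) (by omega) (by omega) (by omega) hμ
    rw [h3] at h
    change weightMult μ (projClass q n (n - (j + 1 + 1))) = 2
    omega

theorem homFrom_projMod_projClass_of_lt {r s : ℕ} (h1 : 1 ≤ r) (hr : r ≤ n) (hs1 : 1 ≤ s)
    (hs : s < n) : homFrom (projMod q n r) (projClass q n s) =
      if r = s ∨ r + s = n then 2 else 0 := by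
  rw [homFrom_projMod_projClass h1 hr hs1 hs.le]
  congr 1
  rw [show s = n - (n - s) by omega]
  exact weightMult_projClass (by omega) (by omega) (hw_pow q n r)

theorem homTo_simpleMod_projClass {r s : ℕ} (h1 : 1 ≤ r) (hr : r ≤ n) (hs1 : 1 ≤ s) (hs : s ≤ n) :
    homTo (simpleMod q n r hr) (projClass q n s) = if r = s then 1 else 0 := by
  rw [projClass, homTo_greenClass, homDim_projMod_simpleMod hs1 hs h1 hr]
  split_ifs <;> simp

theorem homTo_simpleMod_simpleClass {r s : ℕ} (h1 : 1 ≤ r) (hr : r ≤ n) (hs1 : 1 ≤ s)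
    (hs : s ≤ n) : homTo (simpleMod q n r hr) (simpleClass q n s) = if r = s then 1 else 0 := by
  have hsr := isSimpleModule_simpleMod (q := q) (hr := hr) h1
  have hss := isSimpleModule_simpleMod (q := q) (hr := hs) hs1
  rw [simpleClass_eq hs, homTo_greenClass]
  split_ifs with h
  · subst h
    -- Composition with `toSimple` embeds the endomorphisms of the simple module into `Hom(P_r,
    -- V_r)`, which has dimension `1`.
    have hle : homDim (simpleMod q n r hs) (simpleMod q n r hr) ≤ 1 := by
      have h2 := homDim_projMod_simpleMod (q := q) h1 hr h1 hr
      rw [if_pos rfl] at h2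
      rw [← h2]
      refine LinearMap.finrank_le_finrank_of_injective
        (f := ({ toFun := fun φ => φ ∘ₗ toSimple hr
                 map_add' := fun _ _ => rfl
                 map_smul' := fun _ _ => rfl } :
          (simpleMod q n r hr →ₗ[SmallQuantumGroup q n] simpleMod q n r hr) →ₗ[k]
          (projMod q n r →ₗ[SmallQuantumGroup q n] simpleMod q n r hr))) fun φ ψ h => ?_
      ext x
      obtain ⟨y, rfl⟩ := toSimple_surjective h1 hr x
      exact LinearMap.congr_fun h y
    have hge : 0 < homDim (simpleMod q n r hs) (simpleMod q n r hr) := by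
      have := IsSimpleModule.nontrivial (SmallQuantumGroup q n) (simpleMod q n r hr)
      have : Nontrivial (simpleMod q n r hr →ₗ[SmallQuantumGroup q n] simpleMod q n r hr) :=
        ⟨LinearMap.id, 0, fun h0 => by
          obtain ⟨x, hx⟩ := exists_ne (0 : simpleMod q n r hr)
          exact hx (LinearMap.congr_fun h0 x)⟩
      exact Module.finrank_pos
    have : homDim (simpleMod q n r hs) (simpleMod q n r hr) = 1 := by omega
    rw [this, Nat.cast_one]
  · have : Subsingleton (simpleMod q n s hs →ₗ[SmallQuantumGroup q n] simpleMod q n r hr) := by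
      have h0 : ∀ f : simpleMod q n s hs →ₗ[SmallQuantumGroup q n] simpleMod q n r hr, f = 0 := by
        intro f
        by_contra hf
        exact h (simpleMod_equiv_iff (LinearEquiv.ofBijective f
          (LinearMap.bijective_of_ne_zero hf))).symm
      exact ⟨fun f g => (h0 f).trans (h0 g).symm⟩
    have h3 : homDim (simpleMod q n s hs) (simpleMod q n r hr) = 0 :=
      Module.finrank_zero_of_subsingleton
    rw [h3, Nat.cast_zero]

end Classes

end SmallQuantumGroup

/-! ### Chebyshev polynomials over the integers and the degree of the relation -/

section IntegerPolynomials

open Polynomial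

/-- A closed form of the rescaled Chebyshev polynomials of the second kind. -/
theorem chebyshev_S_eq_sum {m N : ℕ} (h : m < 2 * N) :
    Chebyshev.S ℤ m = ∑ i ∈ Finset.range N,
      C ((-1) ^ i * ((m - i).choose i : ℤ)) * X ^ (m - 2 * i) := by
  induction m using Nat.strong_induction_on generalizing N with
  | _ m ih =>
  obtain ⟨N, rfl⟩ : ∃ N', N = N' + 1 := ⟨N - 1, by omega⟩
  rcases m with _ | _ | m
  · rw [Finset.sum_range_succ', Finset.sum_eq_zero]
    · simp
    · intro i _
      rw [Nat.choose_eq_zero_of_lt (by omega)]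
      simp
  · rw [Finset.sum_range_succ', Finset.sum_eq_zero]
    · simp
    · intro i _
      rw [Nat.choose_eq_zero_of_lt (by omega)]
      simp
  -- The number of terms is free because the binomials vanish beyond `m / 2`; choosing `N + 1` and
  -- `N` terms makes the shifted sums match term by term.
  · have h1 := ih (m + 1) (by omega) (N := N + 1) (by omega)
    have h2 := ih m (by omega) (N := N) (by omega)
    push_cast at h1 ⊢
    rw [show (m : ℤ) + 1 + 1 = m + 2 by ring, Chebyshev.S_add_two, h1, h2,
      Finset.sum_range_succ', Finset.sum_range_succ', mul_add, add_sub_right_comm,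
      Finset.mul_sum, ← Finset.sum_sub_distrib]
    congr 1
    · refine Finset.sum_congr rfl fun i _ => ?_
      by_cases hi : 2 * i ≤ m
      · have hc : (m + 1 + 1 - (i + 1)).choose (i + 1) =
            (m - i).choose i + (m + 1 - (i + 1)).choose (i + 1) := by
          rw [show m + 1 + 1 - (i + 1) = (m - i) + 1 by omega,
            show m + 1 - (i + 1) = m - i by omega, Nat.choose_succ_succ]
        rw [hc, show m + 1 + 1 - 2 * (i + 1) = m - 2 * i by omega]
        by_cases hi' : 2 * i = m
        · rw [Nat.choose_eq_zero_of_lt (n := m + 1 - (i + 1)) (by omega)]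
          simp [pow_succ]
        · rw [show m - 2 * i = (m + 1 - 2 * (i + 1)) + 1 by omega, pow_succ X]
          simp only [Nat.cast_add, C_mul, C_add, C_pow, pow_succ, C_neg, C_1]
          ring
      · rw [Nat.choose_eq_zero_of_lt (n := m + 1 + 1 - (i + 1)) (by omega),
          Nat.choose_eq_zero_of_lt (n := m + 1 - (i + 1)) (by omega),
          Nat.choose_eq_zero_of_lt (n := m - i) (by omega)]
        simp
    · simp only [Nat.choose_zero_right, pow_zero, Nat.cast_one, mul_one, C_1, one_mul, mul_zero,
        Nat.sub_zero, ← pow_succ']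

/-- With `j = i + 1`, the quotient `n / (n - j) * (n - j).choose j` splits as `(n - j).choose j + (n
- j - 1).choose (j - 1)`, the coefficient form of `C_n = S_n - S_{n-2}`. -/
theorem mul_choose_div {n i : ℕ} (h : i + 1 < n) :
    n * (n - (i + 1)).choose (i + 1) / (n - (i + 1)) =
      (n - (i + 1)).choose (i + 1) + (n - 2 - i).choose i := by
  obtain ⟨m, rfl⟩ : ∃ m, n = m + 1 + (i + 1) := ⟨n - i - 2, by omega⟩
  rw [Nat.add_sub_cancel, show m + 1 + (i + 1) - 2 - i = m by omega]
  refine Nat.div_eq_of_eq_mul_right (Nat.succ_pos m) ?_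
  rw [mul_add, Nat.add_one_mul_choose_eq]
  ring

theorem firstPoly_eq {n : ℕ} (h : 1 < n) (ho : Odd n) : firstPoly n = Chebyshev.C ℤ n := by
  obtain ⟨m, rfl⟩ := ho
  have h1 := chebyshev_S_eq_sum (m := 2 * m + 1) (N := m + 1) (by omega)
  have h2 := chebyshev_S_eq_sum (m := 2 * m + 1 - 2) (N := m) (by omega)
  have hC : Chebyshev.C ℤ (2 * m + 1 : ℕ) =
      Chebyshev.S ℤ (2 * m + 1 : ℕ) - Chebyshev.S ℤ (2 * m + 1 - 2 : ℕ) := by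
    rw [Chebyshev.C_eq_S_sub_X_mul_S, Chebyshev.S_eq ℤ ((2 * m + 1 : ℕ) : ℤ),
      Nat.cast_sub (by omega)]
    push_cast
    ring
  rw [hC, h1, h2, firstPoly, show (2 * m + 1 - 1) / 2 + 1 = m + 1 by omega,
    Finset.sum_range_succ', Finset.sum_range_succ', add_sub_right_comm,
    ← Finset.sum_sub_distrib]
  congr 1
  · refine Finset.sum_congr rfl fun i hi => ?_
    have hi := Finset.mem_range.1 hi
    rw [mul_choose_div (by omega), show 2 * m + 1 - 2 * (i + 1) = 2 * m + 1 - 2 - 2 * i by omega,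
      ← sub_mul, ← C_sub]
    congr 2
    push_cast
    ring
  · simp

theorem secondPoly_eq (n : ℕ) : secondPoly n = Chebyshev.S ℤ (n - 1 : ℕ) :=
  (chebyshev_S_eq_sum (by omega)).symm

theorem isMonicOfDegree_chebyshev_S (m : ℕ) : IsMonicOfDegree (Chebyshev.S ℤ m) m := by
  induction m using Nat.strong_induction_on with
  | _ m ih =>
  rcases m with _ | _ | m
  · simp
  · simpa using isMonicOfDegree_X ℤ
  · push_cast
    rw [show (m : ℤ) + 1 + 1 = m + 2 by ring, Chebyshev.S_add_two, show m + 1 + 1 = 1 + (m + 1) by ring]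
    have h1 := ih (m + 1) (by omega)
    have h0 := ih m (by omega)
    push_cast at h1
    refine ((isMonicOfDegree_X ℤ).mul h1).sub ?_
    rw [h0.natDegree_eq]
    omega

/-- The index starts at `1` because `C_0 = 2` is not monic. -/
theorem isMonicOfDegree_chebyshev_C (m : ℕ) : IsMonicOfDegree (Chebyshev.C ℤ (m + 1 : ℕ)) (m + 1) := by
  induction m using Nat.strong_induction_on with
  | _ m ih =>
  rcases m with _ | _ | m
  · simpa using isMonicOfDegree_X ℤ
  · have h := (isMonicOfDegree_X_pow ℤ 2).sub (q := 2) (by simp)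
    simpa [one_add_one_eq_two, Chebyshev.C_two] using h
  · have h1 := ih (m + 1) (by omega)
    have h0 := ih m (by omega)
    push_cast at h1 ⊢
    rw [show (m : ℤ) + 1 + 1 + 1 = (m + 1) + 2 by ring, Chebyshev.C_add_two,
      show m + 1 + 1 + 1 = 1 + (m + 1 + 1) by ring]
    refine ((isMonicOfDegree_X ℤ).mul h1).sub ?_
    have := h0.natDegree_eq
    push_cast at this
    rw [this]
    omega

/-- One monic polynomial in each degree is a basis: subtract the leading term and induct. -/
theorem exists_eq_sum_of_isMonicOfDegree {R : Type*} [CommRing R] [Nontrivial R] {Q : ℕ → R[X]}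
    (hQ : ∀ i, IsMonicOfDegree (Q i) i) {m : ℕ} {f : R[X]} (hf : f.degree < m) :
    ∃ c : ℕ → R, f = ∑ i ∈ Finset.range m, C (c i) * Q i := by
  induction m generalizing f with
  | zero =>
    refine ⟨0, ?_⟩
    rw [Finset.range_zero, Finset.sum_empty]
    simpa [Nat.WithBot.lt_zero_iff, degree_eq_bot] using hf
  | succ m ih =>
    have hlt : (f - C (f.coeff m) * Q m).degree < m := by
      rw [degree_lt_iff_coeff_zero] at hf ⊢
      intro i hi
      rw [coeff_sub, coeff_C_mul]
      obtain rfl | hi := hi.eq_or_lt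
      · have h1 : (Q m).coeff m = 1 := by
          simpa [(hQ m).natDegree_eq] using (hQ m).monic.coeff_natDegree
        rw [h1, mul_one, sub_self]
      · rw [hf i hi, coeff_eq_zero_of_natDegree_lt (p := Q m) (by rw [(hQ m).natDegree_eq]; exact hi),
          mul_zero, sub_zero]
    obtain ⟨c, hc⟩ := ih hlt
    refine ⟨Function.update c m (f.coeff m), ?_⟩
    rw [Finset.sum_range_succ, Function.update_self, ← sub_eq_iff_eq_add, hc]
    refine Finset.sum_congr rfl fun i hi => ?_
    rw [Function.update_of_ne (Finset.mem_range.1 hi).ne]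

/-- Monic polynomials whose values at the class of `V₂` are the classes of the simple modules and
of the non-simple indecomposable projective modules. -/
def classPoly (n i : ℕ) : ℤ[X] :=
  if i < n then Chebyshev.S ℤ i else Chebyshev.C ℤ (i - n + 1 : ℕ) * Chebyshev.S ℤ (n - 1 : ℕ)

theorem isMonicOfDegree_classPoly {n : ℕ} (h : 1 ≤ n) (i : ℕ) : IsMonicOfDegree (classPoly n i) i := by
  rw [classPoly]
  split_ifs with hi
  · exact isMonicOfDegree_chebyshev_S i
  · have := (isMonicOfDegree_chebyshev_C (i - n)).mul (isMonicOfDegree_chebyshev_S (n - 1))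
    rwa [show i - n + 1 + (n - 1) = i by omega] at this

theorem isMonicOfDegree_relation {n : ℕ} (h : 1 < n) (ho : Odd n) :
    IsMonicOfDegree ((firstPoly n - 2) * secondPoly n) (n + (n - 1)) := by
  have hC := isMonicOfDegree_chebyshev_C (n - 1)
  rw [Nat.sub_add_cancel h.le] at hC
  rw [firstPoly_eq h ho, secondPoly_eq]
  refine (hC.sub ?_).mul (isMonicOfDegree_chebyshev_S _)
  rw [natDegree_ofNat]
  omega

end IntegerPolynomials

/-! ### Evaluation at `[V₂]`: relation, kernel and range -/

namespace SmallQuantumGroup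

open Polynomial

variable {k : Type u} [Field k] {q : k} {n : ℕ} [CharZero k] [IsAlgClosed k]
  [Fact (2 < n)] [Fact (Odd n)] [Fact (orderOf q = n ∨ orderOf q = 2 * n)]

theorem aeval_chebyshev_S {r : ℕ} (hr : r < n) :
    aeval (greenClass (V₂ q n)) (Chebyshev.S ℤ r) = simpleClass q n (r + 1) := by
  induction r using Nat.strong_induction_on with
  | _ r ih =>
  rcases r with _ | _ | r
  · rw [Nat.cast_zero, Chebyshev.S_zero, map_one, zero_add, simpleClass_one]
  · rw [zero_add, Nat.cast_one, Chebyshev.S_one, aeval_X, one_add_one_eq_two, simpleClass_two]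
  · have h1 := ih (r + 1) (by omega) (by omega)
    have h0 := ih r (by omega) (by omega)
    push_cast at h1 ⊢
    rw [add_assoc (r : ℤ), one_add_one_eq_two, Chebyshev.S_add_two, map_sub, map_mul, aeval_X, h1,
      h0, mul_simpleClass (by omega), add_sub_cancel_right]

theorem aeval_chebyshev_C_mul_projClass {j : ℕ} (hj : j < n) :
    aeval (greenClass (V₂ q n)) (Chebyshev.C ℤ j) * projClass q n n =
      if j = 0 then 2 • projClass q n n else projClass q n (n - j) := by
  induction j using Nat.strong_induction_on with
  | _ j ih =>
  rcases j with _ | _ | j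
  · rw [Nat.cast_zero, Chebyshev.C_zero, map_ofNat, if_pos rfl, two_mul, two_nsmul]
  · rw [zero_add, Nat.cast_one, Chebyshev.C_one, aeval_X, if_neg one_ne_zero, mul_projClass_self]
  · have h1 := ih (j + 1) (by omega) (by omega)
    have h0 := ih j (by omega) (by omega)
    have h2 := mul_projClass_sub (q := q) (n := n) (j := j + 1) (by omega) (by omega)
    rw [if_neg (Nat.succ_ne_zero j)] at h1
    simp only [Nat.add_eq_right, Nat.add_sub_cancel] at h2
    push_cast at h1 ⊢
    rw [add_assoc (j : ℤ), one_add_one_eq_two, Chebyshev.C_add_two, map_sub, map_mul, aeval_X,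
      sub_mul, mul_assoc, h1, h0, h2, add_sub_cancel_right]

/-- The recursion `C_n = X C_{n-1} - C_{n-2}` gives `V₂ P_1 - P_2`, which is `2 P_n`: the chain
returns to twice its start, and this is the defining relation. -/
theorem aeval_chebyshev_C_mul_projClass_self :
    aeval (greenClass (V₂ q n)) (Chebyshev.C ℤ n) * projClass q n n = 2 • projClass q n n := by
  have h2 : 2 < n := Fact.out
  have h1 := aeval_chebyshev_C_mul_projClass (q := q) (n := n) (j := n - 1) (by omega)
  have h0 := aeval_chebyshev_C_mul_projClass (q := q) (n := n) (j := n - 2) (by omega)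
  rw [if_neg (by omega), Nat.cast_sub (by omega), Nat.cast_one, Nat.sub_sub_self (by omega)] at h1
  rw [if_neg (by omega), Nat.cast_sub (by omega), Nat.cast_ofNat, Nat.sub_sub_self (by omega)] at h0
  rw [Chebyshev.C_eq, map_sub, map_mul, aeval_X, sub_mul, mul_assoc, h1, h0, mul_projClass_one,
    add_sub_cancel_left]

theorem aeval_secondPoly :
    aeval (greenClass (V₂ q n)) (Chebyshev.S ℤ (n - 1 : ℕ)) = projClass q n n := by
  have h2 : 2 < n := Fact.out
  rw [aeval_chebyshev_S (by omega), Nat.sub_add_cancel (by omega), simpleClass_self]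

theorem aeval_relation :
    aeval (greenClass (V₂ q n)) ((firstPoly n - 2) * secondPoly n) = 0 := by
  have h2 : 2 < n := Fact.out
  rw [firstPoly_eq (by omega) Fact.out, secondPoly_eq, map_mul, map_sub,
    aeval_secondPoly, sub_mul, aeval_chebyshev_C_mul_projClass_self, map_ofNat, two_mul, two_nsmul,
    sub_self]

/-- The class `P_n` is left out of the second sum since it equals `V_n`. Maps to `V_{s+1}` and maps
from `P_{s+1}` are additive and give two families of linear equations in the coefficients. -/
theorem linearIndependent_simpleClass_projClass {a b : ℕ → ℤ}
    (h : ∑ i ∈ Finset.range n, a i • simpleClass q n (i + 1) +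
      ∑ i ∈ Finset.range (n - 1), b i • projClass q n (i + 1) = 0) :
    (∀ i < n, a i = 0) ∧ ∀ i < n - 1, b i = 0 := by
  have h2 : 2 < n := Fact.out
  have ho : Odd n := Fact.out
  -- Both `V_{s+1}` and `P_{s+1}` have a one-dimensional space of maps to `V_{s+1}`, and the other
  -- classes have none.
  have hto : ∀ s < n, a s + (if s < n - 1 then b s else 0) = 0 := by
    intro s hs
    have := congrArg (homTo (simpleMod q n (s + 1) hs)) h
    rw [map_add, map_sum, map_sum, map_zero] at this
    refine Eq.trans ?_ this
    congr 1
    · rw [Finset.sum_eq_single_of_mem s (Finset.mem_range.2 hs), map_zsmul,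
        homTo_simpleMod_simpleClass (by omega) hs (by omega) hs, if_pos rfl, smul_eq_mul, mul_one]
      intro i hi his
      have := Finset.mem_range.1 hi
      rw [map_zsmul, homTo_simpleMod_simpleClass (by omega) hs (by omega) this, if_neg (by omega),
        smul_zero]
    · split_ifs with hs'
      · rw [Finset.sum_eq_single_of_mem s (Finset.mem_range.2 hs'), map_zsmul,
          homTo_simpleMod_projClass (by omega) hs (by omega) hs, if_pos rfl, smul_eq_mul, mul_one]
        intro i hi his
        have := Finset.mem_range.1 hi
        rw [map_zsmul, homTo_simpleMod_projClass (by omega) hs (by omega) (by omega),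
          if_neg (by omega), smul_zero]
      · refine (Finset.sum_eq_zero fun i hi => ?_).symm
        have := Finset.mem_range.1 hi
        rw [map_zsmul, homTo_simpleMod_projClass (by omega) hs (by omega) (by omega),
          if_neg (by omega), smul_zero]
  -- The module `P_{s+1}` has a two-dimensional space of maps to itself and to its linked partner
  -- `P_{n-1-s}`, whose index in the sum is `n - 2 - s`.
  have hfrom : ∀ s < n - 1, a s + (2 * b s + 2 * b (n - 2 - s)) = 0 := by
    intro s hs
    have := congrArg (homFrom (projMod q n (s + 1))) h
    rw [map_add, map_sum, map_sum, map_zero] at this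
    refine Eq.trans ?_ this
    congr 1
    · rw [Finset.sum_eq_single_of_mem s (Finset.mem_range.2 (by omega)), map_zsmul,
        homFrom_projMod_simpleClass (by omega) (by omega) (by omega), if_pos rfl, smul_eq_mul,
        mul_one]
      intro i hi his
      have := Finset.mem_range.1 hi
      rw [map_zsmul, homFrom_projMod_simpleClass (by omega) (by omega) (by omega),
        if_neg (by omega), smul_zero]
    -- The partner is a different module because `n` is odd.
    · have hne : s ≠ n - 2 - s := by
        obtain ⟨m, rfl⟩ := ho
        omega
      rw [Finset.sum_eq_add_of_mem s (n - 2 - s) (Finset.mem_range.2 hs)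
        (Finset.mem_range.2 (by omega)) hne, map_zsmul, map_zsmul,
        homFrom_projMod_projClass_of_lt (by omega) (by omega) (by omega) (by omega),
        homFrom_projMod_projClass_of_lt (by omega) (by omega) (by omega) (by omega),
        if_pos (.inl rfl), if_pos (.inr (by omega)), smul_eq_mul, smul_eq_mul, mul_comm (b s),
        mul_comm (b _)]
      intro i hi his
      have := Finset.mem_range.1 hi
      rw [map_zsmul, homFrom_projMod_projClass_of_lt (by omega) (by omega) (by omega) (by omega),
        if_neg (by omega), smul_zero]
  -- The second equation gives `i` and its partner equal `a`, so the first gives them equal `b`.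
  -- Then `a + b = 0` and `a + 4 b = 0`.
  have hb : ∀ i < n - 1, b i = 0 := by
    intro i hi
    have e1 := hto i (by omega)
    have e2 := hto (n - 2 - i) (by omega)
    have e3 := hfrom i hi
    have e4 := hfrom (n - 2 - i) (by omega)
    rw [if_pos (by omega)] at e1 e2
    rw [show n - 2 - (n - 2 - i) = i by omega] at e4
    omega
  refine ⟨fun i hi => ?_, hb⟩
  have := hto i hi
  split_ifs at this with h'
  · rw [hb i h', add_zero] at this
    exact this
  · rwa [add_zero] at this

theorem aeval_classPoly_of_lt {i : ℕ} (hi : i < n) :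
    aeval (greenClass (V₂ q n)) (classPoly n i) = simpleClass q n (i + 1) := by
  rw [classPoly, if_pos hi, aeval_chebyshev_S hi]

/-- Rising degree runs through the projective classes downwards, from `P_{n-1}` to `P_1`; the index
is written to match a reflected sum. -/
theorem aeval_classPoly_add {j : ℕ} (hj : j < n - 1) :
    aeval (greenClass (V₂ q n)) (classPoly n (n + j)) = projClass q n (n - 1 - 1 - j + 1) := by
  rw [classPoly, if_neg (by omega), map_mul, aeval_secondPoly,
    aeval_chebyshev_C_mul_projClass (by omega), if_neg (by omega)]
  congr 1
  omega

theorem ker_aeval_V₂ : RingHom.ker (aeval (R := ℤ) (greenClass (V₂ q n))) =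
    Ideal.span {(firstPoly n - 2) * secondPoly n} := by
  have h2 : 2 < n := Fact.out
  have hΦ := isMonicOfDegree_relation (n := n) (by omega) Fact.out
  refine le_antisymm (fun f hf => ?_) ?_
  swap
  · rw [Ideal.span_singleton_le_iff_mem]
    exact aeval_relation
  have hdeg := degree_modByMonic_lt f hΦ.monic
  rw [degree_eq_natDegree hΦ.ne_zero, hΦ.natDegree_eq] at hdeg
  have hr : aeval (greenClass (V₂ q n)) (f %ₘ ((firstPoly n - 2) * secondPoly n)) = 0 := by
    have h := congrArg (aeval (greenClass (V₂ q n)))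
      (modByMonic_add_div f ((firstPoly n - 2) * secondPoly n))
    rwa [map_add, map_mul, aeval_relation, zero_mul, add_zero, RingHom.mem_ker.1 hf] at h
  rw [Ideal.mem_span_singleton, ← modByMonic_eq_zero_iff_dvd hΦ.monic]
  -- The remainder of `f` modulo the relation has degree below `2n - 1`, so it is an integer
  -- combination of the `classPoly`, whose values at `[V₂]` are the independent classes.
  obtain ⟨c, hc⟩ := exists_eq_sum_of_isMonicOfDegree
    (isMonicOfDegree_classPoly (n := n) (by omega)) hdeg
  rw [hc, map_sum, Finset.sum_range_add] at hr
  have hci := linearIndependent_simpleClass_projClass (q := q) (n := n) (a := c)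
    (b := fun i => c (n + (n - 1 - 1 - i))) (by
      rw [← hr, ← Finset.sum_range_reflect (fun i => _ • projClass q n (i + 1))]
      congr 1
      · refine Finset.sum_congr rfl fun i hi => ?_
        rw [map_mul, aeval_C, aeval_classPoly_of_lt (Finset.mem_range.1 hi), eq_intCast (algebraMap ℤ (GreenRing k (SmallQuantumGroup q n))),
          zsmul_eq_mul]
      · refine Finset.sum_congr rfl fun i hi => ?_
        have hi := Finset.mem_range.1 hi
        rw [map_mul, aeval_C, aeval_classPoly_add hi, eq_intCast (algebraMap ℤ (GreenRing k (SmallQuantumGroup q n))),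
          zsmul_eq_mul]
        congr 4
        omega)
  rw [hc]
  refine Finset.sum_eq_zero fun i hi => ?_
  have hi := Finset.mem_range.1 hi
  have : c i = 0 := by
    by_cases h : i < n
    · exact hci.1 i h
    · have := hci.2 (n - 1 - 1 - (i - n)) (by omega)
      rwa [show n + (n - 1 - 1 - (n - 1 - 1 - (i - n))) = i by omega] at this
  rw [this, C_0, zero_mul]

/-- The module `V₂` is simple, which gives one inclusion. Conversely, a projective class is an
integer combination of the `P_r`, and every `P_r` and every `V_r` is a polynomial in `[V₂]`. -/
theorem range_aeval_V₂ : (aeval (R := ℤ) (greenClass (V₂ q n))).toRingHom.range =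
    projectiveClassRing k (SmallQuantumGroup q n) := by
  have h2 : 2 < n := Fact.out
  refine le_antisymm ?_ (Subring.closure_le.2 ?_)
  · rintro _ ⟨f, rfl⟩
    have hy : greenClass (V₂ q n) ∈ projectiveClassRing k (SmallQuantumGroup q n) := by
      rw [← greenClass_eq (iso_V₂ (q := q) h2.le)]
      exact Subring.subset_closure ⟨_, .inr (isSimpleModule_simpleMod (by omega)), rfl⟩
    change aeval (greenClass (V₂ q n)) f ∈ _
    rw [aeval_eq_sum_range]
    exact sum_mem fun i _ => zsmul_mem (pow_mem hy i) _
  · rintro _ ⟨M, hM | hM, rfl⟩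
    · rw [greenClass_of_projective M hM]
      refine sum_mem fun i hi => zsmul_mem ?_ _
      have hi := Finset.mem_range.1 hi
      by_cases h : i + 1 = n
      · exact ⟨_, (aeval_secondPoly (q := q) (n := n)).trans (by rw [h])⟩
      · refine ⟨_, (aeval_classPoly_add (q := q) (j := n - 1 - 1 - i) (by omega)).trans ?_⟩
        congr 1
        omega
    · obtain ⟨r, hr, h1, ⟨e⟩⟩ := exists_equiv_simpleMod (q := q) (n := n) (M := M)
      rw [← greenClass_eq (V := simpleMod q n r hr) ⟨e⟩, ← simpleClass_eq hr]
      refine ⟨_, (aeval_chebyshev_S (q := q) (r := r - 1) (by omega)).trans ?_⟩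
      rw [Nat.sub_add_cancel h1]

end SmallQuantumGroup

end

theorem theorem4p2p8 {k : Type u} [Field k] [IsAlgClosed k] [CharZero k] (n : ℕ) (q : k)
    [Fact (2 < n)] [Fact (Odd n)] [Fact (orderOf q = n ∨ orderOf q = 2 * n)] :
    ∃ φ : (ℤ[X] ⧸ Ideal.span {(firstPoly n - 2) * secondPoly n}) ≃+*
        projectiveClassRing k (SmallQuantumGroup q n),
      ((φ (Ideal.Quotient.mk _ Polynomial.X) :
          projectiveClassRing k (SmallQuantumGroup q n)) : GreenRing k (SmallQuantumGroup q n)) =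
        greenClass (SmallQuantumGroup.V₂ q n) := by
  refine ⟨(Ideal.quotEquivOfEq SmallQuantumGroup.ker_aeval_V₂.symm).trans
    ((RingHom.quotientKerEquivRange
      (Polynomial.aeval (R := ℤ) (greenClass (SmallQuantumGroup.V₂ q n))).toRingHom).trans
      (RingEquiv.subringCongr SmallQuantumGroup.range_aeval_V₂)), ?_⟩
  exact Polynomial.aeval_X _
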